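/- Let $n\ge 0$, $N=n(n+1)/2$, and let $w=(i_1,\dots,i_N)$ be a reduced decomposition $\omega_0=s_{i_1}\cdots s_{i_N}$ of the longest element of $S_{n+1}$. **String diagram.** Start with $n+1$ vertical strings $U_1,\dots,U_{n+1}$ (numbered from left to right at the top) and, going downwards for $p=1,\dots,N$, exchange the strings in positions $i_p$ and $i_p+1$. This gives the crossing $t_p$, which lies "in column $i_p$". Let $b_s$ be the lower end of $U_s$. For $1\le k\le n$ orient $U_1,\dots,U_k$ upward and the other strings downward. A *rigorous path* for $k$ is an oriented path from $b_k$ to $b_{k+1}$ meeting no vertex twice, and never going straight through a crossing along one string towards the left when both strings at that crossing are oriented upward or both are oriented downward. It defines the *string inequality* $\sum_p a_px_p\ge 0$, where $a_p=1$ (resp. $-1$) if the path switches at $t_p$ from $U_s$ to $U_{s'}$ with $s<s'$ (resp. $s>s'$), and $a_p=0$ otherwise. The *$\lambda$-inequality* $\lambda_p$ is $x_p\le 2+\sum_{q>p}c_qx_q$, where $c_q=1$ if $|i_q-i_p|=1$, $c_q=-2$ if $i_q=i_p$, and $c_q=0$ otherwise. Write all these inequalities $d$ as $\sum_p m_{d,p}x_p\le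 0$ or $2$, and put $T^d=\prod_p t_p^{m_{d,p}}$. **Parameter space.** A *box* is a pair of consecutive crossings $t_{\rm top}$ (above), $t_{\rm bot}$ (below) of one column. Let $P_w$ be the closed subscheme of the torus $\operatorname{Spec}\mathbb C[a_d^{\pm1}]$ ($d$ running over all inequalities above) defined by the *combinatorial box equations* $a_{p_1}a_{\lambda_{\rm top}}=a_{p_2}a_{\lambda_{\rm bot}}$, one for every box and all string inequalities $p_1,p_2$ such that $T^{p_1}T^{\lambda_{\rm top}}=T^{p_2}T^{\lambda_{\rm bot}}$, the $t_{\rm top}$-degree of $T^{p_1}$ is $-1$ and the $t_{\rm bot}$-degree of $T^{p_2}$ is $1$. **Proposition.** Let $w,w'$ be reduced decompositions of $\omega_0$ that differ by a single braid move, and denote by $a_d$, $a'_{d'}$ the coordinates of the two coefficient tori. Then there is an isomorphism $P_w\cong P_{w'}$ of schemes over $\mathbb C$ under which every coordinate $a'_{d'}$ pulls back to the Laurent monomial in the $a_d$ given below, and its inverse is given by the same formulas with the roles of $w$ and $w'$ exchanged. In particular each formula determines exactly one monomial. 1. *2-move* (letters at the consecutive places $i,j$, differing by more than $1$, are exchanged):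 $a'_{\lambda_l}=a_{\lambda_{\sigma(l)}}$, where $\sigma$ is the transposition of $i$ and $j$, and for string inequalities $a'_{d'}=a_d$, where the exponent vector of $d$ is that of $d'$ with coordinates $i$ and $j$ exchanged. 2. *3-move* (letters $(c,e,c)$ with $|c-e|=1$ at the consecutive places $i,j,k$ are replaced by $(e,c,e)$): with $C=a_{\lambda_k}/a_{\lambda_i}$, $$a'_{\lambda_i}=a_{\lambda_j}C^{-2},\qquad a'_{\lambda_j}=a_{\lambda_k}C,\qquad a'_{\lambda_k}=a_{\lambda_j}C^{-1},\qquad a'_{\lambda_l}=a_{\lambda_l}C^{x-y}\quad(l\ne i,j,k),$$ where $x,y$ are the exponents of $t_i$, $t_j$ in $T^{\lambda_l}$ (for $w$). For a string inequality $d'$ of $w'$ one has $a'_{d'}=a_dC^{\varepsilon}$, where $d$ is the string inequality of $w$ whose exponents outside $i,j,k$ are those of $d'$, and whose exponents at $(i,j,k)$, together with $\varepsilon$, are determined by those of $d'$ as follows: | $d'$ at $(i,j,k)$ | $d$ at $(i,j,k)$ | $\varepsilon$ | |---|---|---| | $(0,0,0)$ | $(0,0,0)$ | $0$ | | $(0,-1,0)$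 | $(-1,0,-1)$ | $-1$ | | $(-1,0,-1)$ | $(0,-1,0)$ | $1$ | | $(0,1,0)$ | $(1,0,1)$ | $1$ | | $(1,0,1)$ | $(0,1,0)$ | $-1$ | | $(-1,1,-1)$ | $(1,-1,1)$ | $2$ | | $(1,-1,1)$ | $(-1,1,-1)$ | $-2$ | | $(-1,0,0)$ | $(0,0,-1)$ | $0$ | | $(0,-1,1)$ | $(0,0,-1)$ | $-1$ | | $(0,0,1)$ | $(1,0,0)$ | $0$ | | $(-1,1,0)$ | $(1,0,0)$ | $1$ | | $(1,0,0)$ | $(0,0,1)$ | $0$ | | $(0,0,-1)$ | $(-1,0,0)$ | $0$ | -/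

import Mathlib

open CategoryTheory AlgebraicGeometry

noncomputable section

namespace StringDiagram

/-- The simple transposition `s_c` of the `n + 1` columns, exchanging `c` and `c + 1`. Columns and
strings are numbered from `0`. -/
def simpleSwap {n : ℕ} (c : Fin n) : Equiv.Perm (Fin (n + 1)) :=
  Equiv.swap c.castSucc c.succ

/-- The word `w` is a reduced decomposition `s_{w 0} s_{w 1} ⋯ s_{w (N-1)}` of the longest
permutation `x ↦ n - x`, whose Coxeter length is `n (n + 1) / 2`. -/
structure IsReducedWord {n N : ℕ} (w : Fin N → Fin n) : Prop where
  length_eq : N = n * (n + 1) / 2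
  prod_eq : (List.ofFn fun p => simpleSwap (w p)).prod = Fin.revPerm

/-- `config w p c` is the string found in column `c` of the string diagram after the first `p`
exchanges (strings are named by their column at the top). -/
def config {n N : ℕ} (w : Fin N → Fin n) (p : ℕ) : Equiv.Perm (Fin (n + 1)) :=
  ((List.ofFn fun q => simpleSwap (w q)).take p).prod

/-- The string that arrives at the crossing `t_p` from the upper left (and leaves to the lower
right). -/
def leftString {n N : ℕ} (w : Fin N → Fin n) (p : Fin N) : Fin (n + 1) :=
  config w p (w p).castSucc

/-- The string that arrives at the crossing `t_p` from the upper right (and leaves to the lower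
left). -/
def rightString {n N : ℕ} (w : Fin N → Fin n) (p : Fin N) : Fin (n + 1) :=
  config w p (w p).succ

/-- The string `s` passes through the crossing `t_p`. -/
def Passes {n N : ℕ} (w : Fin N → Fin n) (p : Fin N) (s : Fin (n + 1)) : Prop :=
  s = leftString w p ∨ s = rightString w p

/-- In the orientation attached to `k : Fin n`, the strings `0, …, k` are oriented upward
(the others downward). -/
def Upward {n : ℕ} (k : Fin n) (s : Fin (n + 1)) : Prop :=
  s ≤ k.castSucc

/-- The string `s` joins the crossing `t_p` directly to the crossing `t_q`, in the direction in
which `s` is oriented. -/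
def Segment {n N : ℕ} (w : Fin N → Fin n) (k : Fin n) (s : Fin (n + 1)) (p q : Fin N) : Prop :=
  Passes w p s ∧ Passes w q s ∧
    ((Upward k s ∧ q < p ∧ ∀ r, q < r → r < p → ¬ Passes w r s) ∨
      (¬ Upward k s ∧ p < q ∧ ∀ r, p < r → r < q → ¬ Passes w r s))

/-- `t_p` is the lowest crossing on the string `s`, i.e. it is joined directly to the lower end
`b_s` of `s`. -/
def IsLowest {n N : ℕ} (w : Fin N → Fin n) (s : Fin (n + 1)) (p : Fin N) : Prop :=
  Passes w p s ∧ ∀ q, Passes w q s → q ≤ p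

/-- The passage of a path through a crossing: it arrives on the string `inc` and leaves on the
string `out`. -/
structure Step (n N : ℕ) where
  vertex : Fin N
  inc : Fin (n + 1)
  out : Fin (n + 1)

/-- A bad fragment: the path goes straight on along one string to the left, while the two strings
at the crossing are both oriented upward or both oriented downward. -/
def Step.IsBad {n N : ℕ} (w : Fin N → Fin n) (k : Fin n) (st : Step n N) : Prop :=
  st.inc = st.out ∧
    ((Upward k (leftString w st.vertex) ∧ Upward k (rightString w st.vertex) ∧
        st.inc = leftString w st.vertex) ∨
      (¬ Upward k (leftString w st.vertex) ∧ ¬ Upward k (rightString w st.vertex) ∧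
        st.inc = rightString w st.vertex))

/-- A rigorous path for `k`: an oriented path from `b_k` (lower end of the string `k`) to
`b_{k+1}` (lower end of the string `k + 1`), given by the crossings it runs through, which meets no
crossing twice and avoids the bad fragments. -/
structure IsRigorousPath {n N : ℕ} (w : Fin N → Fin n) (k : Fin n) (L : List (Step n N)) :
    Prop where
  start : ∃ st ∈ L.head?, st.inc = k.castSucc ∧ IsLowest w k.castSucc st.vertex
  finish : ∃ st ∈ L.getLast?, st.out = k.succ ∧ IsLowest w k.succ st.vertex
  passes : ∀ st ∈ L, Passes w st.vertex st.inc ∧ Passes w st.vertex st.out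
  chain : L.IsChain fun a b => a.out = b.inc ∧ Segment w k a.out a.vertex b.vertex
  nodup : (L.map Step.vertex).Nodup
  not_bad : ∀ st ∈ L, ¬ st.IsBad w k

/-- The coefficient contributed to the string inequality `∑ a_p x_p ≥ 0`: `1` for a switch to a
string of larger index, `-1` for a switch to a string of smaller index. -/
def Step.sign {n N : ℕ} (st : Step n N) : ℤ :=
  if st.inc < st.out then 1 else if st.out < st.inc then -1 else 0

/-- The exponent vector `M` of the string inequality of a path, written as `∑ M_p x_p ≤ 0`. -/
def pathExponent {n N : ℕ} (L : List (Step n N)) (p : Fin N) : ℤ :=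
  -(L.map fun st => if st.vertex = p then st.sign else 0).sum

/-- The set of all string inequalities, each given by its exponent vector. -/
def stringExponents {n N : ℕ} (w : Fin N → Fin n) : Set (Fin N → ℤ) :=
  {m | ∃ (k : Fin n) (L : List (Step n N)), IsRigorousPath w k L ∧ m = pathExponent L}

/-- The exponent vector of the `λ`-inequality attached to `t_p`, that is of
`x_p - ∑_{q > p} c_q x_q ≤ 2`, where `c_q` is `1` if `t_q` is one column to the left or right of
`t_p`, is `-2` if `t_q` is in the column of `t_p`, and is `0` otherwise. -/
def lambdaExponent {n N : ℕ} (w : Fin N → Fin n) (p q : Fin N) : ℤ :=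
  if q = p then 1
  else if q < p then 0
  else if w q = w p then 2
  else if (w q : ℕ) + 1 = w p ∨ (w p : ℕ) + 1 = w q then -1
  else 0

/-- The inequalities defining the polytope `Δ`: `Sum.inl p` is the `λ`-inequality of `t_p`, and
`Sum.inr m` is the string inequality with exponent vector `m`. -/
abbrev Ineq {n N : ℕ} (w : Fin N → Fin n) : Type :=
  Fin N ⊕ stringExponents w

/-- The Laurent polynomial ring `ℂ[a_d, a_d⁻¹]`, `d` running over all defining inequalities. -/
abbrev TorusRing {n N : ℕ} (w : Fin N → Fin n) : Type :=
  AddMonoidAlgebra ℂ (Ineq w →₀ ℤ)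

/-- The Laurent monomial `∏_d a_d ^ (u d)`. -/
def monom {n N : ℕ} (w : Fin N → Fin n) (u : Ineq w →₀ ℤ) : TorusRing w :=
  AddMonoidAlgebra.single u 1

/-- The coefficient `a_d`. -/
def coeff {n N : ℕ} (w : Fin N → Fin n) (d : Ineq w) : TorusRing w :=
  monom w (Finsupp.single d 1)

/-- A box (bounded region) of the string diagram is bounded above by `t_top` and below by `t_bot`,
two consecutive crossings of one column. -/
def IsBox {n N : ℕ} (w : Fin N → Fin n) (top bot : Fin N) : Prop :=
  top < bot ∧ w top = w bot ∧ ∀ r, top < r → r < bot → w r ≠ w top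

/-- The box conditions for the string inequalities `p₁`, `p₂` and the box between `t_top` and
`t_bot`. -/
def BoxCondition {n N : ℕ} (w : Fin N → Fin n) (top bot : Fin N)
    (p₁ p₂ : stringExponents w) : Prop :=
  IsBox w top bot ∧
    p₁.1 + lambdaExponent w top = p₂.1 + lambdaExponent w bot ∧
    p₁.1 top = -1 ∧ p₂.1 bot = 1

/-- The ideal generated by the combinatorial box equations
`a_{p₁} a_{λ_top} = a_{p₂} a_{λ_bot}`. -/
def boxIdeal {n N : ℕ} (w : Fin N → Fin n) : Ideal (TorusRing w) :=
  Ideal.span {f | ∃ (top bot : Fin N) (p₁ p₂ : stringExponents w),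
    BoxCondition w top bot p₁ p₂ ∧
    f = coeff w (Sum.inr p₁) * coeff w (Sum.inl top) -
      coeff w (Sum.inr p₂) * coeff w (Sum.inl bot)}

/-- The coordinate ring of the parameter space. -/
abbrev ParamRing {n N : ℕ} (w : Fin N → Fin n) : Type :=
  TorusRing w ⧸ boxIdeal w

/-- The parameter space `P`: the closed subscheme of the coefficient torus cut out by the
combinatorial box equations, as a scheme over `ℂ`. -/
def paramSpace {n N : ℕ} (w : Fin N → Fin n) : Over (Spec (CommRingCat.of ℂ)) :=
  Over.mk (Spec.map (CommRingCat.ofHom (algebraMap ℂ (ParamRing w))))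

/-- The Laurent monomial `∏_d a_d ^ (u d)` as a function on the parameter space. -/
def paramMonom {n N : ℕ} (w : Fin N → Fin n) (u : Ineq w →₀ ℤ) : ParamRing w :=
  Ideal.Quotient.mk (boxIdeal w) (monom w u)

/-- The coefficient `a_d` as a function on the parameter space. -/
def paramCoeff {n N : ℕ} (w : Fin N → Fin n) (d : Ineq w) : ParamRing w :=
  Ideal.Quotient.mk (boxIdeal w) (coeff w d)

/-- `w'` arises from `w` by exchanging the consecutive letters at `i`, `j`, which are the indices
of non-adjacent columns. -/
structure TwoMove {n N : ℕ} (w w' : Fin N → Fin n) (i j : Fin N) : Prop where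
  hj : (j : ℕ) = i + 1
  far : (w i : ℕ) + 1 < w j ∨ (w j : ℕ) + 1 < w i
  left : w' i = w j
  right : w' j = w i
  other : ∀ q, q ≠ i → q ≠ j → w' q = w q

/-- `w'` arises from `w` by replacing the consecutive letters `(a, b, a)` at `i`, `j`, `k` by
`(b, a, b)`, where `|a - b| = 1`. -/
structure ThreeMove {n N : ℕ} (w w' : Fin N → Fin n) (i j k : Fin N) : Prop where
  hj : (j : ℕ) = i + 1
  hk : (k : ℕ) = i + 2
  same : w k = w i
  adjacent : (w i : ℕ) + 1 = w j ∨ (w j : ℕ) + 1 = w i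
  left : w' i = w j
  middle : w' j = w i
  right : w' k = w j
  other : ∀ q, q ≠ i → q ≠ j → q ≠ k → w' q = w q

/-- The monomial formulas for a 2-move: `CoeffRule₂ w w' i j d' u` says that the coefficient
`a'_{d'}` is `∏_d a_d ^ (u d)`. It is the coefficient of the inequality obtained from `d'` by
exchanging the coordinates `i` and `j`. -/
inductive CoeffRule₂ {n N : ℕ} (w w' : Fin N → Fin n) (i j : Fin N) :
    Ineq w' → (Ineq w →₀ ℤ) → Prop
  | lam (l : Fin N) :
      CoeffRule₂ w w' i j (Sum.inl l) (Finsupp.single (Sum.inl (Equiv.swap i j l)) 1)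
  | str (d' : stringExponents w') (d : stringExponents w)
      (h : ∀ q, d'.1 q = d.1 (Equiv.swap i j q)) :
      CoeffRule₂ w w' i j (Sum.inr d') (Finsupp.single (Sum.inr d) 1)

/-- The exponent vector of `C = a_{λ_k} / a_{λ_i}`. -/
def ratio {n N : ℕ} (w : Fin N → Fin n) (i k : Fin N) : Ineq w →₀ ℤ :=
  Finsupp.single (Sum.inl k) 1 - Finsupp.single (Sum.inl i) 1

/-- The exchange of string monomial pieces under a 3-move. An entry
`((x, y, z), (x', y', z'), e)` means: a string monomial of `w'` with piece
`t_i ^ x' t_j ^ y' t_k ^ z'` comes from the one of `w` with piece `t_i ^ x t_j ^ y t_k ^ z`, and the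
coefficient is multiplied by `C ^ e`. -/
def pieceTable : List ((ℤ × ℤ × ℤ) × (ℤ × ℤ × ℤ) × ℤ) :=
  [((0, 0, 0), (0, 0, 0), 0),
   ((-1, 0, -1), (0, -1, 0), -1),
   ((0, -1, 0), (-1, 0, -1), 1),
   ((1, 0, 1), (0, 1, 0), 1),
   ((0, 1, 0), (1, 0, 1), -1),
   ((1, -1, 1), (-1, 1, -1), 2),
   ((-1, 1, -1), (1, -1, 1), -2),
   ((0, 0, -1), (-1, 0, 0), 0),
   ((0, 0, -1), (0, -1, 1), -1),
   ((1, 0, 0), (0, 0, 1), 0),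
   ((1, 0, 0), (-1, 1, 0), 1),
   ((0, 0, 1), (1, 0, 0), 0),
   ((-1, 0, 0), (0, 0, -1), 0)]

/-- The monomial formulas for a 3-move: `CoeffRule₃ w w' i j k d' u` says that the coefficient
`a'_{d'}` is `∏_d a_d ^ (u d)`. With `C = a_{λ_k} / a_{λ_i}` the rules read
`a'_{λ_i} = a_{λ_j} C⁻²`, `a'_{λ_k} = a_{λ_j} C⁻¹`, `a'_{λ_j} = a_{λ_k} C`; further
`a'_{λ_l} = a_{λ_l} C ^ (x - y)` for the other `l`, where `t_i ^ x t_j ^ y t_k ^ x` is the piece of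
the monomial of `λ_l` before the move; and for string inequalities `a'_{d'} = a_d C ^ e`, where `d`
and `d'` agree outside `i, j, k` and their pieces and `e` are as in the table. -/
inductive CoeffRule₃ {n N : ℕ} (w w' : Fin N → Fin n) (i j k : Fin N) :
    Ineq w' → (Ineq w →₀ ℤ) → Prop
  | lam_i : CoeffRule₃ w w' i j k (Sum.inl i)
      (Finsupp.single (Sum.inl j) 1 + (-2 : ℤ) • ratio w i k)
  | lam_k : CoeffRule₃ w w' i j k (Sum.inl k)
      (Finsupp.single (Sum.inl j) 1 + (-1 : ℤ) • ratio w i k)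
  | lam_j : CoeffRule₃ w w' i j k (Sum.inl j)
      (Finsupp.single (Sum.inl k) 1 + (1 : ℤ) • ratio w i k)
  | lam_other (l : Fin N) (hi : l ≠ i) (hj : l ≠ j) (hk : l ≠ k) :
      CoeffRule₃ w w' i j k (Sum.inl l)
        (Finsupp.single (Sum.inl l) 1 +
          (lambdaExponent w l i - lambdaExponent w l j) • ratio w i k)
  | str (d' : stringExponents w') (d : stringExponents w) (e : ℤ)
      (hout : ∀ q, q ≠ i → q ≠ j → q ≠ k → d'.1 q = d.1 q)
      (hpiece : ((d.1 i, d.1 j, d.1 k), (d'.1 i, d'.1 j, d'.1 k), e) ∈ pieceTable) :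
      CoeffRule₃ w w' i j k (Sum.inr d') (Finsupp.single (Sum.inr d) 1 + e • ratio w i k)

/-- The parameter spaces of `w` and `w'` are isomorphic over `ℂ`, the isomorphism `g : P ≅ P'`
being given on coordinate rings by `φ`, which expresses every coefficient `a'_{d'}` as the unique
Laurent monomial in the `a_d` prescribed by `R`, while the inverse expresses every `a_d` as the
unique Laurent monomial in the `a'_{d'}` prescribed by `R'`. -/
def IsoByMonomials {n N : ℕ} (w w' : Fin N → Fin n)
    (R : Ineq w' → (Ineq w →₀ ℤ) → Prop) (R' : Ineq w → (Ineq w' →₀ ℤ) → Prop) : Prop :=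
  (∀ d', ∃! u, R d' u) ∧ (∀ d, ∃! u', R' d u') ∧
  ∃ (g : paramSpace w ≅ paramSpace w') (φ : ParamRing w' ≃ₐ[ℂ] ParamRing w),
    g.hom.left = Spec.map (CommRingCat.ofHom (φ : ParamRing w' →+* ParamRing w)) ∧
    g.inv.left = Spec.map (CommRingCat.ofHom (φ.symm : ParamRing w →+* ParamRing w')) ∧
    (∀ d' u, R d' u → φ (paramCoeff w' d') = paramMonom w u) ∧
    (∀ d u', R' d u' → φ.symm (paramCoeff w d) = paramMonom w' u')

end StringDiagram

end

/-! The proof replaces rigorous paths by flows, for which a braid move is a local change. Read an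
exponent vector `m` as moving `m p` units, at the crossing `t_p`, from the right string to the left
one. Starting from zero at the top this determines a `flux` on every piece of every string. The
vector of a rigorous path has flux `-1` on the upward pieces that the path uses, `1` on the downward
ones and `0` elsewhere, and it satisfies the conditions of `IsFlow`: bounds on the flux, values at
the bottom, and one condition at each crossing.

Conversely every `IsFlow` comes from a rigorous path (`IsFlow.mem_stringExponents`). In a reduced
word two strings cross once, which makes the oriented diagram acyclic (`exists_rank`). Hence
following the flow from `b_k` must end at `b_{k+1}`, no closed loop can remain beside that path, and
the vector of the path is `m`. Acyclicity also gives `NoBypass`: a path running directly from one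
crossing to another misses every crossing lying between them in the orientation.

A flow may therefore be changed inside a window as long as the flux leaving the window and the
conditions inside are right (`IsFlow.replace`). For a 2-move the two crossings share no string, and
swapping coordinates suffices. For a 3-move the window is a triangle formed by strings `x < y < z`;
the orientations, incoming fluxes and exchanged amounts have finitely many values, and a finite
check shows that each piece has the replacement listed in the table.

The table is not injective on pieces. Two pieces of one word can come from the same piece of the
other; they then differ by `(1, -1, 1)`, the piece of `λ_i - λ_k`, and a box equation for the small
box between `t_i` and `t_k` relates their coefficients. So `a_d C ^ e` is independent of the chosen
row only modulo box equations (`ThreeMove.class_unique`), and the two substitutions are inverse only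
modulo box equations.

Since the ideals are generated by differences of two monomials, everything takes place in the
exponent lattice modulo `boxGroup`. It remains to see that box equations go to box equations
(`ThreeMove.substitution_box`). The small box gives an identity; a box ending or starting at the
move is carried to one ending or starting at another of the three crossings; a box beside the move
stays, and the two pieces change compatibly. Exactly one pair of pieces would fail in the last case,
and `exclusion_of_box` rules it out by comparing the fluxes of both flows along the side of the box.
-/

noncomputable section

namespace StringDiagram

/-! ### Monomial substitutions and the exponent lattice modulo box equations -/

section

variable {n N : ℕ}

/-- The exponent vector of the quotient of the two sides of a box equation. -/
def boxVector (w : Fin N → Fin n) (top bot : Fin N) (p₁ p₂ : stringExponents w) : Ineq w →₀ ℤ :=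
  Finsupp.single (Sum.inr p₁) 1 + Finsupp.single (Sum.inl top) 1 -
    (Finsupp.single (Sum.inr p₂) 1 + Finsupp.single (Sum.inl bot) 1)

/-- The group of exponent vectors generated by the box equations. -/
def boxGroup (w : Fin N → Fin n) : AddSubgroup (Ineq w →₀ ℤ) :=
  AddSubgroup.closure {u | ∃ (top bot : Fin N) (p₁ p₂ : stringExponents w),
    BoxCondition w top bot p₁ p₂ ∧ u = boxVector w top bot p₁ p₂}

theorem monom_add (w : Fin N → Fin n) (u v : Ineq w →₀ ℤ) :
    monom w (u + v) = monom w u * monom w v := by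
  simp [monom, AddMonoidAlgebra.single_mul_single]

theorem paramMonom_add (w : Fin N → Fin n) (u v : Ineq w →₀ ℤ) :
    paramMonom w (u + v) = paramMonom w u * paramMonom w v := by
  simp [paramMonom, monom_add]

theorem paramMonom_zero (w : Fin N → Fin n) : paramMonom w 0 = 1 := by
  simp [paramMonom, monom, ← AddMonoidAlgebra.one_def]

theorem paramMonom_box (w : Fin N → Fin n) {top bot : Fin N} {p₁ p₂ : stringExponents w}
    (h : BoxCondition w top bot p₁ p₂) : paramMonom w (boxVector w top bot p₁ p₂) = 1 := by
  have h1 : paramMonom w (Finsupp.single (Sum.inr p₁) 1 + Finsupp.single (Sum.inl top) 1) =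
      paramMonom w (Finsupp.single (Sum.inr p₂) 1 + Finsupp.single (Sum.inl bot) 1) := by
    unfold paramMonom
    rw [Ideal.Quotient.eq, monom_add, monom_add]
    exact Ideal.subset_span ⟨top, bot, p₁, p₂, h, rfl⟩
  rw [boxVector, sub_eq_add_neg, paramMonom_add, h1, ← paramMonom_add, add_neg_cancel,
    paramMonom_zero]

theorem paramMonom_eq_one (w : Fin N → Fin n) {u : Ineq w →₀ ℤ} (hu : u ∈ boxGroup w) :
    paramMonom w u = 1 := by
  induction hu using AddSubgroup.closure_induction with
  | mem x hx =>
    obtain ⟨top, bot, p₁, p₂, h, rfl⟩ := hx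
    exact paramMonom_box w h
  | zero => exact paramMonom_zero w
  | add x y _ _ hx hy => rw [paramMonom_add, hx, hy, one_mul]
  | neg x _ hx =>
    have := paramMonom_add w x (-x)
    rwa [add_neg_cancel, paramMonom_zero, hx, one_mul, eq_comm] at this

/-- Monomials are units, so a box equation says that a quotient of monomials is `1`. All later
verifications thereby become additive statements about exponents. -/
theorem paramMonom_congr (w : Fin N → Fin n) {u v : Ineq w →₀ ℤ} (h : u - v ∈ boxGroup w) :
    paramMonom w u = paramMonom w v := by
  rw [← sub_add_cancel u v, paramMonom_add, paramMonom_eq_one w h, one_mul]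

/-- The homomorphism of exponent lattices that sends the basis vector of `d` to `U d`. -/
def substitution {w w' : Fin N → Fin n} (U : Ineq w' → (Ineq w →₀ ℤ)) :
    (Ineq w' →₀ ℤ) →+ (Ineq w →₀ ℤ) :=
  (Finsupp.linearCombination ℤ U).toAddMonoidHom

@[simp] theorem substitution_single {w w' : Fin N → Fin n} (U : Ineq w' → (Ineq w →₀ ℤ))
    (d : Ineq w') (a : ℤ) : substitution U (Finsupp.single d a) = a • U d := by
  simp [substitution]

/-- A substitution of Laurent monomials as a homomorphism from the coefficient torus ring. -/
def torusHom {w w' : Fin N → Fin n} (U : Ineq w' → (Ineq w →₀ ℤ)) :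
    TorusRing w' →ₐ[ℂ] ParamRing w :=
  (Ideal.Quotient.mkₐ ℂ (boxIdeal w)).comp (AddMonoidAlgebra.mapDomainAlgHom ℂ ℂ (substitution U))

theorem torusHom_monom {w w' : Fin N → Fin n} (U : Ineq w' → (Ineq w →₀ ℤ)) (u : Ineq w' →₀ ℤ) :
    torusHom U (monom w' u) = paramMonom w (substitution U u) := by
  simp [torusHom, paramMonom, monom, AddMonoidAlgebra.mapDomain_single]

theorem torusHom_eq_zero {w w' : Fin N → Fin n} {U : Ineq w' → (Ineq w →₀ ℤ)}
    (hbox : ∀ top bot p₁ p₂, BoxCondition w' top bot p₁ p₂ →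
      substitution U (boxVector w' top bot p₁ p₂) ∈ boxGroup w) (a : TorusRing w')
    (ha : a ∈ boxIdeal w') : torusHom U a = 0 := by
  have hle : boxIdeal w' ≤ RingHom.ker (torusHom U) := by
    rw [boxIdeal, Ideal.span_le]
    rintro _ ⟨top, bot, p₁, p₂, h, rfl⟩
    rw [SetLike.mem_coe, RingHom.mem_ker, map_sub, sub_eq_zero]
    simp only [coeff, ← monom_add]
    rw [torusHom_monom, torusHom_monom]
    apply paramMonom_congr
    rw [← map_sub]
    exact hbox _ _ _ _ h
  exact hle ha

/-- A substitution of Laurent monomials compatible with the box equations, as a homomorphism of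
coordinate rings. -/
def substitutionHom {w w' : Fin N → Fin n} (U : Ineq w' → (Ineq w →₀ ℤ))
    (hbox : ∀ top bot p₁ p₂, BoxCondition w' top bot p₁ p₂ →
      substitution U (boxVector w' top bot p₁ p₂) ∈ boxGroup w) :
    ParamRing w' →ₐ[ℂ] ParamRing w :=
  Ideal.Quotient.liftₐ (boxIdeal w') (torusHom U) (torusHom_eq_zero hbox)

theorem substitutionHom_paramMonom {w w' : Fin N → Fin n} (U : Ineq w' → (Ineq w →₀ ℤ))
    (hbox : ∀ top bot p₁ p₂, BoxCondition w' top bot p₁ p₂ →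
      substitution U (boxVector w' top bot p₁ p₂) ∈ boxGroup w) (u : Ineq w' →₀ ℤ) :
    substitutionHom U hbox (paramMonom w' u) = paramMonom w (substitution U u) :=
  torusHom_monom U u

theorem paramRing_hom_ext {w : Fin N → Fin n} {A : Type*} [CommRing A] [Algebra ℂ A]
    {f g : ParamRing w →ₐ[ℂ] A} (h : ∀ u, f (paramMonom w u) = g (paramMonom w u)) : f = g := by
  apply Ideal.Quotient.algHom_ext
  apply AddMonoidAlgebra.algHom_ext
  · intro u
    exact h u
  · ext

/-- Both maps are additive on exponents, so it is enough to recover each single coefficient, and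
only modulo the box equations. -/
theorem substitutionHom_comp {w w' : Fin N → Fin n} {U : Ineq w' → (Ineq w →₀ ℤ)}
    {V : Ineq w → (Ineq w' →₀ ℤ)}
    (hU : ∀ top bot p₁ p₂, BoxCondition w' top bot p₁ p₂ →
      substitution U (boxVector w' top bot p₁ p₂) ∈ boxGroup w)
    (hV : ∀ top bot p₁ p₂, BoxCondition w top bot p₁ p₂ →
      substitution V (boxVector w top bot p₁ p₂) ∈ boxGroup w')
    (h : ∀ d, substitution V (U d) - Finsupp.single d 1 ∈ boxGroup w') :
    (substitutionHom V hV).comp (substitutionHom U hU) = AlgHom.id ℂ _ := by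
  apply paramRing_hom_ext
  intro u
  simp only [AlgHom.comp_apply, substitutionHom_paramMonom, AlgHom.id_apply]
  apply paramMonom_congr
  induction u using Finsupp.induction_linear with
  | zero => simp [zero_mem]
  | add f g hf hg =>
    rw [map_add, map_add, add_sub_add_comm]
    exact add_mem hf hg
  | single d a =>
    have : substitution V (substitution U (Finsupp.single d a)) - Finsupp.single d a =
        a • (substitution V (U d) - Finsupp.single d 1) := by
      rw [substitution_single, map_zsmul, smul_sub, Finsupp.smul_single_one]
    rw [this]
    exact zsmul_mem (h d) a

/-- The reduction of the geometric statement to lattice statements: the rules are the graphs of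
functions `U` and `V`, these respect the box equations, and they are mutually inverse modulo them.
-/
theorem isoByMonomials_of_substitution {w w' : Fin N → Fin n}
    {R : Ineq w' → (Ineq w →₀ ℤ) → Prop} {R' : Ineq w → (Ineq w' →₀ ℤ) → Prop}
    {U : Ineq w' → (Ineq w →₀ ℤ)} {V : Ineq w → (Ineq w' →₀ ℤ)}
    (hR : ∀ d u, R d u ↔ u = U d) (hR' : ∀ d u, R' d u ↔ u = V d)
    (hU : ∀ top bot p₁ p₂, BoxCondition w' top bot p₁ p₂ →
      substitution U (boxVector w' top bot p₁ p₂) ∈ boxGroup w)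
    (hV : ∀ top bot p₁ p₂, BoxCondition w top bot p₁ p₂ →
      substitution V (boxVector w top bot p₁ p₂) ∈ boxGroup w')
    (hVU : ∀ d, substitution V (U d) - Finsupp.single d 1 ∈ boxGroup w')
    (hUV : ∀ d, substitution U (V d) - Finsupp.single d 1 ∈ boxGroup w) :
    IsoByMonomials w w' R R' := by
  refine ⟨fun d => ⟨U d, (hR _ _).2 rfl, fun u hu => (hR _ _).1 hu⟩,
    fun d => ⟨V d, (hR' _ _).2 rfl, fun u hu => (hR' _ _).1 hu⟩, ?_⟩
  let φ : ParamRing w' ≃ₐ[ℂ] ParamRing w :=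
    AlgEquiv.ofAlgHom (substitutionHom U hU) (substitutionHom V hV)
      (substitutionHom_comp hV hU hUV) (substitutionHom_comp hU hV hVU)
  let e : CommRingCat.of (ParamRing w') ≅ CommRingCat.of (ParamRing w) :=
    φ.toRingEquiv.toCommRingCatIso
  -- `Spec` reverses arrows, so the ring isomorphism from `w'` to `w` gives the map of spaces from
  -- `w` to `w'`. It is a map over `ℂ` because `φ` fixes the scalars.
  refine ⟨Over.isoMk (Scheme.Spec.mapIso e.op) ?_, φ, ?_, ?_, ?_, ?_⟩
  · simp only [paramSpace, Over.mk_hom]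
    change Spec.map e.hom ≫ _ = _
    rw [← Spec.map_comp]
    congr 1
    ext x
    exact φ.commutes x
  · rfl
  · rfl
  · intro d u h
    rw [hR] at h
    subst h
    have := substitutionHom_paramMonom U hU (Finsupp.single d 1)
    rw [substitution_single, one_smul] at this
    exact this
  · intro d u h
    rw [hR'] at h
    subst h
    have := substitutionHom_paramMonom V hV (Finsupp.single d 1)
    rw [substitution_single, one_smul] at this
    exact this

end

/-! ### Columns of strings, inversions, and the consequences of reducedness -/

section

variable {n N : ℕ}

theorem config_zero (w : Fin N → Fin n) : config w 0 = 1 := by simp [config]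

theorem config_succ (w : Fin N → Fin n) (p : Fin N) :
    config w (p + 1) = config w p * simpleSwap (w p) := by
  unfold config
  rw [List.prod_take_succ _ _ (by simp)]
  simp

theorem config_last {w : Fin N → Fin n} (hw : IsReducedWord w) : config w N = Fin.revPerm := by
  rw [← hw.prod_eq, config, List.take_of_length_le (by simp)]

/-- The column of the string `s` after the first `t` exchanges. -/
def column (w : Fin N → Fin n) (t : ℕ) (s : Fin (n + 1)) : Fin (n + 1) :=
  (config w t).symm s

theorem column_zero (w : Fin N → Fin n) (s : Fin (n + 1)) : column w 0 s = s := by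
  rw [column, config_zero]
  rfl

theorem column_succ (w : Fin N → Fin n) (p : Fin N) (s : Fin (n + 1)) :
    column w (p + 1) s = simpleSwap (w p) (column w p s) := by
  unfold column
  rw [config_succ, Equiv.symm_apply_eq]
  simp [simpleSwap, Equiv.Perm.mul_apply]

theorem eq_leftString_iff (w : Fin N → Fin n) (p : Fin N) (s : Fin (n + 1)) :
    s = leftString w p ↔ column w p s = (w p).castSucc := by
  rw [leftString, column, Equiv.symm_apply_eq]

theorem eq_rightString_iff (w : Fin N → Fin n) (p : Fin N) (s : Fin (n + 1)) :
    s = rightString w p ↔ column w p s = (w p).succ := by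
  rw [rightString, column, Equiv.symm_apply_eq]

theorem column_leftString (w : Fin N → Fin n) (p : Fin N) :
    column w p (leftString w p) = (w p).castSucc := (eq_leftString_iff w p _).1 rfl

theorem column_rightString (w : Fin N → Fin n) (p : Fin N) :
    column w p (rightString w p) = (w p).succ := (eq_rightString_iff w p _).1 rfl

theorem column_succ_left (w : Fin N → Fin n) (p : Fin N) :
    column w (p + 1) (leftString w p) = (w p).succ := by
  rw [column_succ, column_leftString, simpleSwap, Equiv.swap_apply_left]

theorem column_succ_right (w : Fin N → Fin n) (p : Fin N) :
    column w (p + 1) (rightString w p) = (w p).castSucc := by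
  rw [column_succ, column_rightString, simpleSwap, Equiv.swap_apply_right]

theorem leftString_ne_rightString (w : Fin N → Fin n) (p : Fin N) :
    leftString w p ≠ rightString w p := by
  intro h
  have := column_leftString w p
  rw [h, column_rightString] at this
  exact absurd this (Fin.castSucc_lt_succ).ne'

/-- Only the two strings of a crossing change their relative position there. -/
theorem column_lt_succ_iff (w : Fin N → Fin n) (p : Fin N) {a b : Fin (n + 1)}
    (h : ¬ (a = leftString w p ∧ b = rightString w p))
    (h' : ¬ (b = leftString w p ∧ a = rightString w p)) :
    column w (p + 1) a < column w (p + 1) b ↔ column w p a < column w p b := by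
  rw [eq_leftString_iff, eq_rightString_iff] at h h'
  rw [column_succ, column_succ]
  generalize column w p a = x at *
  generalize column w p b = y at *
  simp only [simpleSwap, Equiv.swap_apply_def]
  simp only [Fin.ext_iff, Fin.lt_def, Fin.val_castSucc, Fin.val_succ] at *
  split_ifs <;> simp <;> omega

/-- The pairs of strings that have been exchanged after the first `t` steps. -/
def inversions (w : Fin N → Fin n) (t : ℕ) : Finset (Fin (n + 1) × Fin (n + 1)) :=
  {x | x.1 < x.2 ∧ column w t x.2 < column w t x.1}

/-- Only the pair meeting at the crossing changes its order. If that pair was already inverted, the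
crossing restores its order and adds nothing. -/
theorem inversions_succ_subset (w : Fin N → Fin n) (p : Fin N) :
    inversions w (p + 1) ⊆ insert (leftString w p, rightString w p) (inversions w p) := by
  rintro ⟨a, b⟩ h
  simp only [inversions, Finset.mem_filter, Finset.mem_univ, true_and, Finset.mem_insert,
    Prod.mk.injEq] at h ⊢
  by_cases h1 : a = leftString w p ∧ b = rightString w p
  · exact Or.inl h1
  by_cases h2 : b = leftString w p ∧ a = rightString w p
  · obtain ⟨rfl, rfl⟩ := h2
    right
    refine ⟨h.1, ?_⟩
    have := h.2
    rw [column_succ_left, column_succ_right] at this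
    exact absurd this (Fin.castSucc_lt_succ).not_gt
  · exact Or.inr ⟨h.1, (column_lt_succ_iff w p h2 h1).1 h.2⟩

/-- The longest permutation inverts all pairs of the `n + 1` strings, and the length of the word is
exactly their number. -/
theorem card_inversions_last {w : Fin N → Fin n} (hw : IsReducedWord w) :
    (inversions w N).card = N := by
  have h1 : inversions w N = ({x | x.1 < x.2} : Finset (Fin (n + 1) × Fin (n + 1))) := by
    ext ⟨a, b⟩
    simp only [inversions, column, config_last hw, Finset.mem_filter, Finset.mem_univ, true_and,
      and_iff_left_iff_imp]
    intro h
    simpa using h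
  rw [h1]
  have h2 : ∀ m : ℕ, (({x | x.1 < x.2} : Finset (Fin m × Fin m))).card = m * (m - 1) / 2 := by
    intro m
    have h3 : (Finset.powersetCard 2 (Finset.univ : Finset (Fin m))).card = m.choose 2 := by simp
    rw [← Nat.choose_two_right, ← h3]
    refine Finset.card_bij (fun x _ => {x.1, x.2}) ?_ ?_ ?_
    · rintro ⟨a, b⟩ h
      simp only [Finset.mem_filter, Finset.mem_univ, true_and] at h
      simp [Finset.mem_powersetCard, Finset.card_pair h.ne]
    · rintro ⟨a, b⟩ h ⟨c, d⟩ h' he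
      simp only [Finset.mem_filter, Finset.mem_univ, true_and] at h h' he
      have e1 : a ∈ ({c, d} : Finset (Fin m)) := he ▸ by simp
      have e2 : b ∈ ({c, d} : Finset (Fin m)) := he ▸ by simp
      simp only [Finset.mem_insert, Finset.mem_singleton] at e1 e2
      rcases e1 with rfl | rfl <;> rcases e2 with rfl | rfl <;> simp_all
      exact absurd h' h.not_gt
    · intro s hs
      rw [Finset.mem_powersetCard, Finset.card_eq_two] at hs
      obtain ⟨-, a, b, hab, rfl⟩ := hs
      rcases lt_or_gt_of_ne hab with h | h
      · exact ⟨(a, b), by simpa using h, rfl⟩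
      · exact ⟨(b, a), by simpa using h, Finset.pair_comm _ _⟩
  rw [h2, hw.length_eq, Nat.add_sub_cancel, mul_comm]

/-- A counting argument: each of the `N` crossings creates at most one inversion and `N` inversions
are needed, so none may be wasted. A crossing of strings that are already exchanged creates none. -/
theorem leftString_lt_rightString {w : Fin N → Fin n} (hw : IsReducedWord w) (p : Fin N) :
    leftString w p < rightString w p := by
  by_contra hlt
  have step : ∀ q : Fin N, (inversions w (q + 1)).card ≤ (inversions w q).card + 1 := fun q =>
    (Finset.card_le_card (inversions_succ_subset w q)).trans (Finset.card_insert_le _ _)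
  have bad : (inversions w (p + 1)).card ≤ (inversions w p).card := by
    apply Finset.card_le_card
    intro x hx
    rcases Finset.mem_insert.1 (inversions_succ_subset w p hx) with rfl | h
    · simp only [inversions, Finset.mem_filter, Finset.mem_univ, true_and] at hx
      exact absurd hx.1 hlt
    · exact h
  have up : ∀ t ≤ N, (inversions w t).card ≤ t := by
    intro t
    induction t with
    | zero =>
      intro _
      have : inversions w 0 = ∅ := by
        ext x
        simp [inversions, column_zero]
        exact fun h => h.le
      simp [this]
    | succ t ih =>
      intro h
      have := step ⟨t, h⟩
      have := ih (by omega)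
      simp only at *
      omega
  -- After the wasted crossing `p` the count lags behind the number of steps and can never catch up.
  have down : ∀ t, (p : ℕ) < t → t ≤ N → (inversions w t).card < t := by
    intro t
    induction t with
    | zero => simp
    | succ t ih =>
      intro h1 h2
      rcases Nat.lt_succ_iff_lt_or_eq.1 h1 with h | h
      · have := step ⟨t, h2⟩
        have := ih h (by omega)
        simp only at *
        omega
      · have := up p p.2.le
        subst h
        omega
  exact absurd (card_inversions_last hw) (down N p.2 le_rfl).ne

theorem not_inverted_of_crossing (w : Fin N → Fin n) (p : Fin N) :
    column w p (leftString w p) < column w p (rightString w p) := by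
  rw [column_leftString, column_rightString]
  exact Fin.castSucc_lt_succ

theorem inverted_after_crossing (w : Fin N → Fin n) (p : Fin N) :
    column w (p + 1) (rightString w p) < column w (p + 1) (leftString w p) := by
  rw [column_succ_left, column_succ_right]
  exact Fin.castSucc_lt_succ

/-- Every crossing has the smaller string on its upper left, so no crossing can undo an inversion.
-/
theorem inverted_mono {w : Fin N → Fin n} (hw : IsReducedWord w) {a b : Fin (n + 1)} (hab : a < b)
    {t t' : ℕ} (htt : t ≤ t') (ht : t' ≤ N) (h : column w t b < column w t a) :
    column w t' b < column w t' a := by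
  induction t', htt using Nat.le_induction with
  | base => exact h
  | succ t' h1 ih =>
    have ih := ih (by omega)
    have key := column_lt_succ_iff w ⟨t', ht⟩ (a := b) (b := a)
    refine (key ?_ ?_).2 ih
    · rintro ⟨rfl, rfl⟩
      exact absurd (leftString_lt_rightString hw ⟨t', ht⟩) hab.not_gt
    · rintro ⟨rfl, rfl⟩
      exact absurd ih (not_inverted_of_crossing w ⟨t', ht⟩).not_gt

/-- Two strings cross only once. -/
theorem crossing_unique {w : Fin N → Fin n} (hw : IsReducedWord w) {p q : Fin N}
    {a b : Fin (n + 1)} (hab : a ≠ b) (hpa : Passes w p a) (hpb : Passes w p b)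
    (hqa : Passes w q a) (hqb : Passes w q b) : p = q := by
  wlog hlt : a < b generalizing a b
  · exact this hab.symm hpb hpa hqb hqa (lt_of_le_of_ne (not_lt.1 hlt) hab.symm)
  have aux : ∀ r, Passes w r a → Passes w r b → a = leftString w r ∧ b = rightString w r := by
    intro r h1 h2
    have := leftString_lt_rightString hw r
    rcases h1 with h1 | h1 <;> rcases h2 with h2 | h2
    · exact absurd (h1.trans h2.symm) hab
    · exact ⟨h1, h2⟩
    · rw [← h1, ← h2] at this
      exact absurd this hlt.not_gt
    · exact absurd (h1.trans h2.symm) hab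
  have main : ∀ r r' : Fin N, Passes w r a → Passes w r b → Passes w r' a → Passes w r' b →
      ¬ r < r' := by
    intro r r' h1 h2 h3 h4 hr
    obtain ⟨e1, e2⟩ := aux r h1 h2
    obtain ⟨e3, e4⟩ := aux r' h3 h4
    have i1 := inverted_after_crossing w r
    rw [← e1, ← e2] at i1
    have i2 := not_inverted_of_crossing w r'
    rw [← e3, ← e4] at i2
    exact absurd (inverted_mono hw hlt (Nat.succ_le_of_lt hr) r'.2.le i1) i2.not_gt
  exact le_antisymm (not_lt.1 (main _ _ hqa hqb hpa hpb)) (not_lt.1 (main _ _ hpa hpb hqa hqb))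

end

/-! ### Acyclicity of the oriented string diagram -/

section

variable {n N : ℕ}

/-- `t_p` precedes `t_q` on a common string, when the strings numbered below `K` are oriented
upward. -/
def Precedes (w : Fin N → Fin n) (K : ℕ) (p q : Fin N) : Prop :=
  ∃ s : Fin (n + 1), Passes w p s ∧ Passes w q s ∧ (((s : ℕ) < K ∧ q < p) ∨ (K ≤ (s : ℕ) ∧ p < q))

/-- The side of the string `s` on which the crossing `t_p` lies: `0` to the right, `1` on the
string, `2` to the left. -/
def side (w : Fin N → Fin n) (s : Fin (n + 1)) (p : Fin N) : ℕ :=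
  if column w p s < (w p).castSucc then 0 else if column w p s ≤ (w p).succ then 1 else 2

theorem side_eq_one_iff (w : Fin N → Fin n) (s : Fin (n + 1)) (p : Fin N) :
    side w s p = 1 ↔ Passes w p s := by
  rw [Passes, eq_leftString_iff, eq_rightString_iff]
  unfold side
  simp only [Fin.ext_iff, Fin.lt_def, Fin.le_def, Fin.val_castSucc, Fin.val_succ]
  split_ifs <;> simp <;> omega

/-- The side of `s` is seen from any other string through the crossing. -/
theorem side_eq_zero_iff {w : Fin N → Fin n} {s s' : Fin (n + 1)} {p : Fin N}
    (h : ¬ Passes w p s) (h' : Passes w p s') :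
    side w s p = 0 ↔ column w p s < column w p s' := by
  rw [Passes, eq_leftString_iff, eq_rightString_iff] at h h'
  unfold side
  simp only [Fin.ext_iff, Fin.lt_def, Fin.le_def, Fin.val_castSucc, Fin.val_succ] at *
  split_ifs <;> simp <;> omega

theorem side_eq_two_iff {w : Fin N → Fin n} {s s' : Fin (n + 1)} {p : Fin N}
    (h : ¬ Passes w p s) (h' : Passes w p s') :
    side w s p = 2 ↔ column w p s' < column w p s := by
  rw [Passes, eq_leftString_iff, eq_rightString_iff] at h h'
  unfold side
  simp only [Fin.ext_iff, Fin.lt_def, Fin.le_def, Fin.val_castSucc, Fin.val_succ] at *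
  split_ifs <;> simp <;> omega

theorem side_le_two (w : Fin N → Fin n) (s : Fin (n + 1)) (p : Fin N) : side w s p ≤ 2 := by
  unfold side
  split_ifs <;> simp

theorem column_passes (w : Fin N → Fin n) {p : Fin N} {a b : Fin (n + 1)} (hab : a < b)
    (hw : IsReducedWord w) (ha : Passes w p a) (hb : Passes w p b) :
    column w p a < column w p b ∧ column w (p + 1) b < column w (p + 1) a := by
  have := leftString_lt_rightString hw p
  rcases ha with rfl | rfl <;> rcases hb with rfl | rfl
  · exact absurd hab (lt_irrefl _)
  · exact ⟨not_inverted_of_crossing w p, inverted_after_crossing w p⟩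
  · exact absurd hab this.not_gt
  · exact absurd hab (lt_irrefl _)

/-- Going down along a string of larger index, the crossings move from the right of `s` to the
left. -/
theorem side_le_of_lt {w : Fin N → Fin n} (hw : IsReducedWord w) {s s' : Fin (n + 1)} (hs : s < s')
    {p q : Fin N} (hp : Passes w p s') (hq : Passes w q s') (hpq : p < q) :
    side w s p ≤ side w s q ∧ ¬ (Passes w p s ∧ Passes w q s) := by
  refine ⟨?_, fun h => hpq.ne (crossing_unique hw hs.ne h.1 hp h.2 hq)⟩
  have hle : (p : ℕ) + 1 ≤ q := hpq
  have mono := fun {t t'} (h1 : t ≤ t') (h2 : t' ≤ N) => inverted_mono hw hs h1 h2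
  by_cases h1 : Passes w p s
  · have h2 : ¬ Passes w q s := fun h => hpq.ne (crossing_unique hw hs.ne h1 hp h hq)
    have := mono hle q.2.le (column_passes w hs hw h1 hp).2
    rw [← side_eq_two_iff h2 hq] at this
    rw [this]
    exact side_le_two w s p
  by_cases h2 : Passes w q s
  · rw [(side_eq_one_iff w s q).2 h2]
    have h3 := (column_passes w hs hw h2 hq).1
    have : side w s p ≠ 2 := by
      rw [Ne, side_eq_two_iff h1 hp]
      intro h
      exact absurd (mono hpq.le q.2.le h) h3.not_gt
    have := side_le_two w s p
    omega
  · by_contra! hlt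
    have e1 : side w s q ≠ 1 := fun h => h2 ((side_eq_one_iff w s q).1 h)
    have e2 : side w s p ≠ 1 := fun h => h1 ((side_eq_one_iff w s p).1 h)
    have e3 : side w s p = 2 := by
      have := side_le_two w s p
      omega
    have e4 : side w s q = 0 := by omega
    rw [side_eq_two_iff h1 hp] at e3
    rw [side_eq_zero_iff h2 hq] at e4
    exact absurd (mono hpq.le q.2.le e3) e4.not_gt

/-- Going up along a string of smaller index, the crossings move from the right of `s` to the
left. -/
theorem side_le_of_gt {w : Fin N → Fin n} (hw : IsReducedWord w) {s s' : Fin (n + 1)} (hs : s' < s)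
    {p q : Fin N} (hp : Passes w p s') (hq : Passes w q s') (hpq : p < q) :
    side w s q ≤ side w s p ∧ ¬ (Passes w p s ∧ Passes w q s) := by
  refine ⟨?_, fun h => hpq.ne (crossing_unique hw hs.ne' h.1 hp h.2 hq)⟩
  have hle : (p : ℕ) + 1 ≤ q := hpq
  have mono := fun {t t'} (h1 : t ≤ t') (h2 : t' ≤ N) => inverted_mono hw hs h1 h2
  by_cases h1 : Passes w p s
  · have h2 : ¬ Passes w q s := fun h => hpq.ne (crossing_unique hw hs.ne' h1 hp h hq)
    have := mono hle q.2.le (column_passes w hs hw hp h1).2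
    rw [← side_eq_zero_iff h2 hq] at this
    rw [this]
    exact Nat.zero_le _
  by_cases h2 : Passes w q s
  · rw [(side_eq_one_iff w s q).2 h2]
    have h3 := (column_passes w hs hw hq h2).1
    have : side w s p ≠ 0 := by
      rw [Ne, side_eq_zero_iff h1 hp]
      intro h
      exact absurd (mono hpq.le q.2.le h) h3.not_gt
    omega
  · by_contra! hlt
    have e1 : side w s q ≠ 1 := fun h => h2 ((side_eq_one_iff w s q).1 h)
    have e2 : side w s p ≠ 1 := fun h => h1 ((side_eq_one_iff w s p).1 h)
    have e3 : side w s q = 2 := by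
      have := side_le_two w s q
      omega
    have e4 : side w s p = 0 := by omega
    rw [side_eq_two_iff h2 hq] at e3
    rw [side_eq_zero_iff h1 hp] at e4
    exact absurd (mono hpq.le q.2.le e4) e3.not_gt

/-- The oriented string diagram has no oriented cycles. -/
theorem exists_rank {w : Fin N → Fin n} (hw : IsReducedWord w) (K : ℕ) (hK : K ≤ n + 1) :
    ∃ (α : Type) (_ : LinearOrder α) (f : Fin N → α), ∀ p q, Precedes w K p q → f p < f q := by
  -- Induction on the number of strings oriented upward. With none, the order from top to bottom is
  -- a rank; the step reverses the single string `K`.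
  induction K with
  | zero =>
    refine ⟨Fin N, inferInstance, id, ?_⟩
    rintro p q ⟨s, -, -, h⟩
    simpa using h
  | succ K ih =>
    obtain ⟨α, _, f, hf⟩ := ih (by omega)
    let s : Fin (n + 1) := ⟨K, hK⟩
    -- Every other string crosses `s` at most once, and in its orientation it passes from the right
    -- of `s` to the left: larger strings run down, smaller ones run up. So the side is the first
    -- key. On `s` itself the second key `-p` increases upward, and off `s` the old rank decides,
    -- since no segment on another string has both ends on `s`.
    refine ⟨ℕ ×ₗ ℤ ×ₗ α, inferInstance, fun p =>
      toLex (side w s p, toLex (if side w s p = 1 then -(p : ℤ) else 0, f p)), ?_⟩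
    rintro p q ⟨s', hp, hq, h⟩
    simp only [Prod.Lex.toLex_lt_toLex]
    by_cases hs : s' = s
    · subst hs
      have e1 := (side_eq_one_iff w s p).2 hp
      have e2 := (side_eq_one_iff w s q).2 hq
      have h : q < p := by
        rcases h with h | h
        · exact h.2
        · exact absurd h.1 (by simp [s])
      right
      refine ⟨by rw [e1, e2], Or.inl ?_⟩
      rw [if_pos e1, if_pos e2]
      simpa using h
    · have hne : (s' : ℕ) ≠ K := fun h => hs (Fin.ext h)
      have main : side w s p ≤ side w s q ∧ ¬ (Passes w p s ∧ Passes w q s) ∧ f p < f q := by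
        rcases h with ⟨h1, h2⟩ | ⟨h1, h2⟩
        · have hlt : s' < s := by
            rw [Fin.lt_def]
            simp only [s]
            omega
          obtain ⟨i1, i2⟩ := side_le_of_gt hw hlt hq hp h2
          exact ⟨i1, fun h => i2 h.symm, hf _ _ ⟨s', hp, hq, Or.inl ⟨by omega, h2⟩⟩⟩
        · have hlt : s < s' := by
            rw [Fin.lt_def]
            simp only [s]
            omega
          obtain ⟨i1, i2⟩ := side_le_of_lt hw hlt hp hq h2
          exact ⟨i1, i2, hf _ _ ⟨s', hp, hq, Or.inr ⟨by omega, h2⟩⟩⟩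
      obtain ⟨i1, i2, i3⟩ := main
      rcases i1.lt_or_eq with i1 | i1
      · exact Or.inl i1
      · have e1 : side w s p ≠ 1 := by
          intro e
          rw [side_eq_one_iff] at e
          have e' := i1 ▸ (side_eq_one_iff w s p).2 e
          exact i2 ⟨e, (side_eq_one_iff w s q).1 e'⟩
        have e2 : side w s q ≠ 1 := i1 ▸ e1
        exact Or.inr ⟨i1, Or.inr ⟨by rw [if_neg e1, if_neg e2], i3⟩⟩

end

/-! ### Flows, and the flow of a rigorous path -/

section

variable {n N : ℕ}

open Classical in
/-- The change of the flow along the string `s` at the crossing `t_p`. -/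
def crossFlow (w : Fin N → Fin n) (m : Fin N → ℤ) (s : Fin (n + 1)) (p : Fin N) : ℤ :=
  if s = leftString w p then m p else if s = rightString w p then -m p else 0

/-- The flow through the string `s` after `t` exchanges, counted positively downward. -/
def flux (w : Fin N → Fin n) (m : Fin N → ℤ) (s : Fin (n + 1)) : ℕ → ℤ
  | 0 => 0
  | t + 1 => flux w m s t + if h : t < N then crossFlow w m s ⟨t, h⟩ else 0

theorem flux_zero (w : Fin N → Fin n) (m : Fin N → ℤ) (s : Fin (n + 1)) : flux w m s 0 = 0 := rfl

theorem flux_succ (w : Fin N → Fin n) (m : Fin N → ℤ) (s : Fin (n + 1)) (p : Fin N) :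
    flux w m s (p + 1) = flux w m s p + crossFlow w m s p := by
  rw [flux, dif_pos p.2]

theorem crossFlow_left (w : Fin N → Fin n) (m : Fin N → ℤ) (p : Fin N) :
    crossFlow w m (leftString w p) p = m p := by simp [crossFlow]

theorem crossFlow_right (w : Fin N → Fin n) (m : Fin N → ℤ) (p : Fin N) :
    crossFlow w m (rightString w p) p = -m p := by
  simp [crossFlow, (leftString_ne_rightString w p).symm]

theorem crossFlow_of_not_passes {w : Fin N → Fin n} (m : Fin N → ℤ) {s : Fin (n + 1)} {p : Fin N}
    (h : ¬ Passes w p s) : crossFlow w m s p = 0 := by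
  rw [Passes, not_or] at h
  simp [crossFlow, h.1, h.2]

/-- The condition on a flow at a crossing, where `P` and `Q` say that the left and the right string
are oriented upward, `a` and `b` are the flows on them above the crossing, and `m` is exchanged. -/
def NodeCondition (P Q : Prop) (a b m : ℤ) : Prop :=
  (¬ P → ¬ Q → a + b ≤ 1 ∧ ¬ (b = 1 ∧ m = 0)) ∧
    (P → Q → -1 ≤ a + b ∧ ¬ (a = -1 ∧ m = 0)) ∧ (P → ¬ Q → b - (a + m) ≤ 1)

/-- `m` is the exponent vector of a flow of unit strength from `b_k` to `b_{k+1}`, which meets no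
crossing twice and avoids the bad fragments. -/
structure IsFlow (w : Fin N → Fin n) (k : Fin n) (m : Fin N → ℤ) : Prop where
  up : ∀ s, ∀ t ≤ N, Upward k s → flux w m s t = 0 ∨ flux w m s t = -1
  down : ∀ s, ∀ t ≤ N, ¬ Upward k s → flux w m s t = 0 ∨ flux w m s t = 1
  final : ∀ s, flux w m s N = if s = k.castSucc then -1 else if s = k.succ then 1 else 0
  node : ∀ p, NodeCondition (Upward k (leftString w p)) (Upward k (rightString w p))
    (flux w m (leftString w p) p) (flux w m (rightString w p) p) (m p)

/-- No flow takes a segment from `t_p` to `t_q` and also meets a crossing lying between `t_p` and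
`t_q`. -/
def NoBypass (w : Fin N → Fin n) (k : Fin n) (m : Fin N → ℤ) : Prop :=
  ∀ s p q v, Segment w k s p q → flux w m s (max p q) ≠ 0 →
    Precedes w (k + 1) p v → Precedes w (k + 1) v q →
      ∀ s', Passes w v s' → flux w m s' v = 0 ∧ flux w m s' (v + 1) = 0

theorem chain_head_or_pred {α : Type*} {R : α → α → Prop} {l : List α} (h : l.IsChain R) {x : α}
    (hx : x ∈ l) : l.head? = some x ∨ ∃ a ∈ l, R a x := by
  induction h with
  | nil => simp at hx
  | singleton a => simp at hx; simp [hx]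
  | @cons_cons a b l hab hl ih =>
    rcases List.mem_cons.1 hx with rfl | hx
    · simp
    · right
      rcases ih hx with h | ⟨c, hc, hR⟩
      · simp at h
        subst h
        exact ⟨a, by simp, hab⟩
      · exact ⟨c, List.mem_cons_of_mem _ hc, hR⟩

theorem chain_last_or_succ {α : Type*} {R : α → α → Prop} {l : List α} (h : l.IsChain R) {x : α}
    (hx : x ∈ l) : l.getLast? = some x ∨ ∃ b ∈ l, R x b := by
  induction h with
  | nil => simp at hx
  | singleton a => simp at hx; simp [hx]
  | @cons_cons a b l hab hl ih =>
    rcases List.mem_cons.1 hx with rfl | hx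
    · exact Or.inr ⟨b, by simp, hab⟩
    · rcases ih hx with h | ⟨c, hc, hR⟩
      · left
        rw [List.getLast?_cons_cons]
        exact h
      · exact Or.inr ⟨c, List.mem_cons_of_mem _ hc, hR⟩

/-- The rank increases strictly along the chain, so no member has a rank strictly between those of
two consecutive ones. This is the source of `NoBypass`. -/
theorem chain_rank {α β : Type*} [LinearOrder β] {R : α → α → Prop} {l : List α} (f : α → β)
    (hf : ∀ a b, R a b → f a < f b) (h : l.IsChain R) {x : α}
    (hx : x ∈ l) : l.getLast? = some x ∨
      ∃ b ∈ l, R x b ∧ ∀ y ∈ l, f y ≤ f x ∨ f b ≤ f y := by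
  induction h with
  | nil => simp at hx
  | singleton a => simp at hx; simp [hx]
  | @cons_cons a b l hab hl ih =>
    have hall : ∀ y ∈ b :: l, f b ≤ f y := by
      have h2 : (b :: l).IsChain (fun u v => f u < f v) := hl.imp hf
      rw [List.isChain_iff_pairwise (R := fun u v => f u < f v)] at h2
      intro y hy
      rcases List.mem_cons.1 hy with rfl | hy
      · exact le_rfl
      · exact (List.rel_of_pairwise_cons h2 hy).le
    rcases List.mem_cons.1 hx with rfl | hxl
    · refine Or.inr ⟨b, by simp, hab, fun y hy => ?_⟩
      rcases List.mem_cons.1 hy with rfl | hy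
      · exact Or.inl le_rfl
      · exact Or.inr (hall y hy)
    · rcases ih hxl with h | ⟨c, hc, hR, hr⟩
      · left
        rw [List.getLast?_cons_cons]
        exact h
      · refine Or.inr ⟨c, List.mem_cons_of_mem _ hc, hR, fun y hy => ?_⟩
        rcases List.mem_cons.1 hy with rfl | hy
        · exact Or.inl ((hf _ _ hab).le.trans (hall x hxl))
        · exact hr y hy

theorem Segment.precedes {w : Fin N → Fin n} {k : Fin n} {s : Fin (n + 1)} {p q : Fin N}
    (h : Segment w k s p q) : Precedes w (k + 1) p q := by
  obtain ⟨hp, hq, h⟩ := h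
  refine ⟨s, hp, hq, ?_⟩
  unfold Upward at h
  rw [Fin.le_def, Fin.val_castSucc] at h
  rcases h with h | h
  · exact Or.inl ⟨by omega, h.2.1⟩
  · exact Or.inr ⟨by omega, h.2.1⟩

section PathFlow

variable (w : Fin N → Fin n) (k : Fin n) (L : List (Step n N))

/-- The path arrives at `t_p` on the string `s`. -/
def ArrivesOn (p : Fin N) (s : Fin (n + 1)) : Prop := ∃ st ∈ L, st.vertex = p ∧ st.inc = s

/-- The path leaves `t_p` on the string `s`. -/
def LeavesOn (p : Fin N) (s : Fin (n + 1)) : Prop := ∃ st ∈ L, st.vertex = p ∧ st.out = s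

/-- The path uses the part of the string `s` after the first `t` exchanges. -/
def Uses (s : Fin (n + 1)) (t : ℕ) : Prop :=
  (Upward k s ∧ ((∃ st ∈ L, st.out = s ∧ t ≤ st.vertex ∧
      ∀ r : Fin N, t ≤ r → r < st.vertex → ¬ Passes w r s) ∨
    (s = k.castSucc ∧ ∀ r : Fin N, t ≤ r → ¬ Passes w r s))) ∨
  (¬ Upward k s ∧ ∃ st ∈ L, st.out = s ∧ (st.vertex : ℕ) < t ∧
    ∀ r : Fin N, st.vertex < r → (r : ℕ) < t → ¬ Passes w r s)

end PathFlow

section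

variable {w : Fin N → Fin n} {k : Fin n} {L : List (Step n N)}

theorem upward_castSucc (k : Fin n) : Upward k k.castSucc := le_refl _

theorem not_upward_succ (k : Fin n) : ¬ Upward k k.succ := not_le.2 Fin.castSucc_lt_succ

/-- This and the three lemmas alike match pieces of strings with steps of the path. An upward string
leaves a crossing above it (time `p`) and arrives from below (time `p + 1`); for a downward string
the two times are exchanged. -/
theorem uses_out_up {p : Fin N} {s : Fin (n + 1)} (hp : Passes w p s)
    (hs : Upward k s) : Uses w k L s p ↔ LeavesOn L p s := by
  constructor
  · rintro (⟨-, ⟨st, h1, h2, h3, h4⟩ | ⟨-, h⟩⟩ | ⟨h, -⟩)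
    · refine ⟨st, h1, ?_, h2⟩
      by_contra hne
      exact h4 p le_rfl (lt_of_le_of_ne h3 (Ne.symm hne)) hp
    · exact absurd hp (h p le_rfl)
    · exact absurd hs h
  · rintro ⟨st, h1, rfl, h3⟩
    exact Or.inl ⟨hs, Or.inl ⟨st, h1, h3, le_rfl, fun r h5 h6 => absurd h6 (not_lt.2 h5)⟩⟩

theorem uses_in_up {p : Fin N} {s : Fin (n + 1)} (hL : IsRigorousPath w k L) (hp : Passes w p s)
    (hs : Upward k s) : Uses w k L s (p + 1) ↔ ArrivesOn L p s := by
  constructor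
  · rintro (⟨-, ⟨st, h1, rfl, h3, h4⟩ | ⟨rfl, h⟩⟩ | ⟨h, -⟩)
    · rcases chain_last_or_succ hL.chain h1 with h | ⟨b, hb, he, hseg⟩
      · obtain ⟨st', h5, h6, -⟩ := hL.finish
        rw [h, Option.mem_some_iff] at h5
        subst h5
        rw [h6] at hs
        exact absurd hs (not_upward_succ k)
      · refine ⟨b, hb, ?_, he.symm⟩
        obtain ⟨-, i1, ⟨-, i2, i3⟩ | ⟨i2, -⟩⟩ := hseg
        · rcases lt_trichotomy b.vertex p with h | h | h
          · exact absurd hp (i3 p h h3)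
          · exact h
          · exact absurd i1 (h4 _ h i2)
        · exact absurd hs i2
    · obtain ⟨st, h1, h2, h3⟩ := hL.start
      refine ⟨st, List.mem_of_mem_head? h1, ?_, h2⟩
      have h4 := h3.2 p hp
      by_contra hne
      exact h st.vertex (lt_of_le_of_ne h4 (Ne.symm hne)) h3.1
    · exact absurd hs h
  · rintro ⟨st, h1, rfl, rfl⟩
    refine Or.inl ⟨hs, ?_⟩
    rcases chain_head_or_pred hL.chain h1 with h | ⟨a, ha, he, hseg⟩
    · obtain ⟨st', h5, h6, h7⟩ := hL.start
      rw [h, Option.mem_some_iff] at h5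
      subst h5
      right
      refine ⟨h6, fun r hr hr' => ?_⟩
      rw [h6] at hr'
      have := h7.2 r hr'
      rw [Fin.le_def] at this
      omega
    · left
      refine ⟨a, ha, he, ?_⟩
      rw [he] at hseg
      obtain ⟨-, i1, ⟨-, i2, i3⟩ | ⟨i2, -⟩⟩ := hseg
      · exact ⟨i2, fun r hr hr' => i3 r hr hr'⟩
      · exact absurd hs i2

theorem uses_out_down {p : Fin N} {s : Fin (n + 1)} (hp : Passes w p s)
    (hs : ¬ Upward k s) : Uses w k L s (p + 1) ↔ LeavesOn L p s := by
  constructor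
  · rintro (⟨h, -⟩ | ⟨-, st, h1, h2, h3, h4⟩)
    · exact absurd h hs
    · refine ⟨st, h1, ?_, h2⟩
      by_contra hne
      exact h4 p (lt_of_le_of_ne (Nat.lt_succ_iff.1 h3) hne) (Nat.lt_succ_self _) hp
  · rintro ⟨st, h1, rfl, h3⟩
    refine Or.inr ⟨hs, st, h1, h3, Nat.lt_succ_self _, fun r h5 h6 => ?_⟩
    rw [Fin.lt_def] at h5
    omega

theorem uses_in_down {p : Fin N} {s : Fin (n + 1)} (hL : IsRigorousPath w k L) (hp : Passes w p s)
    (hs : ¬ Upward k s) : Uses w k L s p ↔ ArrivesOn L p s := by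
  constructor
  · rintro (⟨h, -⟩ | ⟨-, st, h1, rfl, h3, h4⟩)
    · exact absurd h hs
    · rcases chain_last_or_succ hL.chain h1 with h | ⟨b, hb, he, hseg⟩
      · obtain ⟨st', h5, h6, h7⟩ := hL.finish
        rw [h, Option.mem_some_iff] at h5
        subst h5
        rw [h6] at hp
        exact absurd (h7.2 p hp) (not_le.2 h3)
      · refine ⟨b, hb, ?_, he.symm⟩
        obtain ⟨-, i1, ⟨i2, -⟩ | ⟨-, i2, i3⟩⟩ := hseg
        · exact absurd i2 hs
        · rcases lt_trichotomy b.vertex p with h | h | h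
          · exact absurd i1 (h4 _ i2 h)
          · exact h
          · exact absurd hp (i3 p h3 h)
  · rintro ⟨st, h1, rfl, rfl⟩
    refine Or.inr ⟨hs, ?_⟩
    rcases chain_head_or_pred hL.chain h1 with h | ⟨a, ha, he, hseg⟩
    · obtain ⟨st', h5, h6, h7⟩ := hL.start
      rw [h, Option.mem_some_iff] at h5
      subst h5
      rw [h6] at hs
      exact absurd (upward_castSucc k) hs
    · refine ⟨a, ha, he, ?_⟩
      rw [he] at hseg
      obtain ⟨-, i1, ⟨i2, -⟩ | ⟨-, i2, i3⟩⟩ := hseg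
      · exact absurd i2 hs
      · exact ⟨i2, fun r hr hr' => i3 r hr hr'⟩

theorem uses_succ_of_not_passes {p : Fin N} {s : Fin (n + 1)} (hL : IsRigorousPath w k L)
    (hp : ¬ Passes w p s) : Uses w k L s (p + 1) ↔ Uses w k L s p := by
  have hv : ∀ st ∈ L, st.out = s → st.vertex ≠ p := by
    rintro st h1 rfl rfl
    exact hp (hL.passes st h1).2
  have hr : ∀ r : Fin N, Passes w r s → (r : ℕ) ≠ p := by
    rintro r h1 h2
    rw [Fin.ext h2] at h1
    exact hp h1
  unfold Uses
  refine or_congr (and_congr_right fun _ => or_congr ?_ (and_congr_right fun _ => ?_))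
    (and_congr_right fun _ => ?_)
  · refine exists_congr fun st => and_congr_right fun h1 => and_congr_right fun h2 => ?_
    have h3 : (st.vertex : ℕ) ≠ p := fun h => hv st h1 h2 (Fin.ext h)
    constructor
    · rintro ⟨h4, h5⟩
      exact ⟨by omega, fun r h6 h7 h8 => h5 r (by have := hr r h8; omega) h7 h8⟩
    · rintro ⟨h4, h5⟩
      exact ⟨by omega, fun r h6 h7 h8 => h5 r (by omega) h7 h8⟩
  · constructor
    · intro h r h6 h8
      exact h r (by have := hr r h8; omega) h8
    · intro h r h6 h8
      exact h r (by omega) h8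
  · refine exists_congr fun st => and_congr_right fun h1 => and_congr_right fun h2 => ?_
    have h3 : (st.vertex : ℕ) ≠ p := fun h => hv st h1 h2 (Fin.ext h)
    constructor
    · rintro ⟨h4, h5⟩
      exact ⟨by omega, fun r h6 h7 h8 => h5 r h6 (by omega) h8⟩
    · rintro ⟨h4, h5⟩
      exact ⟨by omega, fun r h6 h7 h8 => h5 r h6 (by have := hr r h8; omega) h8⟩

theorem step_unique (hL : IsRigorousPath w k L) {st st' : Step n N} (h : st ∈ L) (h' : st' ∈ L)
    (he : st.vertex = st'.vertex) : st = st' :=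
  List.inj_on_of_nodup_map hL.nodup h h' he

theorem pathExponent_of_mem (hL : IsRigorousPath w k L) {st : Step n N} (h : st ∈ L) :
    pathExponent L st.vertex = -st.sign := by
  have hnd : L.Nodup := List.Nodup.of_map _ hL.nodup
  unfold pathExponent
  congr 1
  classical
  rw [← List.sum_toFinset _ hnd, Finset.sum_eq_single st]
  · simp
  · intro b hb hne
    rw [if_neg]
    intro he
    exact hne (step_unique hL (List.mem_toFinset.1 hb) h he)
  · intro hn
    exact absurd (List.mem_toFinset.2 h) hn

theorem pathExponent_of_not_mem {p : Fin N} (h : ∀ st ∈ L, st.vertex ≠ p) :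
    pathExponent L p = 0 := by
  unfold pathExponent
  rw [neg_eq_zero]
  apply List.sum_eq_zero
  intro x hx
  obtain ⟨st, hst, rfl⟩ := List.mem_map.1 hx
  rw [if_neg (h st hst)]

open Classical in
/-- The change of the flow of a path at a crossing. -/
theorem crossFlow_pathExponent (hw : IsReducedWord w) (hL : IsRigorousPath w k L) (p : Fin N)
    {s : Fin (n + 1)} (hs : Passes w p s) :
    crossFlow w (pathExponent L) s p =
      (if LeavesOn L p s then 1 else 0) - (if ArrivesOn L p s then 1 else 0) := by
  by_cases h : ∃ st ∈ L, st.vertex = p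
  · obtain ⟨st, h1, rfl⟩ := h
    have e1 : LeavesOn L st.vertex s ↔ st.out = s := by
      constructor
      · rintro ⟨st', i1, i2, i3⟩
        rwa [step_unique hL i1 h1 i2] at i3
      · exact fun h => ⟨st, h1, rfl, h⟩
    have e2 : ArrivesOn L st.vertex s ↔ st.inc = s := by
      constructor
      · rintro ⟨st', i1, i2, i3⟩
        rwa [step_unique hL i1 h1 i2] at i3
      · exact fun h => ⟨st, h1, rfl, h⟩
    have hlt := leftString_lt_rightString hw st.vertex
    have hne := hlt.ne
    have hnlt := hlt.not_gt
    obtain ⟨hi, ho⟩ := hL.passes st h1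
    simp only [e1, e2, crossFlow, pathExponent_of_mem hL h1, Step.sign]
    rcases hi with hi | hi <;> rcases ho with ho | ho <;> rcases hs with hs | hs <;>
      simp [hi, ho, hs, hlt, hne, hnlt, hne.symm]
  · push Not at h
    have e1 : ¬ LeavesOn L p s := fun ⟨st, i1, i2, _⟩ => h st i1 i2
    have e2 : ¬ ArrivesOn L p s := fun ⟨st, i1, i2, _⟩ => h st i1 i2
    simp [e1, e2, crossFlow, pathExponent_of_not_mem h]

open Classical in
-- Both sides change at a crossing by departures minus arrivals. They agree at the top because the
-- path uses no upper end of a string: after leaving upward it must reach a further crossing, as its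
-- last step leaves on the downward string `k + 1`. The pieces used by the path can thus be
-- recovered from its exponent vector.
theorem flux_pathExponent (hw : IsReducedWord w) (hL : IsRigorousPath w k L) (s : Fin (n + 1))
    (t : ℕ) (ht : t ≤ N) : flux w (pathExponent L) s t =
      if Uses w k L s t then (if Upward k s then -1 else 1) else 0 := by
  induction t with
  | zero =>
    rw [flux_zero, if_neg]
    rintro (⟨hs, ⟨st, h1, rfl, -, h4⟩ | ⟨rfl, h⟩⟩ | ⟨h, st, -, -, h3, -⟩)
    · rcases chain_last_or_succ hL.chain h1 with h | ⟨b, hb, he, hseg⟩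
      · obtain ⟨st', h5, h6, -⟩ := hL.finish
        rw [h, Option.mem_some_iff] at h5
        subst h5
        rw [h6] at hs
        exact not_upward_succ k hs
      · obtain ⟨-, i1, ⟨-, i2, i3⟩ | ⟨i2, -⟩⟩ := hseg
        · exact h4 _ (Nat.zero_le _) i2 i1
        · exact i2 hs
    · obtain ⟨st, -, -, h3⟩ := hL.start
      exact h _ (Nat.zero_le _) h3.1
    · omega
  | succ t ih =>
    have ih := ih (by omega)
    let p : Fin N := ⟨t, ht⟩
    change flux w (pathExponent L) s (p + 1) = if Uses w k L s (p + 1) then _ else _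
    change flux w (pathExponent L) s p = if Uses w k L s p then _ else _ at ih
    rw [flux_succ, ih]
    by_cases hp : Passes w p s
    · rw [crossFlow_pathExponent hw hL p hp]
      by_cases hs : Upward k s
      · rw [uses_in_up hL hp hs, uses_out_up hp hs, if_pos hs]
        split_ifs <;> rfl
      · rw [uses_in_down hL hp hs, uses_out_down hp hs, if_neg hs]
        split_ifs <;> rfl
    · rw [crossFlow_of_not_passes _ hp, uses_succ_of_not_passes hL hp, add_zero]

theorem isFlow_pathExponent (hw : IsReducedWord w) (hL : IsRigorousPath w k L) :
    IsFlow w k (pathExponent L) where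
  up s t ht hs := by
    rw [flux_pathExponent hw hL s t ht, if_pos hs]
    split_ifs <;> simp
  down s t ht hs := by
    rw [flux_pathExponent hw hL s t ht, if_neg hs]
    split_ifs <;> simp
  final s := by
    rw [flux_pathExponent hw hL s N le_rfl]
    by_cases hs : Upward k s
    · have h1 : s ≠ k.succ := fun h => not_upward_succ k (h ▸ hs)
      have : Uses w k L s N ↔ s = k.castSucc := by
        constructor
        · rintro (⟨-, ⟨st, -, -, h, -⟩ | ⟨h, -⟩⟩ | ⟨h, -⟩)
          · exact absurd st.vertex.2 (not_lt.2 h)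
          · exact h
          · exact absurd hs h
        · exact fun h => Or.inl ⟨hs, Or.inr ⟨h, fun r hr => absurd r.2 (not_lt.2 hr)⟩⟩
      simp [this, hs, h1]
    · have h1 : s ≠ k.castSucc := fun h => hs (h ▸ upward_castSucc k)
      have : Uses w k L s N ↔ s = k.succ := by
        constructor
        · rintro (⟨h, -⟩ | ⟨-, st, h2, rfl, h3, h4⟩)
          · exact absurd h hs
          · rcases chain_last_or_succ hL.chain h2 with h | ⟨b, hb, he, hseg⟩
            · obtain ⟨st', h5, h6, -⟩ := hL.finish
              rw [h, Option.mem_some_iff] at h5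
              subst h5
              exact h6
            · obtain ⟨-, i1, ⟨i2, -⟩ | ⟨-, i2, i3⟩⟩ := hseg
              · exact absurd i2 hs
              · exact absurd i1 (h4 _ i2 b.vertex.2)
        · rintro rfl
          obtain ⟨st, h1, h2, h3⟩ := hL.finish
          refine Or.inr ⟨hs, st, List.mem_of_mem_getLast? h1, h2, st.vertex.2, fun r hr _ hr' => ?_⟩
          exact absurd (h3.2 r hr') (not_le.2 hr)
      simp [this, hs, h1]
  node p := by
    classical
    have hl : Passes w p (leftString w p) := Or.inl rfl
    have hr : Passes w p (rightString w p) := Or.inr rfl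
    have e1 := flux_pathExponent hw hL (leftString w p) p p.2.le
    have e2 := flux_pathExponent hw hL (rightString w p) p p.2.le
    have e3 := crossFlow_pathExponent hw hL p hl
    rw [crossFlow_left] at e3
    have hne := leftString_ne_rightString w p
    -- No crossing is met twice, so it has at most one arrival and one departure. These two facts
    -- and the absence of bad fragments give the three orientation cases of `NodeCondition`.
    have hin : ¬ (ArrivesOn L p (leftString w p) ∧ ArrivesOn L p (rightString w p)) := by
      rintro ⟨⟨st, h1, h2, h3⟩, ⟨st', h1', h2', h3'⟩⟩
      have := step_unique hL h1 h1' (h2.trans h2'.symm)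
      subst this
      exact hne (h3.symm.trans h3')
    have hout : ¬ (LeavesOn L p (leftString w p) ∧ LeavesOn L p (rightString w p)) := by
      rintro ⟨⟨st, h1, h2, h3⟩, ⟨st', h1', h2', h3'⟩⟩
      have := step_unique hL h1 h1' (h2.trans h2'.symm)
      subst this
      exact hne (h3.symm.trans h3')
    have hbad : ∀ s, LeavesOn L p s → ArrivesOn L p s → ∃ st ∈ L, st.vertex = p ∧ st.inc = s ∧
        st.out = s := by
      rintro s ⟨st, h1, h2, h3⟩ ⟨st', h1', h2', h3'⟩
      have := step_unique hL h1 h1' (h2.trans h2'.symm)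
      subst this
      exact ⟨st, h1, h2, h3', h3⟩
    refine ⟨fun hP hQ => ?_, fun hP hQ => ?_, fun hP hQ => ?_⟩
    · rw [uses_in_down hL hl hP, if_neg hP] at e1
      rw [uses_in_down hL hr hQ, if_neg hQ] at e2
      rw [e1, e2]
      constructor
      · split_ifs <;> simp_all
      · rintro ⟨h1, h2⟩
        have h3 : ArrivesOn L p (rightString w p) := by
          by_contra h
          simp [h] at h1
        have e4 := crossFlow_pathExponent hw hL p hr
        rw [crossFlow_right, h2, if_pos h3] at e4
        have h4 : LeavesOn L p (rightString w p) := by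
          by_contra h
          simp [h] at e4
        obtain ⟨st, i1, rfl, i3, i4⟩ := hbad _ h4 h3
        exact hL.not_bad st i1 ⟨i3.trans i4.symm, Or.inr ⟨hP, hQ, i3⟩⟩
    · rw [uses_out_up hl hP, if_pos hP] at e1
      rw [uses_out_up hr hQ, if_pos hQ] at e2
      rw [e1, e2]
      constructor
      · split_ifs <;> simp_all
      · rintro ⟨h1, h2⟩
        have h3 : LeavesOn L p (leftString w p) := by
          by_contra h
          simp [h] at h1
        rw [h2, if_pos h3] at e3
        have h4 : ArrivesOn L p (leftString w p) := by
          by_contra h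
          simp [h] at e3
        obtain ⟨st, i1, rfl, i3, i4⟩ := hbad _ h3 h4
        exact hL.not_bad st i1 ⟨i3.trans i4.symm, Or.inl ⟨hP, hQ, i3⟩⟩
    · rw [uses_out_up hl hP, if_pos hP] at e1
      rw [uses_in_down hL hr hQ, if_neg hQ] at e2
      rw [e1, e2, e3]
      split_ifs <;> simp_all

/-- A used segment from `t_p` to `t_q` makes these consecutive vertices of the path, while the rank
of `t_v` lies strictly between theirs. Hence `t_v` is not on the path, and no string carries flow
next to it. -/
theorem noBypass_pathExponent (hw : IsReducedWord w) (hL : IsRigorousPath w k L) :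
    NoBypass w k (pathExponent L) := by
  classical
  intro s p q v hseg hflux hpv hvq
  obtain ⟨α, _, f, hf⟩ := exists_rank hw (k + 1) (by have := k.2; omega)
  have hout : LeavesOn L p s := by
    have hu : Uses w k L s (max p q) := by
      by_contra h
      rw [flux_pathExponent hw hL s _ (max_le p.2.le q.2.le), if_neg h] at hflux
      exact hflux rfl
    obtain ⟨hp, hq, ⟨h1, h2, h3⟩ | ⟨h1, h2, h3⟩⟩ := hseg
    · rw [max_eq_left (show (q : ℕ) ≤ p from h2.le)] at hu
      exact (uses_out_up hp h1).1 hu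
    · rw [max_eq_right (show (p : ℕ) ≤ q from h2.le)] at hu
      obtain ⟨st, i1, i2, i3⟩ := (uses_in_down hL hq h1).1 hu
      subst i2 i3
      rcases chain_head_or_pred hL.chain i1 with h | ⟨a, ha, he, hseg⟩
      · obtain ⟨st', h5, h6, h7⟩ := hL.start
        rw [h, Option.mem_some_iff] at h5
        subst h5
        rw [h6] at h1
        exact absurd (upward_castSucc k) h1
      · refine ⟨a, ha, ?_, he⟩
        rw [he] at hseg
        obtain ⟨j1, -, ⟨j2, -⟩ | ⟨-, j2, j3⟩⟩ := hseg
        · exact absurd j2 h1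
        · rcases lt_trichotomy a.vertex p with h | h | h
          · exact absurd hp (j3 p h h2)
          · exact h
          · exact absurd j1 (h3 _ h j2)
  obtain ⟨st, h1, rfl, rfl⟩ := hout
  have hno : ∀ st' ∈ L, st'.vertex ≠ v := by
    rintro st' h2 rfl
    rcases chain_rank (fun st : Step n N => f st.vertex) (fun a b h => hf _ _ h.2.precedes)
      hL.chain h1 with h | ⟨b, hb, ⟨he, hs⟩, hall⟩
    · obtain ⟨st'', h5, h6, h7⟩ := hL.finish
      rw [h, Option.mem_some_iff] at h5
      subst h5
      rw [h6] at hseg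
      obtain ⟨j1, j4, ⟨j2, -⟩ | ⟨-, j2, j3⟩⟩ := hseg
      · exact absurd j2 (not_upward_succ k)
      · exact absurd (h7.2 q j4) (not_le.2 j2)
    · have hbq : b.vertex = q := by
        obtain ⟨j1, j4, j⟩ := hseg
        obtain ⟨l1, l4, l⟩ := hs
        rcases j with ⟨j2, j3, j5⟩ | ⟨j2, j3, j5⟩ <;> rcases l with ⟨l2, l3, l5⟩ | ⟨l2, l3, l5⟩
        · rcases lt_trichotomy b.vertex q with h | h | h
          · exact absurd j4 (l5 _ h j3)
          · exact h
          · exact absurd l4 (j5 _ h l3)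
        · exact absurd j2 l2
        · exact absurd l2 j2
        · rcases lt_trichotomy b.vertex q with h | h | h
          · exact absurd l4 (j5 _ l3 h)
          · exact h
          · exact absurd j4 (l5 _ j3 h)
      rw [hbq] at hall
      rcases hall st' h2 with h | h
      · exact absurd (hf _ _ hpv) (not_lt.2 h)
      · exact absurd (hf _ _ hvq) (not_lt.2 h)
  intro s' hs'
  have e1 : ¬ LeavesOn L v s' := fun ⟨st, i1, i2, _⟩ => hno st i1 i2
  have e2 : ¬ ArrivesOn L v s' := fun ⟨st, i1, i2, _⟩ => hno st i1 i2
  rw [flux_pathExponent hw hL s' v v.2.le, flux_pathExponent hw hL s' (v + 1) v.2]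
  by_cases hup : Upward k s'
  · rw [uses_in_up hL hs' hup, uses_out_up hs' hup, if_neg e1, if_neg e2]
    exact ⟨rfl, rfl⟩
  · rw [uses_in_down hL hs' hup, uses_out_down hs' hup, if_neg e1, if_neg e2]
    exact ⟨rfl, rfl⟩

end

end

/-! ### From flows back to rigorous paths -/

section

variable {n N : ℕ} {w : Fin N → Fin n} {k : Fin n} {m : Fin N → ℤ}

/-- The flow `m` arrives at `t_p` on the string `s`. -/
def Inflow (w : Fin N → Fin n) (k : Fin n) (m : Fin N → ℤ) (p : Fin N) (s : Fin (n + 1)) : Prop :=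
  Passes w p s ∧ (Upward k s ∧ flux w m s (p + 1) = -1 ∨ ¬ Upward k s ∧ flux w m s p = 1)

/-- The flow `m` leaves `t_p` on the string `s`. -/
def Outflow (w : Fin N → Fin n) (k : Fin n) (m : Fin N → ℤ) (p : Fin N) (s : Fin (n + 1)) : Prop :=
  Passes w p s ∧ (Upward k s ∧ flux w m s p = -1 ∨ ¬ Upward k s ∧ flux w m s (p + 1) = 1)

theorem flux_succ_left (w : Fin N → Fin n) (m : Fin N → ℤ) (p : Fin N) :
    flux w m (leftString w p) (p + 1) = flux w m (leftString w p) p + m p := by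
  rw [flux_succ, crossFlow_left]

theorem flux_succ_right (w : Fin N → Fin n) (m : Fin N → ℤ) (p : Fin N) :
    flux w m (rightString w p) (p + 1) = flux w m (rightString w p) p - m p := by
  rw [flux_succ, crossFlow_right, sub_eq_add_neg]

theorem flux_eq_of_not_passes (w : Fin N → Fin n) (m : Fin N → ℤ) {s : Fin (n + 1)} {t t' : ℕ}
    (htt : t ≤ t') (h : ∀ r : Fin N, t ≤ r → (r : ℕ) < t' → ¬ Passes w r s) :
    flux w m s t' = flux w m s t := by
  induction t', htt using Nat.le_induction with
  | base => rfl
  | succ t' h1 ih =>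
    have ih := ih fun r h2 h3 => h r h2 (by omega)
    by_cases ht : t' < N
    · have := flux_succ w m s ⟨t', ht⟩
      rw [crossFlow_of_not_passes m (h ⟨t', ht⟩ h1 (Nat.lt_succ_self _)), add_zero] at this
      exact this.trans ih
    · rw [flux, dif_neg ht, add_zero, ih]

namespace IsFlow

/-- The orientations, the values and the node condition at a crossing. -/
theorem values (hw : IsReducedWord w) (hf : IsFlow w k m) (p : Fin N) :
    (Upward k (rightString w p) → Upward k (leftString w p)) ∧
    (Upward k (leftString w p) →
      (flux w m (leftString w p) p = 0 ∨ flux w m (leftString w p) p = -1) ∧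
      (flux w m (leftString w p) p + m p = 0 ∨ flux w m (leftString w p) p + m p = -1)) ∧
    (¬ Upward k (leftString w p) →
      (flux w m (leftString w p) p = 0 ∨ flux w m (leftString w p) p = 1) ∧
      (flux w m (leftString w p) p + m p = 0 ∨ flux w m (leftString w p) p + m p = 1)) ∧
    (Upward k (rightString w p) →
      (flux w m (rightString w p) p = 0 ∨ flux w m (rightString w p) p = -1) ∧
      (flux w m (rightString w p) p - m p = 0 ∨ flux w m (rightString w p) p - m p = -1)) ∧
    (¬ Upward k (rightString w p) →
      (flux w m (rightString w p) p = 0 ∨ flux w m (rightString w p) p = 1) ∧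
      (flux w m (rightString w p) p - m p = 0 ∨ flux w m (rightString w p) p - m p = 1)) := by
  rw [← flux_succ_left, ← flux_succ_right]
  exact ⟨fun h => (leftString_lt_rightString hw p).le.trans h,
    fun h => ⟨hf.up _ _ p.2.le h, hf.up _ _ p.2 h⟩,
    fun h => ⟨hf.down _ _ p.2.le h, hf.down _ _ p.2 h⟩,
    fun h => ⟨hf.up _ _ p.2.le h, hf.up _ _ p.2 h⟩,
    fun h => ⟨hf.down _ _ p.2.le h, hf.down _ _ p.2 h⟩⟩

/-- Here and in the four lemmas that follow, the orientations of the two strings are split into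
cases; the ranges of the flux and `NodeCondition` then leave a problem in linear integer arithmetic.
-/
theorem inflow_unique (hw : IsReducedWord w) (hf : IsFlow w k m) {p : Fin N} {s s' : Fin (n + 1)}
    (h : Inflow w k m p s) (h' : Inflow w k m p s') : s = s' := by
  have hv := hf.values hw p
  have hn := hf.node p
  unfold NodeCondition at hn
  obtain ⟨hp, h⟩ := h
  obtain ⟨hp', h'⟩ := h'
  by_contra hne
  rcases hp with rfl | rfl <;> rcases hp' with rfl | rfl <;>
    simp only [flux_succ_left, flux_succ_right] at h h' <;>
    by_cases hP : Upward k (leftString w p) <;> by_cases hQ : Upward k (rightString w p) <;>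
    simp only [hP, hQ, true_and, false_and, not_true, not_false_eq_true, true_imp_iff,
      false_imp_iff, or_false, false_or, and_true, ne_eq] at * <;> omega

theorem outflow_unique (hw : IsReducedWord w) (hf : IsFlow w k m) {p : Fin N} {s s' : Fin (n + 1)}
    (h : Outflow w k m p s) (h' : Outflow w k m p s') : s = s' := by
  have hv := hf.values hw p
  have hn := hf.node p
  unfold NodeCondition at hn
  obtain ⟨hp, h⟩ := h
  obtain ⟨hp', h'⟩ := h'
  by_contra hne
  rcases hp with rfl | rfl <;> rcases hp' with rfl | rfl <;>
    simp only [flux_succ_left, flux_succ_right] at h h' <;>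
    by_cases hP : Upward k (leftString w p) <;> by_cases hQ : Upward k (rightString w p) <;>
    simp only [hP, hQ, true_and, false_and, not_true, not_false_eq_true, true_imp_iff,
      false_imp_iff, or_false, false_or, and_true, ne_eq] at * <;> omega

/-- Conservation: the two strings of the crossing change their flux by `m p` and `-m p`, so what
arrives must leave. -/
theorem exists_outflow (hw : IsReducedWord w) (hf : IsFlow w k m) {p : Fin N} {s : Fin (n + 1)}
    (h : Inflow w k m p s) : ∃ s', Outflow w k m p s' := by
  have hv := hf.values hw p
  have hn := hf.node p
  unfold NodeCondition at hn
  obtain ⟨hp, h⟩ := h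
  by_contra! hne
  have h1 := hne (leftString w p)
  have h2 := hne (rightString w p)
  simp only [Outflow, Passes, flux_succ_left, flux_succ_right, true_or, or_true, true_and] at h1 h2
  rcases hp with rfl | rfl <;> simp only [flux_succ_left, flux_succ_right] at h <;>
    by_cases hP : Upward k (leftString w p) <;> by_cases hQ : Upward k (rightString w p) <;>
    simp only [hP, hQ, true_and, false_and, not_true, not_false_eq_true, true_imp_iff,
      false_imp_iff, or_false, false_or, and_true] at * <;> omega

theorem eq_zero_of_no_inflow (hw : IsReducedWord w) (hf : IsFlow w k m) {p : Fin N}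
    (h : ∀ s, ¬ Inflow w k m p s) : m p = 0 := by
  have hv := hf.values hw p
  have hn := hf.node p
  unfold NodeCondition at hn
  have h1 := h (leftString w p)
  have h2 := h (rightString w p)
  simp only [Inflow, Passes, flux_succ_left, flux_succ_right, true_or, or_true, true_and] at h1 h2
  by_cases hP : Upward k (leftString w p) <;> by_cases hQ : Upward k (rightString w p) <;>
    simp only [hP, hQ, true_and, false_and, not_true, not_false_eq_true, true_imp_iff,
      false_imp_iff, or_false, false_or, and_true] at * <;> omega

theorem sign_eq (hw : IsReducedWord w) (hf : IsFlow w k m) {st : Step n N}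
    (h : Inflow w k m st.vertex st.inc) (h' : Outflow w k m st.vertex st.out) :
    m st.vertex = -st.sign ∧ ¬ st.IsBad w k := by
  obtain ⟨p, s, s'⟩ := st
  have hv := hf.values hw p
  have hn := hf.node p
  have hlt := leftString_lt_rightString hw p
  have hnlt := hlt.not_gt
  have hne := hlt.ne
  unfold NodeCondition at hn
  obtain ⟨hp, h⟩ := h
  obtain ⟨hp', h'⟩ := h'
  simp only at hp hp' h h'
  unfold Step.sign Step.IsBad
  simp only
  rcases hp with rfl | rfl <;> rcases hp' with rfl | rfl <;>
    simp only [flux_succ_left, flux_succ_right] at h h' <;>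
    by_cases hP : Upward k (leftString w p) <;> by_cases hQ : Upward k (rightString w p) <;>
    simp only [hP, hQ, hlt, hnlt, hne, hne.symm, lt_irrefl, if_true, if_false, true_and, false_and,
      not_true, not_false_eq_true, true_imp_iff,
      false_imp_iff, or_false, false_or, and_true, and_false, ne_eq] at * <;> omega

/-- The flux is constant up to the next crossing on `s`. Going up, such a crossing exists because
the flux vanishes at the top; going down, the flow can reach the bottom only at `b_{k+1}`, by the
prescribed final values. -/
theorem exists_segment (hf : IsFlow w k m) {p : Fin N} {s : Fin (n + 1)}
    (h : Outflow w k m p s) :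
    (∃ q, Segment w k s p q ∧ Inflow w k m q s) ∨ (s = k.succ ∧ IsLowest w s p) := by
  classical
  obtain ⟨hp, ⟨hs, h⟩ | ⟨hs, h⟩⟩ := h
  · left
    let S : Finset (Fin N) := {q | q < p ∧ Passes w q s}
    have hS : S.Nonempty := by
      by_contra hS
      rw [Finset.not_nonempty_iff_eq_empty] at hS
      have : flux w m s p = flux w m s 0 := by
        refine flux_eq_of_not_passes w m (Nat.zero_le _) fun r _ h2 h3 => ?_
        have : r ∈ S := by simpa [S] using ⟨h2, h3⟩
        simp [hS] at this
      rw [h, flux_zero] at this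
      omega
    obtain ⟨h1, h2⟩ : S.max' hS < p ∧ Passes w (S.max' hS) s := by
      simpa [S] using S.max'_mem hS
    have h3 : ∀ r, S.max' hS < r → r < p → ¬ Passes w r s := by
      intro r h3 h4 h5
      exact absurd (S.le_max' r (by simpa [S] using ⟨h4, h5⟩)) (not_le.2 h3)
    refine ⟨S.max' hS, ⟨hp, h2, Or.inl ⟨hs, h1, h3⟩⟩, h2, Or.inl ⟨hs, ?_⟩⟩
    rw [← h]
    refine (flux_eq_of_not_passes w m h1 fun r h4 h5 => h3 r h4 h5).symm
  · let S : Finset (Fin N) := {q | p < q ∧ Passes w q s}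
    by_cases hS : S.Nonempty
    · left
      obtain ⟨h1, h2⟩ : p < S.min' hS ∧ Passes w (S.min' hS) s := by
        simpa [S] using S.min'_mem hS
      have h3 : ∀ r, p < r → r < S.min' hS → ¬ Passes w r s := by
        intro r h3 h4 h5
        exact absurd (S.min'_le r (by simpa [S] using ⟨h3, h5⟩)) (not_le.2 h4)
      refine ⟨S.min' hS, ⟨hp, h2, Or.inr ⟨hs, h1, h3⟩⟩, h2, Or.inr ⟨hs, ?_⟩⟩
      rw [← h]
      exact flux_eq_of_not_passes w m h1 fun r h4 h5 => h3 r h4 h5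
    · right
      rw [Finset.not_nonempty_iff_eq_empty] at hS
      have h3 : ∀ r, p < r → ¬ Passes w r s := by
        intro r h1 h2
        have : r ∈ S := by simpa [S] using ⟨h1, h2⟩
        simp [hS] at this
      have h4 : flux w m s N = flux w m s (p + 1) :=
        flux_eq_of_not_passes w m p.2 fun r h4 _ => h3 r h4
      rw [h, hf.final] at h4
      refine ⟨?_, hp, fun q hq => not_lt.1 fun hlt => h3 q hlt hq⟩
      by_contra h6
      have h5 : s ≠ k.castSucc := fun h => hs (h ▸ upward_castSucc k)
      simp [h5, h6] at h4

theorem exists_start (hf : IsFlow w k m) :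
    ∃ p, IsLowest w k.castSucc p ∧ Inflow w k m p k.castSucc := by
  classical
  have h := hf.final k.castSucc
  rw [if_pos rfl] at h
  let S : Finset (Fin N) := {q | Passes w q k.castSucc}
  have hS : S.Nonempty := by
    by_contra hS
    rw [Finset.not_nonempty_iff_eq_empty] at hS
    have : flux w m k.castSucc N = flux w m k.castSucc 0 := by
      refine flux_eq_of_not_passes w m (Nat.zero_le _) fun r _ _ h3 => ?_
      have : r ∈ S := by simpa [S] using h3
      simp [hS] at this
    rw [h, flux_zero] at this
    omega
  have h1 : Passes w (S.max' hS) k.castSucc := by simpa [S] using S.max'_mem hS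
  have h2 : ∀ r, Passes w r k.castSucc → r ≤ S.max' hS := fun r hr =>
    S.le_max' r (by simpa [S] using hr)
  refine ⟨S.max' hS, ⟨h1, h2⟩, h1, Or.inl ⟨upward_castSucc k, ?_⟩⟩
  rw [← h]
  exact (flux_eq_of_not_passes w m (S.max' hS).2 fun r h4 _ h5 =>
    absurd (h2 r h5) (not_le.2 h4)).symm

end IsFlow

theorem segment_left_unique {s : Fin (n + 1)} {p p' q : Fin N} (h : Segment w k s p q)
    (h' : Segment w k s p' q) : p = p' := by
  obtain ⟨j1, j4, j⟩ := h
  obtain ⟨l1, l4, l⟩ := h'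
  rcases j with ⟨j2, j3, j5⟩ | ⟨j2, j3, j5⟩ <;> rcases l with ⟨l2, l3, l5⟩ | ⟨l2, l3, l5⟩
  · rcases lt_trichotomy p p' with h | h | h
    · exact absurd j1 (l5 _ j3 h)
    · exact h
    · exact absurd l1 (j5 _ l3 h)
  · exact absurd j2 l2
  · exact absurd l2 j2
  · rcases lt_trichotomy p p' with h | h | h
    · exact absurd l1 (j5 _ h l3)
    · exact h
    · exact absurd j1 (l5 _ h j3)

/-- A step that follows the flow `m`. -/
def Step.Follows (w : Fin N → Fin n) (k : Fin n) (m : Fin N → ℤ) (st : Step n N) : Prop :=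
  Inflow w k m st.vertex st.inc ∧ Outflow w k m st.vertex st.out

theorem Step.Follows.ext (hw : IsReducedWord w) (hf : IsFlow w k m) {st st' : Step n N}
    (h : st.Follows w k m) (h' : st'.Follows w k m) (he : st.vertex = st'.vertex) : st = st' := by
  obtain ⟨p, s, s'⟩ := st
  obtain ⟨q, r, r'⟩ := st'
  obtain rfl : p = q := he
  obtain rfl : s = r := hf.inflow_unique hw h.1 h'.1
  obtain rfl : s' = r' := hf.outflow_unique hw h.2 h'.2
  rfl

theorem wellFounded_rank {α : Type*} [LinearOrder α] (f : Fin N → α) :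
    WellFounded fun p q : Fin N => f q < f p :=
  haveI : IsTrans (Fin N) fun p q => f q < f p := ⟨fun _ _ _ h h' => lt_trans h' h⟩
  haveI : Std.Irrefl (fun p q : Fin N => f q < f p) := ⟨fun _ => lt_irrefl _⟩
  Finite.wellFounded_of_trans_of_irrefl _

/-- Following the flow raises the rank at each step. As there are finitely many crossings, the walk
stops, and it can stop only at `b_{k+1}`. -/
theorem IsFlow.exists_tail (hw : IsReducedWord w) (hf : IsFlow w k m) {α : Type*} [LinearOrder α]
    (f : Fin N → α) (hr : ∀ p q, Precedes w (k + 1) p q → f p < f q) (p : Fin N) :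
    ∀ st : Step n N, st.vertex = p → st.Follows w k m → ∃ l : List (Step n N),
      (st :: l).IsChain (fun a b => a.out = b.inc ∧ Segment w k a.out a.vertex b.vertex) ∧
      (∀ x ∈ st :: l, x.Follows w k m) ∧
      ∃ x ∈ (st :: l).getLast?, x.out = k.succ ∧ IsLowest w k.succ x.vertex := by
  induction p using (wellFounded_rank f).induction with
  | _ p ih =>
    rintro st rfl hst
    rcases hf.exists_segment hst.2 with ⟨q, hseg, hin⟩ | ⟨h1, h2⟩
    · obtain ⟨s', hout⟩ := hf.exists_outflow hw hin
      obtain ⟨l, h1, h2, h3⟩ := ih q (hr _ _ hseg.precedes) ⟨q, st.out, s'⟩ rfl ⟨hin, hout⟩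
      refine ⟨⟨q, st.out, s'⟩ :: l, List.IsChain.cons_cons ⟨rfl, hseg⟩ h1, ?_, ?_⟩
      · intro x hx
        rcases List.mem_cons.1 hx with rfl | hx
        · exact hst
        · exact h2 x hx
      · rw [List.getLast?_cons_cons]
        exact h3
    · refine ⟨[], List.IsChain.singleton _, ?_, ?_⟩
      · simpa using hst
      · rw [h1] at h2
        exact ⟨st, by simp, h1, h2⟩

/-- Following the flow from `b_k` yields a rigorous path `L`. Its vector is all of `m` provided that
the flow has no component away from `L`, which acyclicity guarantees. -/
theorem IsFlow.mem_stringExponents (hw : IsReducedWord w) (hf : IsFlow w k m) :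
    m ∈ stringExponents w := by
  obtain ⟨α, _, f, hr⟩ := exists_rank hw (k + 1) (by have := k.2; omega)
  obtain ⟨p₀, hlow, hin⟩ := hf.exists_start
  obtain ⟨s₀, hout⟩ := hf.exists_outflow hw hin
  obtain ⟨l, hchain, hall, hlast⟩ := hf.exists_tail hw f hr p₀ ⟨p₀, k.castSucc, s₀⟩ rfl ⟨hin, hout⟩
  set L : List (Step n N) := ⟨p₀, k.castSucc, s₀⟩ :: l with hLdef
  have hnd : (L.map Step.vertex).Nodup := by
    have h1 : L.IsChain (fun a b => f a.vertex < f b.vertex) :=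
      hchain.imp fun a b h => hr _ _ h.2.precedes
    rw [List.isChain_iff_pairwise (R := fun a b : Step n N => f a.vertex < f b.vertex)] at h1
    rw [List.Nodup, List.pairwise_map]
    exact h1.imp fun h he => h.ne (congrArg f he)
  have hL : IsRigorousPath w k L :=
    { start := ⟨⟨p₀, k.castSucc, s₀⟩, by simp [hLdef], rfl, hlow⟩
      finish := hlast
      passes := fun st h => ⟨(hall st h).1.1, (hall st h).2.1⟩
      chain := hchain
      nodup := hnd
      not_bad := fun st h => (hf.sign_eq hw (hall st h).1 (hall st h).2).2 }
  -- Induction from high rank to low: the step following `st` lies on `L`, and the predecessor of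
  -- that step on `L` must be `st`, since a segment is determined by its string and its end. A step
  -- with no successor ends at `b_{k+1}`, as `L` does.
  have hcover : ∀ p, ∀ st : Step n N, st.vertex = p → st.Follows w k m → st ∈ L := by
    intro p
    induction p using (wellFounded_rank f).induction with
    | _ p ih =>
      rintro st rfl hst
      rcases hf.exists_segment hst.2 with ⟨q, hseg, hin⟩ | ⟨h1, h2⟩
      · obtain ⟨s', hout⟩ := hf.exists_outflow hw hin
        have hq := ih q (hr _ _ hseg.precedes) ⟨q, st.out, s'⟩ rfl ⟨hin, hout⟩
        rcases chain_head_or_pred hchain hq with h | ⟨a, ha, he, hs⟩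
        -- The successor cannot be the head of `L`: the head is entered on string `k` at its lowest
        -- crossing, so no segment leads into it.
        · simp only [hLdef, List.head?_cons, Option.some.injEq, Step.mk.injEq] at h
          obtain ⟨rfl, h2, -⟩ := h
          rw [← h2] at hseg
          obtain ⟨j1, -, ⟨-, j3, -⟩ | ⟨j2, -⟩⟩ := hseg
          · exact absurd (hlow.2 _ j1) (not_le.2 j3)
          · exact absurd (upward_castSucc k) j2
        · rw [he] at hs
          have hv : a.vertex = st.vertex := segment_left_unique hs hseg
          rwa [← Step.Follows.ext hw hf (hall a ha) hst hv]
      · obtain ⟨x, hx, h3, h4⟩ := hlast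
        have hx := List.mem_of_mem_getLast? hx
        rw [h1] at h2
        have hv : x.vertex = st.vertex := le_antisymm (h2.2 _ h4.1) (h4.2 _ h2.1)
        rwa [← Step.Follows.ext hw hf (hall x hx) hst hv]
  refine ⟨k, L, hL, ?_⟩
  funext p
  by_cases h : ∃ st ∈ L, st.vertex = p
  · obtain ⟨st, h1, rfl⟩ := h
    rw [pathExponent_of_mem hL h1, (hf.sign_eq hw (hall st h1).1 (hall st h1).2).1]
  · push Not at h
    rw [pathExponent_of_not_mem h]
    refine hf.eq_zero_of_no_inflow hw fun s hs => ?_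
    obtain ⟨s', hout⟩ := hf.exists_outflow hw hs
    exact h ⟨p, s, s'⟩ (hcover p ⟨p, s, s'⟩ rfl ⟨hs, hout⟩) rfl

theorem exists_isFlow (hw : IsReducedWord w) (hm : m ∈ stringExponents w) :
    ∃ k, IsFlow w k m ∧ NoBypass w k m := by
  obtain ⟨k, L, hL, rfl⟩ := hm
  exact ⟨k, isFlow_pathExponent hw hL, noBypass_pathExponent hw hL⟩

end

/-! ### Changing a flow inside a window; string inequalities under a 2-move -/

section

variable {n N : ℕ} {w w' : Fin N → Fin n} {k : Fin n} {m m' : Fin N → ℤ}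

theorem column_eq_before {t : ℕ} (ht : t ≤ N) (h : ∀ q : Fin N, (q : ℕ) < t → w' q = w q) :
    column w' t = column w t := by
  induction t with
  | zero => funext s; rw [column_zero, column_zero]
  | succ t ih =>
    funext s
    have := column_succ w ⟨t, ht⟩ s
    have h2 := column_succ w' ⟨t, ht⟩ s
    simp only at this h2
    rw [this, h2, h _ (Nat.lt_succ_self t), ih (by omega) fun q hq => h q (by omega)]

theorem column_eq_after {t t' : ℕ} (htt : t ≤ t') (ht' : t' ≤ N) (h0 : column w' t = column w t)
    (h : ∀ q : Fin N, t ≤ q → w' q = w q) : column w' t' = column w t' := by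
  induction t', htt using Nat.le_induction with
  | base => exact h0
  | succ t' h1 ih =>
    funext s
    have := column_succ w ⟨t', ht'⟩ s
    have h2 := column_succ w' ⟨t', ht'⟩ s
    simp only at this h2
    rw [this, h2, h _ h1, ih (by omega)]

theorem leftString_eq_of_column {p q : Fin N} (h : column w' q = column w p)
    (hpq : w' q = w p) : leftString w' q = leftString w p := by
  rw [eq_comm, eq_leftString_iff, h, hpq, column_leftString]

theorem rightString_eq_of_column {p q : Fin N} (h : column w' q = column w p)
    (hpq : w' q = w p) : rightString w' q = rightString w p := by
  rw [eq_comm, eq_rightString_iff, h, hpq, column_rightString]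

/-- Two flows on two diagrams look the same at the crossings outside the window `[lo, hi)`. -/
def AgreeOutside (w w' : Fin N → Fin n) (m m' : Fin N → ℤ) (lo hi : ℕ) : Prop :=
  ∀ p : Fin N, ((p : ℕ) < lo ∨ hi ≤ p) →
    leftString w p = leftString w' p ∧ rightString w p = rightString w' p ∧ m p = m' p

theorem crossFlow_congr {p q : Fin N} (hl : leftString w p = leftString w' q)
    (hr : rightString w p = rightString w' q) (hm : m p = m' q) (s : Fin (n + 1)) :
    crossFlow w m s p = crossFlow w' m' s q := by
  rw [crossFlow, crossFlow, hl, hr, hm]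

theorem AgreeOutside.flux_before {lo hi : ℕ} (h : AgreeOutside w w' m m' lo hi) (s : Fin (n + 1))
    {t : ℕ} (ht : t ≤ lo) (htN : t ≤ N) : flux w m s t = flux w' m' s t := by
  induction t with
  | zero => rfl
  | succ t ih =>
    have h1 := flux_succ w m s ⟨t, htN⟩
    have h2 := flux_succ w' m' s ⟨t, htN⟩
    obtain ⟨e1, e2, e3⟩ := h ⟨t, htN⟩ (Or.inl ht)
    simp only at h1 h2
    rw [h1, h2, ih (by omega) (by omega), crossFlow_congr e1 e2 e3]

theorem AgreeOutside.flux_after {lo hi : ℕ} (h : AgreeOutside w w' m m' lo hi) {s : Fin (n + 1)}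
    (h0 : flux w m s hi = flux w' m' s hi)
    {t : ℕ} (ht : hi ≤ t) (htN : t ≤ N) : flux w m s t = flux w' m' s t := by
  induction t, ht using Nat.le_induction with
  | base => exact h0
  | succ t h1 ih =>
    have h3 := flux_succ w m s ⟨t, htN⟩
    have h2 := flux_succ w' m' s ⟨t, htN⟩
    obtain ⟨e1, e2, e3⟩ := h ⟨t, htN⟩ (Or.inr h1)
    simp only at h3 h2
    rw [h3, h2, ih (by omega), crossFlow_congr e1 e2 e3]

/-- The possible values of a flow on a string which is oriented upward if `P` holds, and downward
otherwise. -/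
def InRange (P : Prop) (v : ℤ) : Prop := (P → v = 0 ∨ v = -1) ∧ (¬ P → v = 0 ∨ v = 1)

theorem IsFlow.inRange (hf : IsFlow w k m) (s : Fin (n + 1)) {t : ℕ} (ht : t ≤ N) :
    InRange (Upward k s) (flux w m s t) :=
  ⟨hf.up s t ht, hf.down s t ht⟩

/-- A flow may be replaced inside a window. -/
theorem IsFlow.replace (hf : IsFlow w' k m') {lo hi : ℕ} (hhi : hi ≤ N)
    (hag : AgreeOutside w w' m m' lo hi) (hout : ∀ s, flux w m s hi = flux w' m' s hi)
    (hnode : ∀ p : Fin N, lo ≤ p → (p : ℕ) < hi →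
      NodeCondition (Upward k (leftString w p)) (Upward k (rightString w p))
        (flux w m (leftString w p) p) (flux w m (rightString w p) p) (m p) ∧
      ∀ s, Passes w p s → InRange (Upward k s) (flux w m s (p + 1))) : IsFlow w k m := by
  have hr : ∀ s, ∀ t ≤ N, InRange (Upward k s) (flux w m s t) := by
    intro s t ht
    by_cases h1 : t ≤ lo
    · rw [hag.flux_before s h1 ht]
      exact hf.inRange s ht
    by_cases h2 : hi ≤ t
    · rw [hag.flux_after (hout s) h2 ht]
      exact hf.inRange s ht
    · have h3 : lo ≤ t := by omega
      have h4 : t ≤ hi := by omega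
      clear h1 h2
      induction t, h3 using Nat.le_induction with
      | base =>
        rw [hag.flux_before s le_rfl ht]
        exact hf.inRange s ht
      | succ t h5 ih =>
        by_cases hp : Passes w ⟨t, ht⟩ s
        · exact (hnode ⟨t, ht⟩ h5 h4).2 s hp
        · have := flux_succ w m s ⟨t, ht⟩
          rw [crossFlow_of_not_passes m hp, add_zero] at this
          simp only at this
          rw [this]
          exact ih (by omega) (by omega)
  refine ⟨fun s t ht => (hr s t ht).1, fun s t ht => (hr s t ht).2, fun s => ?_, fun p => ?_⟩
  · rw [hag.flux_after (hout s) hhi le_rfl]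
    exact hf.final s
  · by_cases h1 : (p : ℕ) < lo
    · obtain ⟨e1, e2, e3⟩ := hag p (Or.inl h1)
      rw [hag.flux_before _ h1.le p.2.le, hag.flux_before _ h1.le p.2.le, e1, e2, e3]
      exact hf.node p
    by_cases h2 : hi ≤ p
    · obtain ⟨e1, e2, e3⟩ := hag p (Or.inr h2)
      rw [hag.flux_after (hout _) h2 p.2.le, hag.flux_after (hout _) h2 p.2.le, e1, e2, e3]
      exact hf.node p
    · exact (hnode p (by omega) (by omega)).1

namespace TwoMove

variable {i j : Fin N}

theorem symm (h : TwoMove w w' i j) : TwoMove w' w i j where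
  hj := h.hj
  far := by rw [h.left, h.right]; exact h.far.symm
  left := h.right.symm
  right := h.left.symm
  other q h1 h2 := (h.other q h1 h2).symm

theorem column_left (h : TwoMove w w' i j) : column w' i = column w i :=
  column_eq_before i.2.le fun q hq => h.other q (fun e => by subst e; omega)
    (fun e => by have := h.hj; subst e; omega)

theorem column_hi (h : TwoMove w w' i j) : column w' (j + 1) = column w (j + 1) := by
  funext s
  rw [column_succ, column_succ, h.hj, column_succ, column_succ, h.left, h.right, h.column_left]
  have hf := h.far
  generalize column w i s = x
  generalize w i = a at hf
  generalize w j = b at hf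
  simp only [simpleSwap, Equiv.swap_apply_def]
  simp only [Fin.ext_iff, Fin.val_castSucc, Fin.val_succ]
  split_ifs <;> first | rfl | (simp at *; omega)

theorem column_of_ne (h : TwoMove w w' i j) {p : Fin N} (hi : p ≠ i) (hj : p ≠ j) :
    column w' p = column w p := by
  have hij := h.hj
  have hi : (p : ℕ) ≠ i := fun e => hi (Fin.ext e)
  have hj : (p : ℕ) ≠ j := fun e => hj (Fin.ext e)
  rcases lt_or_ge (p : ℕ) i with hp | hp
  · exact column_eq_before p.2.le fun q hq => h.other q (fun e => by subst e; omega)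
      (fun e => by subst e; omega)
  · exact column_eq_after (t := j + 1) (by omega) p.2.le h.column_hi fun q hq =>
      h.other q (fun e => by subst e; omega) (fun e => by subst e; omega)

theorem strings_left (h : TwoMove w w' i j) :
    leftString w i = leftString w' j ∧ rightString w i = rightString w' j := by
  have hf := h.far
  rw [eq_leftString_iff, eq_rightString_iff, h.hj, column_succ, column_succ, h.left,
    h.right, h.column_left, column_leftString, column_rightString]
  generalize w i = a at hf
  generalize w j = b at hf
  constructor <;> rw [simpleSwap, Equiv.swap_apply_of_ne_of_ne] <;>
    simp only [ne_eq, Fin.ext_iff, Fin.val_castSucc, Fin.val_succ] <;> omega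

end TwoMove

/-- The two crossings have no string in common, so neither affects the flux arriving at the other.
After the swap each crossing sees the same strings, fluxes and exchanged amount as before, and the
total effect of the window is unchanged. -/
theorem TwoMove.mem_stringExponents {i j : Fin N} (h : TwoMove w w' i j) (hw : IsReducedWord w)
    (hw' : IsReducedWord w') {m' : Fin N → ℤ} (hm : m' ∈ stringExponents w') :
    (fun q => m' (Equiv.swap i j q)) ∈ stringExponents w := by
  obtain ⟨k, hf, -⟩ := exists_isFlow hw' hm
  set m : Fin N → ℤ := fun q => m' (Equiv.swap i j q) with hmdef
  have hij := h.hj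
  have mi : m i = m' j := by simp [hmdef]
  have mj : m j = m' i := by simp [hmdef]
  obtain ⟨il, ir⟩ := h.strings_left
  obtain ⟨jl, jr⟩ := h.symm.strings_left
  have hag : AgreeOutside w w' m m' i (j + 1) := by
    intro p hp
    have hi : p ≠ i := fun e => by subst e; omega
    have hj : p ≠ j := fun e => by subst e; omega
    exact ⟨(leftString_eq_of_column (h.column_of_ne hi hj) (h.other p hi hj)).symm,
      (rightString_eq_of_column (h.column_of_ne hi hj) (h.other p hi hj)).symm,
      by simp [hmdef, Equiv.swap_apply_of_ne_of_ne hi hj]⟩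
  have f0 : ∀ s, flux w m s i = flux w' m' s i := fun s => hag.flux_before s le_rfl i.2.le
  have ci : ∀ s, crossFlow w m s i = crossFlow w' m' s j := crossFlow_congr il ir mi
  have cj : ∀ s, crossFlow w m s j = crossFlow w' m' s i := crossFlow_congr jl.symm jr.symm mj
  have f1 : ∀ s, flux w m s j = flux w m s i + crossFlow w m s i := fun s => by
    rw [hij, flux_succ]
  have f1' : ∀ s, flux w' m' s j = flux w' m' s i + crossFlow w' m' s i := fun s => by
    rw [hij, flux_succ]
  have f2 : ∀ s, flux w m s (j + 1) = flux w' m' s (j + 1) := fun s => by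
    rw [flux_succ, flux_succ, f1, f1', f0, ci, cj]
    ring
  have disj : ∀ s, Passes w i s → ¬ Passes w j s := by
    intro s h1 h2
    have hfar := h.far
    have h1' : Passes w' j s := by rwa [Passes, ← il, ← ir]
    have h2' : Passes w' i s := by rwa [Passes, jl, jr]
    rw [Passes, eq_leftString_iff, eq_rightString_iff] at h1 h2'
    rw [h.column_left, h.left] at h2'
    rcases h1 with h1 | h1 <;> rcases h2' with h3 | h3 <;> rw [h1] at h3 <;>
      simp only [Fin.ext_iff, Fin.val_castSucc, Fin.val_succ] at h3 <;> omega
  have zi : ∀ s, Passes w i s → crossFlow w' m' s i = 0 := fun s hs =>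
    crossFlow_of_not_passes _ (by rw [Passes, jl, jr]; exact disj s hs)
  have zj : ∀ s, Passes w j s → crossFlow w m s i = 0 := fun s hs =>
    crossFlow_of_not_passes _ fun h => disj s h hs
  refine (hf.replace (lo := i) (hi := j + 1) j.2 hag f2 ?_).mem_stringExponents hw
  intro p hp1 hp2
  have : p = i ∨ p = j := by
    simp only [Fin.ext_iff]
    omega
  rcases this with rfl | rfl
  · constructor
    · have := hf.node j
      rw [← il, ← ir, f1', f1', zi _ (Or.inl rfl), zi _ (Or.inr rfl), add_zero, add_zero, ← f0,
        ← f0, ← mi] at this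
      exact this
    · intro s hs
      have := hf.inRange s (t := j + 1) j.2
      rw [flux_succ, f1', zi s hs, add_zero, ← ci, ← f0, ← flux_succ] at this
      exact this
  · constructor
    · have := hf.node i
      rw [jl, jr, ← f0, ← f0, ← mj] at this
      rwa [f1, f1, zj _ (Or.inl rfl), zj _ (Or.inr rfl), add_zero, add_zero]
    · intro s hs
      rw [f2]
      exact hf.inRange s p.2

end

/-! ### Finite checks on the triangle of a 3-move -/

section

variable {n N : ℕ}

/-- The symmetric closure of the table of pieces: a piece of `w'` may come from two pieces of `w`,
whose coefficients are related by a box equation. -/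
def symmetricTable : List ((ℤ × ℤ × ℤ) × (ℤ × ℤ × ℤ) × ℤ) :=
  pieceTable ++ [((0, -1, 1), (0, 0, -1), 1), ((-1, 1, 0), (1, 0, 0), -1)]

instance (P Q : Prop) [Decidable P] [Decidable Q] (a b m : ℤ) :
    Decidable (NodeCondition P Q a b m) :=
  inferInstanceAs (Decidable (_ ∧ _ ∧ _))

instance (P : Prop) [Decidable P] (v : ℤ) : Decidable (InRange P v) :=
  inferInstanceAs (Decidable (_ ∧ _))

/-- The conditions on a flow at three consecutive crossings of strings `x < y < z` in the order
`xy`, `xz`, `yz`. Here `P`, `Q`, `R` are the orientations of the strings and `a`, `b`, `c` the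
flows on them above the three crossings. -/
def FirstTriangle (P Q R : Prop) (a b c m₁ m₂ m₃ : ℤ) : Prop :=
  (InRange P a ∧ InRange P (a + m₁) ∧ InRange P (a + m₁ + m₂)) ∧
  (InRange Q b ∧ InRange Q (b - m₁) ∧ InRange Q (b - m₁ + m₃)) ∧
  (InRange R c ∧ InRange R (c - m₂) ∧ InRange R (c - m₂ - m₃)) ∧
  NodeCondition P Q a b m₁ ∧ NodeCondition P R (a + m₁) c m₂ ∧
  NodeCondition Q R (b - m₁) (c - m₂) m₃

/-- The conditions on a flow at three consecutive crossings of strings `x < y < z` in the order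
`yz`, `xz`, `xy`. -/
def SecondTriangle (P Q R : Prop) (a b c m₁ m₂ m₃ : ℤ) : Prop :=
  (InRange P a ∧ InRange P (a + m₂) ∧ InRange P (a + m₂ + m₃)) ∧
  (InRange Q b ∧ InRange Q (b + m₁) ∧ InRange Q (b + m₁ - m₃)) ∧
  (InRange R c ∧ InRange R (c - m₁) ∧ InRange R (c - m₁ - m₂)) ∧
  NodeCondition Q R b c m₁ ∧ NodeCondition P R a (c - m₁) m₂ ∧
  NodeCondition P Q (a + m₂) (b + m₁) m₃

/-- A flow along the long side of the triangle does not meet the third corner. -/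
def FirstNoBypass (P Q R : Prop) (a b c m₁ m₂ m₃ : ℤ) : Prop :=
  ((P ∧ R ∨ ¬ P ∧ ¬ R) → b - m₁ ≠ 0 → a + m₁ = 0 ∧ a + m₁ + m₂ = 0 ∧ c = 0 ∧ c - m₂ = 0) ∧
  ((P ∧ ¬ Q) → c - m₂ ≠ 0 → a = 0 ∧ a + m₁ = 0 ∧ b = 0 ∧ b - m₁ = 0) ∧
  ((Q ∧ ¬ R) → a + m₁ ≠ 0 → b - m₁ = 0 ∧ b - m₁ + m₃ = 0 ∧ c - m₂ = 0 ∧ c - m₂ - m₃ = 0)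

/-- A flow along the long side of the triangle does not meet the third corner. -/
def SecondNoBypass (P Q R : Prop) (a b c m₁ m₂ m₃ : ℤ) : Prop :=
  ((P ∧ R ∨ ¬ P ∧ ¬ R) → b + m₁ ≠ 0 → a = 0 ∧ a + m₂ = 0 ∧ c - m₁ = 0 ∧ c - m₁ - m₂ = 0) ∧
  ((P ∧ ¬ Q) → c - m₁ ≠ 0 → a + m₂ = 0 ∧ a + m₂ + m₃ = 0 ∧ b + m₁ = 0 ∧ b + m₁ - m₃ = 0) ∧
  ((Q ∧ ¬ R) → a + m₂ ≠ 0 → b = 0 ∧ b + m₁ = 0 ∧ c = 0 ∧ c - m₁ = 0)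

instance (P Q R : Prop) [Decidable P] [Decidable Q] [Decidable R] (a b c m₁ m₂ m₃ : ℤ) :
    Decidable (FirstTriangle P Q R a b c m₁ m₂ m₃) :=
  inferInstanceAs (Decidable (_ ∧ _ ∧ _ ∧ _ ∧ _ ∧ _))

instance (P Q R : Prop) [Decidable P] [Decidable Q] [Decidable R] (a b c m₁ m₂ m₃ : ℤ) :
    Decidable (SecondTriangle P Q R a b c m₁ m₂ m₃) :=
  inferInstanceAs (Decidable (_ ∧ _ ∧ _ ∧ _ ∧ _ ∧ _))

instance (P Q R : Prop) [Decidable P] [Decidable Q] [Decidable R] (a b c m₁ m₂ m₃ : ℤ) :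
    Decidable (FirstNoBypass P Q R a b c m₁ m₂ m₃) :=
  inferInstanceAs (Decidable (_ ∧ _ ∧ _))

instance (P Q R : Prop) [Decidable P] [Decidable Q] [Decidable R] (a b c m₁ m₂ m₃ : ℤ) :
    Decidable (SecondNoBypass P Q R a b c m₁ m₂ m₃) :=
  inferInstanceAs (Decidable (_ ∧ _ ∧ _))

/-- The values of a flow. -/
def flowValues : List ℤ := [0, 1, -1]

/-- The orientations are monotone because the upward strings form an initial segment. The bypass
condition is needed: with all strings downward, the fluxes `a = c = 1`, `b = 0` and the piece `(-1,
1, 0)` satisfy `FirstTriangle`, but after the replacement `(1, 0, 0)` two strands would meet at the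
last crossing. -/
theorem second_of_first_bool : ∀ u v t : Bool, (t → v) → (v → u) →
    ∀ a ∈ flowValues, ∀ b ∈ flowValues, ∀ c ∈ flowValues, ∀ r ∈ symmetricTable,
    FirstTriangle u v t a b c r.2.1.1 r.2.1.2.1 r.2.1.2.2 →
    FirstNoBypass u v t a b c r.2.1.1 r.2.1.2.1 r.2.1.2.2 →
    SecondTriangle u v t a b c r.1.1 r.1.2.1 r.1.2.2 := by
  decide +kernel

theorem first_of_second_bool : ∀ u v t : Bool, (t → v) → (v → u) →
    ∀ a ∈ flowValues, ∀ b ∈ flowValues, ∀ c ∈ flowValues, ∀ r ∈ symmetricTable,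
    SecondTriangle u v t a b c r.2.1.1 r.2.1.2.1 r.2.1.2.2 →
    SecondNoBypass u v t a b c r.2.1.1 r.2.1.2.1 r.2.1.2.2 →
    FirstTriangle u v t a b c r.1.1 r.1.2.1 r.1.2.2 := by
  decide +kernel

theorem first_mem_table_bool : ∀ u v t : Bool, (t → v) → (v → u) →
    ∀ a ∈ flowValues, ∀ b ∈ flowValues, ∀ c ∈ flowValues,
    ∀ m₁ ∈ flowValues, ∀ m₂ ∈ flowValues, ∀ m₃ ∈ flowValues,
    FirstTriangle u v t a b c m₁ m₂ m₃ → ∃ r ∈ pieceTable, r.2.1 = (m₁, m₂, m₃) := by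
  decide +kernel

theorem second_mem_table_bool : ∀ u v t : Bool, (t → v) → (v → u) →
    ∀ a ∈ flowValues, ∀ b ∈ flowValues, ∀ c ∈ flowValues,
    ∀ m₁ ∈ flowValues, ∀ m₂ ∈ flowValues, ∀ m₃ ∈ flowValues,
    SecondTriangle u v t a b c m₁ m₂ m₃ → ∃ r ∈ pieceTable, r.2.1 = (m₁, m₂, m₃) := by
  decide +kernel

/-- This and its mirror image exclude the one pair of pieces for which a box beside the triangle
would not be carried to a box equation. The two flux differences are those forced by the side of
that box. -/
theorem first_exclusion_bool : ∀ u v t : Bool, (t → v) → (v → u) →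
    ∀ a ∈ flowValues, ∀ b ∈ flowValues, ∀ c ∈ flowValues, FirstTriangle u v t a b c 0 0 1 →
    ∀ a' ∈ flowValues, ∀ b' ∈ flowValues, ∀ c' ∈ flowValues,
    FirstTriangle u v t a' b' c' (-1) 0 0 → a' - a = 1 → ¬ c' - (c - 1) = 1 := by
  decide +kernel

theorem second_exclusion_bool : ∀ u v t : Bool, (t → v) → (v → u) →
    ∀ a ∈ flowValues, ∀ b ∈ flowValues, ∀ c ∈ flowValues, SecondTriangle u v t a b c 0 0 1 →
    ∀ a' ∈ flowValues, ∀ b' ∈ flowValues, ∀ c' ∈ flowValues,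
    SecondTriangle u v t a' b' c' (-1) 0 0 → c' - c = -1 → ¬ a' - (a + 1) = -1 := by
  decide +kernel

/-- The three identities say that both pieces of a row have the same net effect on `x`, `y` and `z`.
Read with the two triangles interchanged, they are the same identities in another order. -/
theorem table_flow_bool : ∀ r ∈ symmetricTable,
    r.1.1 + r.1.2.1 = r.2.1.2.1 + r.2.1.2.2 ∧ r.1.2.2 - r.1.1 = r.2.1.1 - r.2.1.2.2 ∧
    r.1.2.1 + r.1.2.2 = r.2.1.1 + r.2.1.2.1 := by
  decide +kernel

end

/-! ### The strings of the triangle, and the flow conditions in it -/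

section

variable {n N : ℕ} {w w' : Fin N → Fin n} {k₀ : Fin n} {m m' : Fin N → ℤ}

theorem InRange.mem_flowValues {P : Prop} {v : ℤ} (h : InRange P v) : v ∈ flowValues := by
  by_cases hP : P
  · rcases h.1 hP with rfl | rfl <;> decide
  · rcases h.2 hP with rfl | rfl <;> decide

theorem InRange.sub_mem_flowValues {P : Prop} {v v' d : ℤ} (h : InRange P v) (h' : InRange P v')
    (hd : v' - v = d) : d ∈ flowValues := by
  subst hd
  by_cases hP : P
  · rcases h.1 hP with rfl | rfl <;> rcases h'.1 hP with rfl | rfl <;> decide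
  · rcases h.2 hP with rfl | rfl <;> rcases h'.2 hP with rfl | rfl <;> decide

section

variable {P Q R : Prop} (hRQ : R → Q) (hQP : Q → P) {a b c : ℤ}
include hRQ hQP

theorem second_of_first {r : (ℤ × ℤ × ℤ) × (ℤ × ℤ × ℤ) × ℤ} (hr : r ∈ symmetricTable)
    (h : FirstTriangle P Q R a b c r.2.1.1 r.2.1.2.1 r.2.1.2.2)
    (hb : FirstNoBypass P Q R a b c r.2.1.1 r.2.1.2.1 r.2.1.2.2) :
    SecondTriangle P Q R a b c r.1.1 r.1.2.1 r.1.2.2 := by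
  classical
  have := second_of_first_bool (decide P) (decide Q) (decide R)
  simp only [decide_eq_true_eq] at this
  exact this hRQ hQP a h.1.1.mem_flowValues b h.2.1.1.mem_flowValues c h.2.2.1.1.mem_flowValues
    r hr h hb

theorem first_of_second {r : (ℤ × ℤ × ℤ) × (ℤ × ℤ × ℤ) × ℤ} (hr : r ∈ symmetricTable)
    (h : SecondTriangle P Q R a b c r.2.1.1 r.2.1.2.1 r.2.1.2.2)
    (hb : SecondNoBypass P Q R a b c r.2.1.1 r.2.1.2.1 r.2.1.2.2) :
    FirstTriangle P Q R a b c r.1.1 r.1.2.1 r.1.2.2 := by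
  classical
  have := first_of_second_bool (decide P) (decide Q) (decide R)
  simp only [decide_eq_true_eq] at this
  exact this hRQ hQP a h.1.1.mem_flowValues b h.2.1.1.mem_flowValues c h.2.2.1.1.mem_flowValues
    r hr h hb

theorem FirstTriangle.mem_table {m₁ m₂ m₃ : ℤ} (h : FirstTriangle P Q R a b c m₁ m₂ m₃) :
    ∃ r ∈ pieceTable, r.2.1 = (m₁, m₂, m₃) := by
  classical
  have := first_mem_table_bool (decide P) (decide Q) (decide R)
  simp only [decide_eq_true_eq] at this
  exact this hRQ hQP a h.1.1.mem_flowValues b h.2.1.1.mem_flowValues c h.2.2.1.1.mem_flowValues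
    m₁ (h.1.1.sub_mem_flowValues h.1.2.1 (by ring))
    m₂ (h.1.2.1.sub_mem_flowValues h.1.2.2 (by ring))
    m₃ (h.2.1.2.1.sub_mem_flowValues h.2.1.2.2 (by ring)) h

theorem SecondTriangle.mem_table {m₁ m₂ m₃ : ℤ} (h : SecondTriangle P Q R a b c m₁ m₂ m₃) :
    ∃ r ∈ pieceTable, r.2.1 = (m₁, m₂, m₃) := by
  classical
  have := second_mem_table_bool (decide P) (decide Q) (decide R)
  simp only [decide_eq_true_eq] at this
  exact this hRQ hQP a h.1.1.mem_flowValues b h.2.1.1.mem_flowValues c h.2.2.1.1.mem_flowValues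
    m₁ (h.2.1.1.sub_mem_flowValues h.2.1.2.1 (by ring))
    m₂ (h.1.1.sub_mem_flowValues h.1.2.1 (by ring))
    m₃ (h.1.2.1.sub_mem_flowValues h.1.2.2 (by ring)) h

theorem FirstTriangle.exclusion {a' b' c' : ℤ} (h : FirstTriangle P Q R a b c 0 0 1)
    (h' : FirstTriangle P Q R a' b' c' (-1) 0 0) (ha : a' - a = 1) : ¬ c' - (c - 1) = 1 := by
  classical
  have := first_exclusion_bool (decide P) (decide Q) (decide R)
  simp only [decide_eq_true_eq] at this
  exact this hRQ hQP a h.1.1.mem_flowValues b h.2.1.1.mem_flowValues c h.2.2.1.1.mem_flowValues h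
    a' h'.1.1.mem_flowValues b' h'.2.1.1.mem_flowValues c' h'.2.2.1.1.mem_flowValues h' ha

theorem SecondTriangle.exclusion {a' b' c' : ℤ} (h : SecondTriangle P Q R a b c 0 0 1)
    (h' : SecondTriangle P Q R a' b' c' (-1) 0 0) (hc : c' - c = -1) : ¬ a' - (a + 1) = -1 := by
  classical
  have := second_exclusion_bool (decide P) (decide Q) (decide R)
  simp only [decide_eq_true_eq] at this
  exact this hRQ hQP a h.1.1.mem_flowValues b h.2.1.1.mem_flowValues c h.2.2.1.1.mem_flowValues h
    a' h'.1.1.mem_flowValues b' h'.2.1.1.mem_flowValues c' h'.2.2.1.1.mem_flowValues h' hc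

end

/-- Three consecutive crossings `xy`, `xz`, `yz` of strings `x < y < z`. -/
structure IsFirst (w : Fin N → Fin n) (i j k : Fin N) (x y z : Fin (n + 1)) : Prop where
  hj : (j : ℕ) = i + 1
  hk : (k : ℕ) = i + 2
  xy : x < y
  yz : y < z
  li : leftString w i = x
  ri : rightString w i = y
  lj : leftString w j = x
  rj : rightString w j = z
  lk : leftString w k = y
  rk : rightString w k = z

/-- Three consecutive crossings `yz`, `xz`, `xy` of strings `x < y < z`. -/
structure IsSecond (w : Fin N → Fin n) (i j k : Fin N) (x y z : Fin (n + 1)) : Prop where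
  hj : (j : ℕ) = i + 1
  hk : (k : ℕ) = i + 2
  xy : x < y
  yz : y < z
  li : leftString w i = y
  ri : rightString w i = z
  lj : leftString w j = x
  rj : rightString w j = z
  lk : leftString w k = x
  rk : rightString w k = y

variable {i j k : Fin N} {x y z : Fin (n + 1)}

theorem upward_mono {s s' : Fin (n + 1)} (h : s < s') : Upward k₀ s' → Upward k₀ s :=
  fun h' => h.le.trans h'

theorem upward_iff (s : Fin (n + 1)) : Upward k₀ s ↔ (s : ℕ) < k₀ + 1 := by
  rw [Upward, Fin.le_def, Fin.val_castSucc]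
  omega

theorem precedes_of_lt {s : Fin (n + 1)} {p q : Fin N} (hp : Passes w p s) (hq : Passes w q s)
    (hs : ¬ Upward k₀ s) (hpq : p < q) : Precedes w (k₀ + 1) p q := by
  rw [upward_iff] at hs
  exact ⟨s, hp, hq, Or.inr ⟨by omega, hpq⟩⟩

theorem precedes_of_gt {s : Fin (n + 1)} {p q : Fin N} (hp : Passes w p s) (hq : Passes w q s)
    (hs : Upward k₀ s) (hpq : q < p) : Precedes w (k₀ + 1) p q := by
  rw [upward_iff] at hs
  exact ⟨s, hp, hq, Or.inl ⟨hs, hpq⟩⟩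

/-- `NoBypass` for a segment traversed in either direction. -/
theorem NoBypass.apply (h : NoBypass w k₀ m) {s s₁ s₂ : Fin (n + 1)} {p q v : Fin N}
    (hp : Passes w p s) (hq : Passes w q s) (hpq : p < q)
    (hno : ∀ r, p < r → r < q → ¬ Passes w r s) (hflux : flux w m s q ≠ 0)
    (hp₁ : Passes w p s₁) (hv₁ : Passes w v s₁) (hv₂ : Passes w v s₂) (hq₂ : Passes w q s₂)
    (h₁ : (Upward k₀ s ↔ Upward k₀ s₁) ↔ p < v) (h₂ : (Upward k₀ s ↔ Upward k₀ s₂) ↔ v < q)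
    (hpv : p ≠ v) (hvq : v ≠ q) {s' : Fin (n + 1)} (hs' : Passes w v s') :
    flux w m s' v = 0 ∧ flux w m s' (v + 1) = 0 := by
  have hpv' := hpv.lt_or_gt
  have hvq' := hvq.lt_or_gt
  by_cases hs : Upward k₀ s
  · refine h s q p v ⟨hq, hp, Or.inl ⟨hs, hpq, hno⟩⟩ ?_ ?_ ?_ s' hs'
    · rwa [max_eq_left (show (p : ℕ) ≤ q from hpq.le)]
    · by_cases h3 : Upward k₀ s₂
      · exact precedes_of_gt hq₂ hv₂ h3 (h₂.1 (iff_of_true hs h3))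
      · exact precedes_of_lt hq₂ hv₂ h3
          (hvq'.resolve_left fun h => h3 ((h₂.2 h).1 hs))
    · by_cases h3 : Upward k₀ s₁
      · exact precedes_of_gt hv₁ hp₁ h3 (h₁.1 (iff_of_true hs h3))
      · exact precedes_of_lt hv₁ hp₁ h3
          (hpv'.resolve_left fun h => h3 ((h₁.2 h).1 hs))
  · refine h s p q v ⟨hp, hq, Or.inr ⟨hs, hpq, hno⟩⟩ ?_ ?_ ?_ s' hs'
    · rwa [max_eq_right (show (p : ℕ) ≤ q from hpq.le)]
    · by_cases h3 : Upward k₀ s₁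
      · exact precedes_of_gt hp₁ hv₁ h3 (hpv'.resolve_left fun h => hs ((h₁.2 h).2 h3))
      · exact precedes_of_lt hp₁ hv₁ h3 (h₁.1 (iff_of_false hs h3))
    · by_cases h3 : Upward k₀ s₂
      · exact precedes_of_gt hv₂ hq₂ h3 (hvq'.resolve_left fun h => hs ((h₂.2 h).2 h3))
      · exact precedes_of_lt hv₂ hq₂ h3 (h₂.1 (iff_of_false hs h3))

theorem flux_succ_of_not_passes (w : Fin N → Fin n) (m : Fin N → ℤ) {p : Fin N} {s : Fin (n + 1)}
    (h : ¬ Passes w p s) : flux w m s (p + 1) = flux w m s p := by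
  rw [flux_succ, crossFlow_of_not_passes m h, add_zero]

namespace IsFirst

variable (h : IsFirst w i j k x y z)
include h

theorem flux_values (m : Fin N → ℤ) :
    flux w m x (i + 1) = flux w m x i + m i ∧ flux w m y (i + 1) = flux w m y i - m i ∧
    flux w m x (i + 2) = flux w m x i + m i + m j ∧ flux w m y (i + 2) = flux w m y i - m i ∧
    flux w m z (i + 1) = flux w m z i ∧ flux w m z (i + 2) = flux w m z i - m j ∧
    flux w m x (i + 3) = flux w m x i + m i + m j ∧
    flux w m y (i + 3) = flux w m y i - m i + m k ∧
    flux w m z (i + 3) = flux w m z i - m j - m k := by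
  have hxy := h.xy.ne
  have hyz := h.yz.ne
  have hxz := (h.xy.trans h.yz).ne
  have e1 := flux_succ_left w m i
  have e2 := flux_succ_right w m i
  have e3 := flux_succ_left w m j
  have e4 := flux_succ_right w m j
  have e5 := flux_succ_left w m k
  have e6 := flux_succ_right w m k
  have e7 := flux_succ_of_not_passes w m (p := i) (s := z)
    (by rw [Passes, h.li, h.ri]; tauto)
  have e8 := flux_succ_of_not_passes w m (p := j) (s := y)
    (by rw [Passes, h.lj, h.rj]; tauto)
  have e9 := flux_succ_of_not_passes w m (p := k) (s := x)
    (by rw [Passes, h.lk, h.rk]; tauto)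
  rw [h.li] at e1
  rw [h.ri] at e2
  rw [h.lj] at e3
  rw [h.rj] at e4
  rw [h.lk] at e5
  rw [h.rk] at e6
  rw [h.hj] at e3 e4 e8
  rw [h.hk] at e5 e6 e9
  simp only [add_assoc, Nat.reduceAdd] at e3 e4 e5 e6 e8 e9
  refine ⟨?_, ?_, ?_, ?_, ?_, ?_, ?_, ?_, ?_⟩ <;> linarith

theorem triangle (hf : IsFlow w k₀ m) :
    FirstTriangle (Upward k₀ x) (Upward k₀ y) (Upward k₀ z) (flux w m x i) (flux w m y i)
      (flux w m z i) (m i) (m j) (m k) := by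
  obtain ⟨e1, e2, e3, e4, e5, e6, e7, e8, e9⟩ := h.flux_values m
  have hN := k.2
  have hk := h.hk
  have n1 := hf.node i
  have n2 := hf.node j
  have n3 := hf.node k
  rw [h.li, h.ri] at n1
  rw [h.lj, h.rj, h.hj, e1, e5] at n2
  rw [h.lk, h.rk, h.hk, e4, e6] at n3
  refine ⟨⟨?_, ?_, ?_⟩, ⟨?_, ?_, ?_⟩, ⟨?_, ?_, ?_⟩, n1, n2, n3⟩
  · exact hf.inRange _ (by omega)
  · rw [← e1]; exact hf.inRange _ (by omega)
  · rw [← e7]; exact hf.inRange _ (by omega)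
  · exact hf.inRange _ (by omega)
  · rw [← e2]; exact hf.inRange _ (by omega)
  · rw [← e8]; exact hf.inRange _ (by omega)
  · exact hf.inRange _ (by omega)
  · rw [← e6]; exact hf.inRange _ (by omega)
  · rw [← e9]; exact hf.inRange _ (by omega)

/-- Each side of the triangle is a segment of one string. Each clause takes one side and the
orientations for which the other two sides form an oriented detour through the opposite corner. -/
theorem noBypass (hb : NoBypass w k₀ m) :
    FirstNoBypass (Upward k₀ x) (Upward k₀ y) (Upward k₀ z) (flux w m x i) (flux w m y i)
      (flux w m z i) (m i) (m j) (m k) := by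
  obtain ⟨e1, e2, e3, e4, e5, e6, e7, e8, e9⟩ := h.flux_values m
  have hij : i < j := by rw [Fin.lt_def, h.hj]; omega
  have hjk : j < k := by rw [Fin.lt_def, h.hj, h.hk]; omega
  have hik := hij.trans hjk
  have mxy := upward_mono (k₀ := k₀) h.xy
  have myz := upward_mono (k₀ := k₀) h.yz
  have hxi : Passes w i x := Or.inl h.li.symm
  have hyi : Passes w i y := Or.inr h.ri.symm
  have hxj : Passes w j x := Or.inl h.lj.symm
  have hzj : Passes w j z := Or.inr h.rj.symm
  have hyk : Passes w k y := Or.inl h.lk.symm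
  have hzk : Passes w k z := Or.inr h.rk.symm
  have hnyj : ¬ Passes w j y := by
    rw [Passes, h.lj, h.rj]
    exact fun h' => h'.elim h.xy.ne' h.yz.ne
  have adj : ∀ r, ¬ (i < r ∧ r < j) ∧ ¬ (j < r ∧ r < k) ∧ (i < r ∧ r < k → r = j) := by
    intro r
    have := h.hj
    have := h.hk
    simp only [Fin.lt_def, Fin.ext_iff]
    omega
  refine ⟨fun hP hne => ?_, fun hP hne => ?_, fun hP hne => ?_⟩
  · have key : ∀ s', Passes w j s' → flux w m s' j = 0 ∧ flux w m s' (j + 1) = 0 :=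
      fun s' hs' => hb.apply hyi hyk hik (fun r h1 h2 => (adj r).2.2 ⟨h1, h2⟩ ▸ hnyj)
        (by rwa [h.hk, e4]) hxi hxj hzj hzk (iff_of_true (by tauto) hij)
        (iff_of_true (by tauto) hjk) hij.ne hjk.ne hs'
    have k1 := key x hxj
    have k2 := key z hzj
    rw [h.hj] at k1 k2
    rw [e1, e3] at k1
    rw [e5, e6] at k2
    exact ⟨k1.1, k1.2, k2⟩
  · have key : ∀ s', Passes w i s' → flux w m s' i = 0 ∧ flux w m s' (i + 1) = 0 :=
      fun s' hs' => hb.apply hzj hzk hjk (fun r h1 h2 => absurd ⟨h1, h2⟩ (adj r).2.1)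
        (by rwa [h.hk, e6]) hxj hxi hyi hyk (iff_of_false (by tauto) hij.not_gt)
        (iff_of_true (by tauto) hik) hij.ne' hik.ne hs'
    have k1 := key x hxi
    have k2 := key y hyi
    rw [e1] at k1
    rw [e2] at k2
    exact ⟨k1.1, k1.2, k2⟩
  · have key : ∀ s', Passes w k s' → flux w m s' k = 0 ∧ flux w m s' (k + 1) = 0 :=
      fun s' hs' => hb.apply hxi hxj hij (fun r h1 h2 => absurd ⟨h1, h2⟩ (adj r).1)
        (by rwa [h.hj, e1]) hyi hyk hzk hzj (iff_of_true (by tauto) hik)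
        (iff_of_false (by tauto) hjk.not_gt) hik.ne hjk.ne' hs'
    have k1 := key y hyk
    have k2 := key z hzk
    rw [h.hk] at k1 k2
    rw [e4, e8] at k1
    rw [e6, e9] at k2
    exact ⟨k1.1, k1.2, k2⟩

theorem node_of_triangle
    (hT : FirstTriangle (Upward k₀ x) (Upward k₀ y) (Upward k₀ z) (flux w m x i) (flux w m y i)
      (flux w m z i) (m i) (m j) (m k)) (p : Fin N) (hp : (i : ℕ) ≤ p) (hp' : (p : ℕ) < i + 3) :
    NodeCondition (Upward k₀ (leftString w p)) (Upward k₀ (rightString w p))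
        (flux w m (leftString w p) p) (flux w m (rightString w p) p) (m p) ∧
      ∀ s, Passes w p s → InRange (Upward k₀ s) (flux w m s (p + 1)) := by
  obtain ⟨e1, e2, e3, e4, e5, e6, e7, e8, e9⟩ := h.flux_values m
  obtain ⟨⟨r1, r2, r3⟩, ⟨r4, r5, r6⟩, ⟨r7, r8, r9⟩, n1, n2, n3⟩ := hT
  have : p = i ∨ p = j ∨ p = k := by
    simp only [Fin.ext_iff, h.hj, h.hk]
    omega
  rcases this with rfl | rfl | rfl
  · rw [h.li, h.ri]
    refine ⟨n1, fun s hs => ?_⟩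
    rw [Passes, h.li, h.ri] at hs
    rcases hs with rfl | rfl
    · rwa [e1]
    · rwa [e2]
  · rw [h.lj, h.rj, h.hj, e1, e5]
    refine ⟨n2, fun s hs => ?_⟩
    rw [Passes, h.lj, h.rj] at hs
    rcases hs with rfl | rfl
    · rwa [e3]
    · rwa [e6]
  · rw [h.lk, h.rk, h.hk, e4, e6]
    refine ⟨n3, fun s hs => ?_⟩
    rw [Passes, h.lk, h.rk] at hs
    rcases hs with rfl | rfl
    · rwa [e8]
    · rwa [e9]

end IsFirst

namespace IsSecond

variable (h : IsSecond w i j k x y z)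
include h

theorem flux_values (m : Fin N → ℤ) :
    flux w m x (i + 1) = flux w m x i ∧ flux w m y (i + 1) = flux w m y i + m i ∧
    flux w m x (i + 2) = flux w m x i + m j ∧ flux w m y (i + 2) = flux w m y i + m i ∧
    flux w m z (i + 1) = flux w m z i - m i ∧ flux w m z (i + 2) = flux w m z i - m i - m j ∧
    flux w m x (i + 3) = flux w m x i + m j + m k ∧
    flux w m y (i + 3) = flux w m y i + m i - m k ∧
    flux w m z (i + 3) = flux w m z i - m i - m j := by
  have hxy := h.xy.ne
  have hyz := h.yz.ne
  have hxz := (h.xy.trans h.yz).ne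
  have e1 := flux_succ_left w m i
  have e2 := flux_succ_right w m i
  have e3 := flux_succ_left w m j
  have e4 := flux_succ_right w m j
  have e5 := flux_succ_left w m k
  have e6 := flux_succ_right w m k
  have e7 := flux_succ_of_not_passes w m (p := i) (s := x)
    (by rw [Passes, h.li, h.ri]; tauto)
  have e8 := flux_succ_of_not_passes w m (p := j) (s := y)
    (by rw [Passes, h.lj, h.rj]; tauto)
  have e9 := flux_succ_of_not_passes w m (p := k) (s := z)
    (by rw [Passes, h.lk, h.rk]; tauto)
  rw [h.li] at e1
  rw [h.ri] at e2
  rw [h.lj] at e3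
  rw [h.rj] at e4
  rw [h.lk] at e5
  rw [h.rk] at e6
  rw [h.hj] at e3 e4 e8
  rw [h.hk] at e5 e6 e9
  simp only [add_assoc, Nat.reduceAdd] at e3 e4 e5 e6 e8 e9
  refine ⟨?_, ?_, ?_, ?_, ?_, ?_, ?_, ?_, ?_⟩ <;> linarith

theorem triangle (hf : IsFlow w k₀ m) :
    SecondTriangle (Upward k₀ x) (Upward k₀ y) (Upward k₀ z) (flux w m x i) (flux w m y i)
      (flux w m z i) (m i) (m j) (m k) := by
  obtain ⟨e1, e2, e3, e4, e5, e6, e7, e8, e9⟩ := h.flux_values m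
  have hN := k.2
  have hk := h.hk
  have n1 := hf.node i
  have n2 := hf.node j
  have n3 := hf.node k
  rw [h.li, h.ri] at n1
  rw [h.lj, h.rj, h.hj, e1, e5] at n2
  rw [h.lk, h.rk, h.hk, e4, e3] at n3
  refine ⟨⟨?_, ?_, ?_⟩, ⟨?_, ?_, ?_⟩, ⟨?_, ?_, ?_⟩, n1, n2, n3⟩
  · exact hf.inRange _ (by omega)
  · rw [← e3]; exact hf.inRange _ (by omega)
  · rw [← e7]; exact hf.inRange _ (by omega)
  · exact hf.inRange _ (by omega)
  · rw [← e2]; exact hf.inRange _ (by omega)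
  · rw [← e8]; exact hf.inRange _ (by omega)
  · exact hf.inRange _ (by omega)
  · rw [← e5]; exact hf.inRange _ (by omega)
  · rw [← e9]; exact hf.inRange _ (by omega)

theorem noBypass (hb : NoBypass w k₀ m) :
    SecondNoBypass (Upward k₀ x) (Upward k₀ y) (Upward k₀ z) (flux w m x i) (flux w m y i)
      (flux w m z i) (m i) (m j) (m k) := by
  obtain ⟨e1, e2, e3, e4, e5, e6, e7, e8, e9⟩ := h.flux_values m
  have hij : i < j := by rw [Fin.lt_def, h.hj]; omega
  have hjk : j < k := by rw [Fin.lt_def, h.hj, h.hk]; omega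
  have hik := hij.trans hjk
  have mxy := upward_mono (k₀ := k₀) h.xy
  have myz := upward_mono (k₀ := k₀) h.yz
  have hyi : Passes w i y := Or.inl h.li.symm
  have hzi : Passes w i z := Or.inr h.ri.symm
  have hxj : Passes w j x := Or.inl h.lj.symm
  have hzj : Passes w j z := Or.inr h.rj.symm
  have hxk : Passes w k x := Or.inl h.lk.symm
  have hyk : Passes w k y := Or.inr h.rk.symm
  have hnyj : ¬ Passes w j y := by
    rw [Passes, h.lj, h.rj]
    exact fun h' => h'.elim h.xy.ne' h.yz.ne
  have adj : ∀ r, ¬ (i < r ∧ r < j) ∧ ¬ (j < r ∧ r < k) ∧ (i < r ∧ r < k → r = j) := by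
    intro r
    have := h.hj
    have := h.hk
    simp only [Fin.lt_def, Fin.ext_iff]
    omega
  refine ⟨fun hP hne => ?_, fun hP hne => ?_, fun hP hne => ?_⟩
  · have key : ∀ s', Passes w j s' → flux w m s' j = 0 ∧ flux w m s' (j + 1) = 0 :=
      fun s' hs' => hb.apply hyi hyk hik (fun r h1 h2 => (adj r).2.2 ⟨h1, h2⟩ ▸ hnyj)
        (by rwa [h.hk, e4]) hzi hzj hxj hxk (iff_of_true (by tauto) hij)
        (iff_of_true (by tauto) hjk) hij.ne hjk.ne hs'
    have k1 := key x hxj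
    have k2 := key z hzj
    rw [h.hj] at k1 k2
    rw [e1, e3] at k1
    rw [e5, e6] at k2
    exact ⟨k1.1, k1.2, k2⟩
  · have key : ∀ s', Passes w k s' → flux w m s' k = 0 ∧ flux w m s' (k + 1) = 0 :=
      fun s' hs' => hb.apply hzi hzj hij (fun r h1 h2 => absurd ⟨h1, h2⟩ (adj r).1)
        (by rwa [h.hj, e5]) hyi hyk hxk hxj (iff_of_true (by tauto) hik)
        (iff_of_false (by tauto) hjk.not_gt) hik.ne hjk.ne' hs'
    have k1 := key x hxk
    have k2 := key y hyk
    rw [h.hk] at k1 k2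
    rw [e3, e7] at k1
    rw [e4, e8] at k2
    exact ⟨k1.1, k1.2, k2⟩
  · have key : ∀ s', Passes w i s' → flux w m s' i = 0 ∧ flux w m s' (i + 1) = 0 :=
      fun s' hs' => hb.apply hxj hxk hjk (fun r h1 h2 => absurd ⟨h1, h2⟩ (adj r).2.1)
        (by rwa [h.hk, e3]) hzj hzi hyi hyk (iff_of_false (by tauto) hij.not_gt)
        (iff_of_true (by tauto) hik) hij.ne' hik.ne hs'
    have k1 := key y hyi
    have k2 := key z hzi
    rw [e2] at k1
    rw [e5] at k2
    exact ⟨k1.1, k1.2, k2⟩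

theorem node_of_triangle
    (hT : SecondTriangle (Upward k₀ x) (Upward k₀ y) (Upward k₀ z) (flux w m x i) (flux w m y i)
      (flux w m z i) (m i) (m j) (m k)) (p : Fin N) (hp : (i : ℕ) ≤ p) (hp' : (p : ℕ) < i + 3) :
    NodeCondition (Upward k₀ (leftString w p)) (Upward k₀ (rightString w p))
        (flux w m (leftString w p) p) (flux w m (rightString w p) p) (m p) ∧
      ∀ s, Passes w p s → InRange (Upward k₀ s) (flux w m s (p + 1)) := by
  obtain ⟨e1, e2, e3, e4, e5, e6, e7, e8, e9⟩ := h.flux_values m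
  obtain ⟨⟨r1, r2, r3⟩, ⟨r4, r5, r6⟩, ⟨r7, r8, r9⟩, n1, n2, n3⟩ := hT
  have : p = i ∨ p = j ∨ p = k := by
    simp only [Fin.ext_iff, h.hj, h.hk]
    omega
  rcases this with rfl | rfl | rfl
  · rw [h.li, h.ri]
    refine ⟨n1, fun s hs => ?_⟩
    rw [Passes, h.li, h.ri] at hs
    rcases hs with rfl | rfl
    · rwa [e2]
    · rwa [e5]
  · rw [h.lj, h.rj, h.hj, e1, e5]
    refine ⟨n2, fun s hs => ?_⟩
    rw [Passes, h.lj, h.rj] at hs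
    rcases hs with rfl | rfl
    · rwa [e3]
    · rwa [e6]
  · rw [h.lk, h.rk, h.hk, e4, e3]
    refine ⟨n3, fun s hs => ?_⟩
    rw [Passes, h.lk, h.rk] at hs
    rcases hs with rfl | rfl
    · rwa [e7]
    · rwa [e8]

end IsSecond

end

/-! ### String inequalities under a 3-move -/

section

variable {n N : ℕ} {w w' : Fin N → Fin n} {m m' : Fin N → ℤ}

theorem column_succ_of_left {p : Fin N} {s : Fin (n + 1)} (h : (column w p s : ℕ) = w p) :
    (column w (p + 1) s : ℕ) = w p + 1 := by
  have h' : column w p s = (w p).castSucc := Fin.ext h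
  rw [column_succ, h', simpleSwap, Equiv.swap_apply_left, Fin.val_succ]

theorem column_succ_of_right {p : Fin N} {s : Fin (n + 1)} (h : (column w p s : ℕ) = w p + 1) :
    (column w (p + 1) s : ℕ) = w p := by
  have h' : column w p s = (w p).succ := Fin.ext h
  rw [column_succ, h', simpleSwap, Equiv.swap_apply_right, Fin.val_castSucc]

theorem column_succ_of_ne {p : Fin N} {s : Fin (n + 1)} (h : (column w p s : ℕ) ≠ w p)
    (h' : (column w p s : ℕ) ≠ w p + 1) : (column w (p + 1) s : ℕ) = column w p s := by
  rw [column_succ, simpleSwap, Equiv.swap_apply_of_ne_of_ne (fun e => h (congrArg Fin.val e))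
    (fun e => h' (congrArg Fin.val e))]

theorem leftString_eq_iff (w : Fin N → Fin n) (p : Fin N) (s : Fin (n + 1)) :
    leftString w p = s ↔ (column w p s : ℕ) = w p := by
  rw [eq_comm, eq_leftString_iff, Fin.ext_iff, Fin.val_castSucc]

theorem rightString_eq_iff (w : Fin N → Fin n) (p : Fin N) (s : Fin (n + 1)) :
    rightString w p = s ↔ (column w p s : ℕ) = w p + 1 := by
  rw [eq_comm, eq_rightString_iff, Fin.ext_iff, Fin.val_succ]

namespace ThreeMove

variable {i j k : Fin N}

theorem symm (h : ThreeMove w w' i j k) : ThreeMove w' w i j k where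
  hj := h.hj
  hk := h.hk
  same := by rw [h.left, h.right]
  adjacent := by rw [h.left, h.middle]; exact h.adjacent.symm
  left := h.middle.symm
  middle := h.left.symm
  right := by rw [h.same, h.middle]
  other q h1 h2 h3 := (h.other q h1 h2 h3).symm

theorem column_left (h : ThreeMove w w' i j k) : column w' i = column w i :=
  column_eq_before i.2.le fun q hq => h.other q (fun e => by subst e; omega)
    (fun e => by have := h.hj; subst e; omega) (fun e => by have := h.hk; subst e; omega)

theorem column_hi (h : ThreeMove w w' i j k) : column w' (i + 3) = column w (i + 3) := by
  funext s
  rw [Fin.ext_iff]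
  have hj := h.hj
  have hk := h.hk
  have e0 : (i : ℕ) + 3 = k + 1 := by omega
  have c0 : (column w' i s : ℕ) = column w i s := by rw [h.column_left]
  have hl := congrArg Fin.val h.left
  have hm := congrArg Fin.val h.middle
  have hr := congrArg Fin.val h.right
  have hs := congrArg Fin.val h.same
  have hadj := h.adjacent
  have step : ∀ (v : Fin N → Fin n) (p q : Fin N), (q : ℕ) = p + 1 →
      ((column v p s : ℕ) = v p ∧ (column v q s : ℕ) = v p + 1) ∨
      ((column v p s : ℕ) = v p + 1 ∧ (column v q s : ℕ) = v p) ∨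
      ((column v p s : ℕ) ≠ v p ∧ (column v p s : ℕ) ≠ v p + 1 ∧
        (column v q s : ℕ) = column v p s) := by
    intro v p q hq
    rw [hq]
    by_cases h1 : (column v p s : ℕ) = v p
    · exact Or.inl ⟨h1, column_succ_of_left h1⟩
    by_cases h2 : (column v p s : ℕ) = v p + 1
    · exact Or.inr (Or.inl ⟨h2, column_succ_of_right h2⟩)
    · exact Or.inr (Or.inr ⟨h1, h2, column_succ_of_ne h1 h2⟩)
  have last : ∀ (v : Fin N → Fin n) (p : Fin N),
      ((column v p s : ℕ) = v p ∧ (column v (p + 1) s : ℕ) = v p + 1) ∨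
      ((column v p s : ℕ) = v p + 1 ∧ (column v (p + 1) s : ℕ) = v p) ∨
      ((column v p s : ℕ) ≠ v p ∧ (column v p s : ℕ) ≠ v p + 1 ∧
        (column v (p + 1) s : ℕ) = column v p s) := by
    intro v p
    by_cases h1 : (column v p s : ℕ) = v p
    · exact Or.inl ⟨h1, column_succ_of_left h1⟩
    by_cases h2 : (column v p s : ℕ) = v p + 1
    · exact Or.inr (Or.inl ⟨h2, column_succ_of_right h2⟩)
    · exact Or.inr (Or.inr ⟨h1, h2, column_succ_of_ne h1 h2⟩)
  rw [e0]
  have a1 := step w i j hj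
  have a2 := step w j k (by omega)
  have a3 := last w k
  have b1 := step w' i j hj
  have b2 := step w' j k (by omega)
  have b3 := last w' k
  clear step last
  rcases a1 with a1 | a1 | a1 <;> rcases a2 with a2 | a2 | a2 <;> rcases hadj with hadj | hadj <;>
    first | (exfalso; omega) | skip
  all_goals omega

theorem column_of_ne (h : ThreeMove w w' i j k) {p : Fin N} (hi : p ≠ i) (hj : p ≠ j)
    (hk : p ≠ k) : column w' p = column w p := by
  have hij := h.hj
  have hik := h.hk
  have hi : (p : ℕ) ≠ i := fun e => hi (Fin.ext e)
  have hj : (p : ℕ) ≠ j := fun e => hj (Fin.ext e)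
  have hk : (p : ℕ) ≠ k := fun e => hk (Fin.ext e)
  rcases lt_or_ge (p : ℕ) i with hp | hp
  · exact column_eq_before p.2.le fun q hq => h.other q (fun e => by subst e; omega)
      (fun e => by subst e; omega) (fun e => by subst e; omega)
  · exact column_eq_after (t := i + 3) (by omega) p.2.le h.column_hi fun q hq =>
      h.other q (fun e => by subst e; omega) (fun e => by subst e; omega)
        (fun e => by subst e; omega)

/-- Tracking the three columns shows that the letters `(c, c + 1, c)` cross the strings as `xy`,
`xz`, `yz`, and `(c + 1, c, c + 1)` as `yz`, `xz`, `xy`. Reducedness at the first and last crossing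
of `w` orders the strings. -/
theorem triangles_of_lt (h : ThreeMove w w' i j k) (hw : IsReducedWord w)
    (hlt : (w i : ℕ) + 1 = w j) : ∃ x y z, IsFirst w i j k x y z ∧ IsSecond w' i j k x y z := by
  obtain ⟨x, hx⟩ : ∃ x, leftString w i = x := ⟨_, rfl⟩
  obtain ⟨y, hy⟩ : ∃ y, rightString w i = y := ⟨_, rfl⟩
  obtain ⟨z, hz⟩ : ∃ z, rightString w j = z := ⟨_, rfl⟩
  have oxy := leftString_lt_rightString hw i
  rw [hx, hy] at oxy
  have cx := (leftString_eq_iff _ _ _).1 hx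
  have cy := (rightString_eq_iff _ _ _).1 hy
  have cz := (rightString_eq_iff _ _ _).1 hz
  have hi' := congrArg Fin.val h.left
  have hj' := congrArg Fin.val h.middle
  have hk' := congrArg Fin.val h.right
  have hks := congrArg Fin.val h.same
  have hj := h.hj
  have hk : (k : ℕ) = j + 1 := by rw [h.hk, h.hj]
  have cz : (column w i z : ℕ) = w i + 2 := by
    rw [hj] at cz
    by_cases h1 : (column w i z : ℕ) = w i
    · have := column_succ_of_left h1
      omega
    by_cases h2 : (column w i z : ℕ) = w i + 1
    · have := column_succ_of_right h2
      omega
    · have := column_succ_of_ne h1 h2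
      omega
  have x1 : (column w j x : ℕ) = w j := by rw [hj, column_succ_of_left cx, hlt]
  have y1 : (column w j y : ℕ) = w i := by rw [hj, column_succ_of_right cy]
  have z1 : (column w j z : ℕ) = w j + 1 := by
    rw [hj, column_succ_of_ne (by rw [cz]; simp) (by rw [cz]; simp), cz, ← hlt]
  have y2 : (column w k y : ℕ) = w k := by
    rw [hk, column_succ_of_ne (by rw [y1, ← hlt]; clear * -; omega)
      (by rw [y1, ← hlt]; clear * -; omega), y1, h.same]
  have z2 : (column w k z : ℕ) = w k + 1 := by
    rw [hk, column_succ_of_right z1, h.same, hlt]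
  have x0' : (column w' i x : ℕ) = w i := by rw [h.column_left, cx]
  have y0' : (column w' i y : ℕ) = w' i := by rw [h.column_left, cy, h.left, hlt]
  have z0' : (column w' i z : ℕ) = w' i + 1 := by rw [h.column_left, cz, h.left, ← hlt]
  have x1' : (column w' j x : ℕ) = w' j := by
    rw [hj, column_succ_of_ne (by rw [x0', h.left, ← hlt]; clear * -; omega)
      (by rw [x0', h.left, ← hlt]; clear * -; omega), x0', h.middle]
  have y1' : (column w' j y : ℕ) = w j + 1 := by
    rw [hj, column_succ_of_left y0', h.left]
  have z1' : (column w' j z : ℕ) = w' j + 1 := by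
    rw [hj, column_succ_of_right z0', h.left, h.middle, hlt]
  have x2' : (column w' k x : ℕ) = w' k := by
    rw [hk, column_succ_of_left x1', h.middle, h.right, hlt]
  have y2' : (column w' k y : ℕ) = w' k + 1 := by
    rw [hk, column_succ_of_ne (by rw [y1', h.middle, ← hlt]; clear * -; omega)
      (by rw [y1', h.middle, ← hlt]; clear * -; omega), y1', h.right]
  have lk := (leftString_eq_iff w k y).2 y2
  have rk := (rightString_eq_iff w k z).2 z2
  have oyz := leftString_lt_rightString hw k
  rw [lk, rk] at oyz
  exact ⟨x, y, z,
    ⟨h.hj, h.hk, oxy, oyz, hx, hy, (leftString_eq_iff w j x).2 x1, hz, lk, rk⟩,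
    ⟨h.hj, h.hk, oxy, oyz, (leftString_eq_iff w' i y).2 y0', (rightString_eq_iff w' i z).2 z0',
      (leftString_eq_iff w' j x).2 x1', (rightString_eq_iff w' j z).2 z1',
      (leftString_eq_iff w' k x).2 x2', (rightString_eq_iff w' k y).2 y2'⟩⟩

theorem triangles (h : ThreeMove w w' i j k) (hw : IsReducedWord w) (hw' : IsReducedWord w') :
    ∃ x y z, (IsFirst w i j k x y z ∧ IsSecond w' i j k x y z) ∨
      (IsSecond w i j k x y z ∧ IsFirst w' i j k x y z) := by
  rcases h.adjacent with hlt | hlt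
  · obtain ⟨x, y, z, h1⟩ := h.triangles_of_lt hw hlt
    exact ⟨x, y, z, Or.inl h1⟩
  · obtain ⟨x, y, z, h1⟩ := h.symm.triangles_of_lt hw' (by rw [h.left, h.middle]; exact hlt)
    exact ⟨x, y, z, Or.inr h1.symm⟩

/-- The piece of a string monomial at the three crossings of the move. -/
theorem exists_row (h : ThreeMove w w' i j k) (hw : IsReducedWord w) (hw' : IsReducedWord w')
    (hm : m' ∈ stringExponents w') : ∃ r ∈ pieceTable, r.2.1 = (m' i, m' j, m' k) := by
  obtain ⟨k₀, hf, -⟩ := exists_isFlow hw' hm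
  obtain ⟨x, y, z, ⟨-, h2⟩ | ⟨-, h2⟩⟩ := h.triangles hw hw'
  · exact (h2.triangle hf).mem_table (upward_mono h2.yz) (upward_mono h2.xy)
  · exact (h2.triangle hf).mem_table (upward_mono h2.yz) (upward_mono h2.xy)

/-- Any row of the symmetric table may be used, so an ambiguous piece produces two string
inequalities of `w`; the box equations later need this freedom. The flow is replaced inside the
triangle, where the finite checks supply the node conditions. -/
theorem mem_stringExponents (h : ThreeMove w w' i j k) (hw : IsReducedWord w)
    (hw' : IsReducedWord w') (hm : m' ∈ stringExponents w')
    {r : (ℤ × ℤ × ℤ) × (ℤ × ℤ × ℤ) × ℤ} (hr : r ∈ symmetricTable)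
    (hr₁ : r.1 = (m i, m j, m k)) (hr₂ : r.2.1 = (m' i, m' j, m' k))
    (hout : ∀ q, q ≠ i → q ≠ j → q ≠ k → m' q = m q) : m ∈ stringExponents w := by
  obtain ⟨k₀, hf, hb⟩ := exists_isFlow hw' hm
  have hij := h.hj
  have hik := h.hk
  have hag : AgreeOutside w w' m m' i (i + 3) := by
    intro p hp
    have hi : p ≠ i := fun e => by subst e; omega
    have hj : p ≠ j := fun e => by subst e; omega
    have hk : p ≠ k := fun e => by subst e; omega
    exact ⟨(leftString_eq_of_column (h.column_of_ne hi hj hk) (h.other p hi hj hk)).symm,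
      (rightString_eq_of_column (h.column_of_ne hi hj hk) (h.other p hi hj hk)).symm,
      (hout p hi hj hk).symm⟩
  have f0 : ∀ s, flux w m s i = flux w' m' s i := fun s => hag.flux_before s le_rfl i.2.le
  obtain ⟨t1, t2, t3⟩ := table_flow_bool r hr
  have hconst : ∀ (v : Fin N → Fin n) (u : Fin N → ℤ) (s : Fin (n + 1)),
      (∀ p : Fin N, (i : ℕ) ≤ p → (p : ℕ) < i + 3 → ¬ Passes v p s) →
      flux v u s (i + 3) = flux v u s i := fun v u s hs =>
    flux_eq_of_not_passes v u (by omega) hs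
  have hwin : ∀ p : Fin N, (i : ℕ) ≤ p → (p : ℕ) < i + 3 → p = i ∨ p = j ∨ p = k := by
    intro p h1 h2
    simp only [Fin.ext_iff]
    omega
  have hN : (i : ℕ) + 3 ≤ N := by have := k.2; omega
  obtain ⟨x, y, z, ⟨h1, h2⟩ | ⟨h1, h2⟩⟩ := h.triangles hw hw'
  all_goals
    have yz := upward_mono (k₀ := k₀) h2.yz
    have xy := upward_mono (k₀ := k₀) h2.xy
    obtain ⟨-, -, -, -, -, -, e1, e2, e3⟩ := h1.flux_values m
    obtain ⟨-, -, -, -, -, -, e1', e2', e3'⟩ := h2.flux_values m'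
    -- Strings outside the triangle are constant across the window; for `x`, `y`, `z` the rows of
    -- the table have equal net effect.
    have hfin : ∀ s, flux w m s (i + 3) = flux w' m' s (i + 3) := by
      intro s
      by_cases hs : s = x ∨ s = y ∨ s = z
      · simp only [hr₁, hr₂] at t1 t2 t3
        rcases hs with rfl | rfl | rfl
        · rw [e1, e1', f0]; omega
        · rw [e2, e2', f0]; omega
        · rw [e3, e3', f0]; omega
      · push Not at hs
        obtain ⟨sx, sy, sz⟩ := hs
        rw [hconst, hconst, f0]
        · intro p hp1 hp2
          rcases hwin p hp1 hp2 with rfl | rfl | rfl <;>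
            simp [Passes, h2.li, h2.ri, h2.lj, h2.rj, h2.lk, h2.rk, sx, sy, sz]
        · intro p hp1 hp2
          rcases hwin p hp1 hp2 with rfl | rfl | rfl <;>
            simp [Passes, h1.li, h1.ri, h1.lj, h1.rj, h1.lk, h1.rk, sx, sy, sz]
    have T := h2.triangle hf
    have B := h2.noBypass hb
    refine (hf.replace hN hag hfin (h1.node_of_triangle ?_)).mem_stringExponents hw
    rw [f0, f0, f0]
  · have := first_of_second yz xy (r := r) hr (by rw [hr₂]; exact T) (by rw [hr₂]; exact B)
    rwa [hr₁] at this
  · have := second_of_first yz xy (r := r) hr (by rw [hr₂]; exact T) (by rw [hr₂]; exact B)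
    rwa [hr₁] at this

end ThreeMove

/-! ### The two flows of a box equation -/

section Box

variable {top bot : Fin N}

/-- The flows of the two string inequalities in a box equation differ along the sides of the
box. -/
theorem flux_sub_of_box (hbox : IsBox w top bot)
    (heq : m + lambdaExponent w top = m' + lambdaExponent w bot) (s : Fin (n + 1)) (t : ℕ)
    (ht : t ≤ N) : flux w m' s t - flux w m s t =
      if (top : ℕ) < t ∧ t ≤ bot then
        (if (column w t s : ℕ) = w top + 1 then 1 else if (column w t s : ℕ) = w top then -1 else 0)
      else 0 := by
  induction t with
  | zero => simp [flux_zero]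
  | succ t ih =>
    have ih := ih (by omega)
    obtain ⟨p, hp⟩ : ∃ p : Fin N, (p : ℕ) = t := ⟨⟨t, ht⟩, rfl⟩
    subst hp
    have hd := congrFun heq p
    simp only [Pi.add_apply, lambdaExponent] at hd
    obtain ⟨b1, b2, b3⟩ := hbox
    have c1 : (p : ℕ) = top → (w p : ℕ) = w top := fun e => by rw [Fin.ext e]
    have c2 : (p : ℕ) = bot → (w p : ℕ) = w top := fun e => by rw [Fin.ext e, b2]
    have c3 : (top : ℕ) < p → (p : ℕ) < bot → (w p : ℕ) ≠ w top :=
      fun h1 h2 h3 => b3 p h1 h2 (Fin.ext h3)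
    rw [← b2] at hd
    simp only [Fin.ext_iff, Fin.lt_def] at hd b1
    -- This is `λ_top - λ_bot`: at `bot` it is `2 - 1`, and below `bot` the two vectors agree since
    -- the columns are equal. The result is a circulation around the box, `1` on its right side and
    -- `-1` on its left.
    have hδ : m' p - m p = if (p : ℕ) = top ∨ (p : ℕ) = bot then 1 else
        if (top : ℕ) < p ∧ (p : ℕ) < bot ∧ ((w p : ℕ) + 1 = w top ∨ (w top : ℕ) + 1 = w p) then -1
        else 0 := by
      split_ifs at hd ⊢ <;> omega
    clear hd
    have hstep : ((column w p s : ℕ) = w p ∧ (column w (p + 1) s : ℕ) = w p + 1 ∧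
          crossFlow w m' s p - crossFlow w m s p = m' p - m p) ∨
        ((column w p s : ℕ) = w p + 1 ∧ (column w (p + 1) s : ℕ) = w p ∧
          crossFlow w m' s p - crossFlow w m s p = -(m' p - m p)) ∨
        ((column w p s : ℕ) ≠ w p ∧ (column w p s : ℕ) ≠ w p + 1 ∧
          (column w (p + 1) s : ℕ) = column w p s ∧
          crossFlow w m' s p - crossFlow w m s p = 0) := by
      by_cases h1 : (column w p s : ℕ) = w p
      · refine Or.inl ⟨h1, column_succ_of_left h1, ?_⟩
        rw [← (leftString_eq_iff w p s).2 h1, crossFlow_left, crossFlow_left]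
      by_cases h2 : (column w p s : ℕ) = w p + 1
      · refine Or.inr (Or.inl ⟨h2, column_succ_of_right h2, ?_⟩)
        rw [← (rightString_eq_iff w p s).2 h2, crossFlow_right, crossFlow_right]
        ring
      · refine Or.inr (Or.inr ⟨h1, h2, column_succ_of_ne h1 h2, ?_⟩)
        have hp : ¬ Passes w p s := by
          exact fun h => h.elim (fun e => h1 ((leftString_eq_iff w p s).1 e.symm))
            fun e => h2 ((rightString_eq_iff w p s).1 e.symm)
        rw [crossFlow_of_not_passes _ hp, crossFlow_of_not_passes _ hp, sub_zero]
    have hgoal : flux w m' s (p + 1) - flux w m s (p + 1) = flux w m' s p - flux w m s p +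
        (crossFlow w m' s p - crossFlow w m s p) := by
      rw [flux_succ, flux_succ]
      ring
    rw [hgoal, ih]
    clear hgoal ih b3
    generalize (column w p s : ℕ) = x at *
    generalize (column w (p + 1) s : ℕ) = x' at *
    generalize (w p : ℕ) = c at *
    generalize (w top : ℕ) = f at *
    generalize crossFlow w m' s p - crossFlow w m s p = d at *
    generalize m' p - m p = δ at *
    rcases lt_trichotomy (p : ℕ) top with h | h | h
    · rw [if_neg (by omega), if_neg (by omega)] at hδ
      rw [if_neg (c := (top : ℕ) < p ∧ (p : ℕ) ≤ bot) (by omega),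
        if_neg (c := (top : ℕ) < p + 1 ∧ (p : ℕ) + 1 ≤ bot) (by omega)]
      omega
    · rw [if_pos (by omega)] at hδ
      have := c1 h
      rw [if_neg (c := (top : ℕ) < p ∧ (p : ℕ) ≤ bot) (by omega),
        if_pos (c := (top : ℕ) < p + 1 ∧ (p : ℕ) + 1 ≤ bot) (by omega)]
      rcases hstep with hs | hs | hs <;> split_ifs <;> omega
    · rcases lt_trichotomy (p : ℕ) bot with h' | h' | h'
      · rw [if_neg (by omega)] at hδ
        have := c3 h h'
        rw [if_pos (c := (top : ℕ) < p ∧ (p : ℕ) ≤ bot) (by omega),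
          if_pos (c := (top : ℕ) < p + 1 ∧ (p : ℕ) + 1 ≤ bot) (by omega)]
        clear c1 c2 c3
        rcases hstep with hs | hs | hs <;> split_ifs at hδ ⊢ <;> omega
      · rw [if_pos (by omega)] at hδ
        have := c2 h'
        rw [if_pos (c := (top : ℕ) < p ∧ (p : ℕ) ≤ bot) (by omega),
          if_neg (c := (top : ℕ) < p + 1 ∧ (p : ℕ) + 1 ≤ bot) (by omega)]
        rcases hstep with hs | hs | hs <;> split_ifs <;> omega
      · rw [if_neg (by omega), if_neg (by omega)] at hδ
        rw [if_neg (c := (top : ℕ) < p ∧ (p : ℕ) ≤ bot) (by omega),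
          if_neg (c := (top : ℕ) < p + 1 ∧ (p : ℕ) + 1 ≤ bot) (by omega)]
        omega

/-- The circulation around the box has died out at the bottom of the diagram, so both flows start
from the same lower end. -/
theorem eq_of_box {k₁ k₂ : Fin n} (hbox : IsBox w top bot)
    (heq : m + lambdaExponent w top = m' + lambdaExponent w bot) (h₁ : IsFlow w k₁ m)
    (h₂ : IsFlow w k₂ m') : k₁ = k₂ := by
  have := flux_sub_of_box hbox heq k₁.castSucc N le_rfl
  rw [if_neg (by have := bot.2; omega), h₁.final, h₂.final, if_pos rfl] at this
  by_contra hne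
  have hne' : k₁.castSucc ≠ k₂.castSucc := fun h => hne (Fin.castSucc_injective _ h)
  rw [if_neg hne'] at this
  split_ifs at this <;> omega

/-- The triangle touches the side of the box: one of `x`, `z` lies on that side just before the
window, and the other just after it. There the two fluxes differ by a prescribed `1` or `-1`, which
contradicts the finite check for the pieces `(0, 0, 1)` and `(-1, 0, 0)`. -/
theorem exclusion_of_box (hw : IsReducedWord w) {i j k : Fin N} {x y z : Fin (n + 1)}
    (hT : ((w i : ℕ) = w top + 1 ∧ IsFirst w i j k x y z) ∨
      ((w top : ℕ) = w i + 1 ∧ IsSecond w i j k x y z))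
    (hki : w k = w i) (hbox : IsBox w top bot)
    (heq : m + lambdaExponent w top = m' + lambdaExponent w bot) (htop : top < i) (hbot : k < bot)
    (hm : m ∈ stringExponents w) (hm' : m' ∈ stringExponents w)
    (h₁ : (m i, m j, m k) = (0, 0, 1)) (h₂ : (m' i, m' j, m' k) = (-1, 0, 0)) : False := by
  obtain ⟨k₁, hf₁, -⟩ := exists_isFlow hw hm
  obtain ⟨k₂, hf₂, -⟩ := exists_isFlow hw hm'
  obtain rfl := eq_of_box hbox heq hf₁ hf₂
  simp only [Prod.mk.injEq] at h₁ h₂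
  obtain ⟨mi, mj, mk⟩ := h₁
  obtain ⟨mi', mj', mk'⟩ := h₂
  rw [Fin.lt_def] at htop hbot
  have hN := k.2
  rcases hT with ⟨hc, hT⟩ | ⟨hc, hT⟩
  · have hk := hT.hk
    have T := hT.triangle hf₁
    have T' := hT.triangle hf₂
    obtain ⟨-, -, -, -, -, -, -, -, e3⟩ := hT.flux_values m
    obtain ⟨-, -, -, -, -, -, -, -, e3'⟩ := hT.flux_values m'
    rw [mi, mj, mk] at T
    rw [mi', mj', mk'] at T'
    have d1 := flux_sub_of_box hbox heq x i i.2.le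
    have d2 := flux_sub_of_box hbox heq z (i + 3) (by omega)
    have cx := (leftString_eq_iff _ _ _).1 hT.li
    have cz := (rightString_eq_iff _ _ _).1 hT.rk
    have cz' := column_succ_of_right cz
    rw [hki, hk] at cz'
    simp only [add_assoc, Nat.reduceAdd] at cz'
    rw [if_pos (by omega), if_pos (by omega)] at d1 d2
    rw [e3, e3', mj, mk, mj', mk'] at d2
    exact T.exclusion (upward_mono hT.yz) (upward_mono hT.xy) T' d1 (by linarith)
  · have hk := hT.hk
    have T := hT.triangle hf₁
    have T' := hT.triangle hf₂
    obtain ⟨-, -, -, -, -, -, e3, -, -⟩ := hT.flux_values m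
    obtain ⟨-, -, -, -, -, -, e3', -, -⟩ := hT.flux_values m'
    rw [mi, mj, mk] at T
    rw [mi', mj', mk'] at T'
    have d1 := flux_sub_of_box hbox heq z i i.2.le
    have d2 := flux_sub_of_box hbox heq x (i + 3) (by omega)
    have cz := (rightString_eq_iff _ _ _).1 hT.ri
    have cx := (leftString_eq_iff _ _ _).1 hT.lk
    have cx' := column_succ_of_left cx
    rw [hki, hk] at cx'
    simp only [add_assoc, Nat.reduceAdd] at cx'
    rw [if_pos (by omega), if_neg (by omega), if_pos (by omega)] at d1 d2
    rw [e3, e3', mj, mk, mj', mk'] at d2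
    exact T.exclusion (upward_mono hT.yz) (upward_mono hT.xy) T' d1 (by linarith)

end Box

end

/-! ### The correspondence of string inequalities modulo box equations -/

section

variable {n N : ℕ} {w w' : Fin N → Fin n}

section Lambda

theorem lambda_self (w : Fin N → Fin n) (p : Fin N) : lambdaExponent w p p = 1 := by
  simp [lambdaExponent]

theorem lambda_of_lt {p q : Fin N} (h : q < p) : lambdaExponent w p q = 0 := by
  simp [lambdaExponent, h, h.ne]

theorem lambda_of_eq {p q : Fin N} (h : p < q) (hc : w q = w p) : lambdaExponent w p q = 2 := by
  simp [lambdaExponent, h.ne', h.not_gt, hc]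

theorem lambda_of_adjacent {p q : Fin N} (h : p < q)
    (hc : (w q : ℕ) + 1 = w p ∨ (w p : ℕ) + 1 = w q) : lambdaExponent w p q = -1 := by
  have : w q ≠ w p := fun e => by rw [e] at hc; omega
  simp [lambdaExponent, h.ne', h.not_gt, this, hc]

theorem lambda_of_far {p q : Fin N} (h : p < q) (hne : w q ≠ w p)
    (hc : ¬ ((w q : ℕ) + 1 = w p ∨ (w p : ℕ) + 1 = w q)) : lambdaExponent w p q = 0 := by
  simp [lambdaExponent, h.ne', h.not_gt, hne, hc]

/-- The exponents of a `λ`-inequality depend only on the relative positions and on the columns. -/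
theorem lambda_congr {p q p' q' : Fin N} (h₁ : q = p ↔ q' = p') (h₂ : q < p ↔ q' < p')
    (hp : w p = w' p') (hq : w q = w' q') : lambdaExponent w p q = lambdaExponent w' p' q' := by
  simp only [lambdaExponent, h₁, h₂, hp, hq]

end Lambda

/-- The exponent lattice modulo the box equations. -/
def boxQuot (w : Fin N → Fin n) :
    (Ineq w →₀ ℤ) →+ (Ineq w →₀ ℤ) ⧸ boxGroup w := QuotientAddGroup.mk' (boxGroup w)

theorem boxQuot_eq_zero {u : Ineq w →₀ ℤ} : boxQuot w u = 0 ↔ u ∈ boxGroup w :=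
  QuotientAddGroup.eq_zero_iff u

/-- The class of the coefficient of a string inequality. -/
def strClass (d : stringExponents w) : (Ineq w →₀ ℤ) ⧸ boxGroup w :=
  boxQuot w (Finsupp.single (Sum.inr d) 1)

/-- The class of the coefficient of a `λ`-inequality. -/
def lamClass (w : Fin N → Fin n) (l : Fin N) : (Ineq w →₀ ℤ) ⧸ boxGroup w :=
  boxQuot w (Finsupp.single (Sum.inl l) 1)

theorem boxClass {top bot : Fin N} {p₁ p₂ : stringExponents w}
    (h : BoxCondition w top bot p₁ p₂) :
    strClass p₁ + lamClass w top = strClass p₂ + lamClass w bot := by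
  have h1 : boxVector w top bot p₁ p₂ ∈ boxGroup w :=
    AddSubgroup.subset_closure ⟨top, bot, p₁, p₂, h, rfl⟩
  rw [← boxQuot_eq_zero, boxVector, map_sub, map_add, map_add, sub_eq_zero] at h1
  exact h1

theorem boxQuot_ratio (w : Fin N → Fin n) (i k : Fin N) :
    boxQuot w (ratio w i k) = lamClass w k - lamClass w i := by
  rw [ratio, map_sub]
  rfl

/-- `d` is the string exponent of `w` that corresponds to `d'` by the entry of a table `T` with
exponent `e`. -/
def Corresponds (T : List ((ℤ × ℤ × ℤ) × (ℤ × ℤ × ℤ) × ℤ)) (i j k : Fin N)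
    (d' : stringExponents w') (d : stringExponents w) (e : ℤ) : Prop :=
  (∀ q, q ≠ i → q ≠ j → q ≠ k → d'.1 q = d.1 q) ∧
    ((d.1 i, d.1 j, d.1 k), (d'.1 i, d'.1 j, d'.1 k), e) ∈ T

/-- The vector `m` with its piece at `i`, `j`, `k` replaced. -/
def patch (i j k : Fin N) (r : ℤ × ℤ × ℤ) (m : Fin N → ℤ) (q : Fin N) : ℤ :=
  if q = i then r.1 else if q = j then r.2.1 else if q = k then r.2.2 else m q

theorem mem_symmetricTable {r : (ℤ × ℤ × ℤ) × (ℤ × ℤ × ℤ) × ℤ} (h : r ∈ pieceTable) :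
    r ∈ symmetricTable := List.mem_append_left _ h

theorem symmetricTable_symm : ∀ r ∈ symmetricTable, (r.2.1, r.1, -r.2.2) ∈ symmetricTable := by
  decide +kernel

/-- The new piece determines the row, which is why each formula of a 3-move gives exactly one
monomial. -/
theorem pieceTable_unique : ∀ r ∈ pieceTable, ∀ r' ∈ pieceTable, r.2.1 = r'.2.1 → r = r' := by
  decide +kernel

/-- Only `(0, 0, -1)` and `(1, 0, 0)` have two rows. Their old pieces differ by `(1, -1, 1)` and the
exponents by one, exactly as in a box equation for the box between `t_i` and `t_k`. -/
theorem symmetricTable_unique : ∀ r ∈ symmetricTable, ∀ r' ∈ symmetricTable, r.2.1 = r'.2.1 →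
    r = r' ∨ (r.1.1 = -1 ∧ r'.1.2.2 = 1 ∧ r'.1 = r.1 + (1, -1, 1) ∧ r'.2.2 = r.2.2 + 1) ∨
      (r'.1.1 = -1 ∧ r.1.2.2 = 1 ∧ r.1 = r'.1 + (1, -1, 1) ∧ r.2.2 = r'.2.2 + 1) := by
  decide +kernel

theorem rows_small_box : ∀ s₁ ∈ pieceTable, ∀ s₂ ∈ pieceTable, s₁.2.1.1 = -1 → s₂.2.1.2.2 = 1 →
    s₂.2.1 = s₁.2.1 + (1, -1, 1) → s₁.1 = s₂.1 ∧ s₁.2.2 = s₂.2.2 + 1 := by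
  decide +kernel

/-- In this and the following checks the rows `r₁`, `r₂` are chosen jointly: an ambiguous piece may
need the row missing from `pieceTable` for the old pieces to differ as a box equation of `w`
demands. The last equation is the balance of powers of `C`. -/
theorem rows_box_above_left : ∀ s₁ ∈ pieceTable, ∀ s₂ ∈ pieceTable, s₂.2.1.1 = 1 →
    s₂.2.1 = s₁.2.1 + (1, 0, 0) → ∃ r₁ ∈ symmetricTable, ∃ r₂ ∈ symmetricTable,
      r₁.2.1 = s₁.2.1 ∧ r₂.2.1 = s₂.2.1 ∧ r₂.1 = r₁.1 + (-1, 1, 0) ∧ r₂.1.2.1 = 1 ∧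
      r₂.2.2 = r₁.2.2 - 1 := by
  decide +kernel

theorem rows_box_above_middle : ∀ s₁ ∈ pieceTable, ∀ s₂ ∈ pieceTable, s₂.2.1.2.1 = 1 →
    s₂.2.1 = s₁.2.1 + (-1, 1, 0) → ∃ r₁ ∈ symmetricTable, ∃ r₂ ∈ symmetricTable,
      r₁.2.1 = s₁.2.1 ∧ r₂.2.1 = s₂.2.1 ∧ r₂.1 = r₁.1 + (1, 0, 0) ∧ r₂.1.1 = 1 ∧
      r₂.2.2 = r₁.2.2 + 1 := by
  decide +kernel

theorem rows_box_below_right : ∀ s₁ ∈ pieceTable, ∀ s₂ ∈ pieceTable, s₁.2.1.2.2 = -1 →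
    s₂.2.1 = s₁.2.1 + (0, 0, 1) → ∃ r₁ ∈ symmetricTable, ∃ r₂ ∈ symmetricTable,
      r₁.2.1 = s₁.2.1 ∧ r₂.2.1 = s₂.2.1 ∧ r₂.1 = r₁.1 + (0, 1, -1) ∧ r₁.1.2.1 = -1 ∧
      r₂.2.2 = r₁.2.2 - 1 := by
  decide +kernel

theorem rows_box_below_middle : ∀ s₁ ∈ pieceTable, ∀ s₂ ∈ pieceTable, s₁.2.1.2.1 = -1 →
    s₂.2.1 = s₁.2.1 + (0, 1, -1) → ∃ r₁ ∈ symmetricTable, ∃ r₂ ∈ symmetricTable,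
      r₁.2.1 = s₁.2.1 ∧ r₂.2.1 = s₂.2.1 ∧ r₂.1 = r₁.1 + (0, 0, 1) ∧ r₁.1.2.2 = -1 ∧
      r₂.2.2 = r₁.2.2 + 1 := by
  decide +kernel

theorem rows_box_beside_middle : ∀ s₁ ∈ pieceTable, ∀ s₂ ∈ pieceTable,
    s₂.2.1 = s₁.2.1 + (0, -1, 0) → ∃ r₁ ∈ symmetricTable, ∃ r₂ ∈ symmetricTable,
      r₁.2.1 = s₁.2.1 ∧ r₂.2.1 = s₂.2.1 ∧ r₂.1 = r₁.1 + (-1, 0, -1) ∧ r₂.2.2 = r₁.2.2 - 1 := by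
  decide +kernel

theorem rows_box_beside_outer : ∀ s₁ ∈ pieceTable, ∀ s₂ ∈ pieceTable,
    s₂.2.1 = s₁.2.1 + (-1, 0, -1) → ¬ (s₁.2.1 = (0, 0, 1) ∧ s₂.2.1 = (-1, 0, 0)) →
    ∃ r₁ ∈ symmetricTable, ∃ r₂ ∈ symmetricTable,
      r₁.2.1 = s₁.2.1 ∧ r₂.2.1 = s₂.2.1 ∧ r₂.1 = r₁.1 + (0, -1, 0) ∧ r₂.2.2 = r₁.2.2 + 1 := by
  decide +kernel

theorem rows_box_apart : ∀ s₁ ∈ pieceTable, ∀ s₂ ∈ pieceTable,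
    s₂.2.1 = s₁.2.1 → ∃ r₁ ∈ symmetricTable, ∃ r₂ ∈ symmetricTable,
      r₁.2.1 = s₁.2.1 ∧ r₂.2.1 = s₂.2.1 ∧ r₂.1 = r₁.1 ∧ r₂.2.2 = r₁.2.2 := by
  decide +kernel

namespace ThreeMove

variable {i j k : Fin N}

theorem lt_ij (h : ThreeMove w w' i j k) : i < j := by rw [Fin.lt_def, h.hj]; omega
theorem lt_jk (h : ThreeMove w w' i j k) : j < k := by rw [Fin.lt_def, h.hj, h.hk]; omega
theorem lt_ik (h : ThreeMove w w' i j k) : i < k := h.lt_ij.trans h.lt_jk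

theorem ne_columns (h : ThreeMove w w' i j k) : w i ≠ w j := fun e => by
  have := h.adjacent
  rw [e] at this
  omega

theorem patch_i (r : ℤ × ℤ × ℤ) (m : Fin N → ℤ) :
    patch i j k r m i = r.1 := by
  simp [patch]

theorem patch_j (h : ThreeMove w w' i j k) (r : ℤ × ℤ × ℤ) (m : Fin N → ℤ) :
    patch i j k r m j = r.2.1 := by
  simp [patch, h.lt_ij.ne']

theorem patch_k (h : ThreeMove w w' i j k) (r : ℤ × ℤ × ℤ) (m : Fin N → ℤ) :
    patch i j k r m k = r.2.2 := by
  simp [patch, h.lt_ik.ne', h.lt_jk.ne']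

theorem patch_of_ne {q : Fin N} (hi : q ≠ i) (hj : q ≠ j) (hk : q ≠ k) (r : ℤ × ℤ × ℤ)
    (m : Fin N → ℤ) : patch i j k r m q = m q := by
  simp [patch, hi, hj, hk]

theorem isBox (h : ThreeMove w w' i j k) : IsBox w i k := by
  refine ⟨h.lt_ik, h.same.symm, fun r h1 h2 => ?_⟩
  have : r = j := by
    have := h.hj
    have := h.hk
    rw [Fin.lt_def] at h1 h2
    rw [Fin.ext_iff]
    omega
  rw [this]
  exact h.ne_columns.symm

theorem lt_cases (h : ThreeMove w w' i j k) {q : Fin N} (hi : q ≠ i) (hj : q ≠ j) (hk : q ≠ k) :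
    (q < i ∧ q < j ∧ q < k) ∨ (i < q ∧ j < q ∧ k < q) := by
  have := h.hj
  have := h.hk
  simp only [Fin.lt_def, ne_eq, Fin.ext_iff] at *
  omega

theorem lambda_values (h : ThreeMove w w' i j k) :
    (lambdaExponent w i i = 1 ∧ lambdaExponent w i j = -1 ∧ lambdaExponent w i k = 2) ∧
    (lambdaExponent w j i = 0 ∧ lambdaExponent w j j = 1 ∧ lambdaExponent w j k = -1) ∧
    (lambdaExponent w k i = 0 ∧ lambdaExponent w k j = 0 ∧ lambdaExponent w k k = 1) :=
  ⟨⟨lambda_self _ _, lambda_of_adjacent h.lt_ij h.adjacent.symm, lambda_of_eq h.lt_ik h.same⟩,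
    ⟨lambda_of_lt h.lt_ij, lambda_self _ _,
      lambda_of_adjacent h.lt_jk (by rw [h.same]; exact h.adjacent)⟩,
    lambda_of_lt h.lt_ik, lambda_of_lt h.lt_jk, lambda_self _ _⟩

/-- The `λ`-exponents outside the move. -/
theorem lambda_outside (h : ThreeMove w w' i j k) {q : Fin N} (hi : q ≠ i) (hj : q ≠ j)
    (hk : q ≠ k) :
    (∀ l, l ≠ i → l ≠ j → l ≠ k → lambdaExponent w' l q = lambdaExponent w l q) ∧
    lambdaExponent w' i q = lambdaExponent w j q ∧ lambdaExponent w' j q = lambdaExponent w i q ∧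
    lambdaExponent w' k q = lambdaExponent w j q ∧
    lambdaExponent w k q = lambdaExponent w i q := by
  have hq := h.other q hi hj hk
  have hc := h.lt_cases hi hj hk
  have e : ∀ {a b : Fin N}, q ≠ a → q ≠ b → (q = a ↔ q = b) := fun h1 h2 => iff_of_false h1 h2
  have o : ∀ {a b : Fin N}, (q < a ∧ q < b ∨ a < q ∧ b < q) → (q < a ↔ q < b) := by
    intro a b h
    rcases h with h | h
    · exact iff_of_true h.1 h.2
    · exact iff_of_false h.1.not_gt h.2.not_gt
  refine ⟨fun l h1 h2 h3 => lambda_congr Iff.rfl Iff.rfl (h.other l h1 h2 h3) hq,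
    lambda_congr (e hi hj) (o (by tauto)) h.left hq,
    lambda_congr (e hj hi) (o (by tauto)) h.middle hq,
    lambda_congr (e hk hj) (o (by tauto)) h.right hq,
    lambda_congr (e hk hi) (o (by tauto)) h.same rfl⟩

/-- The piece of a `λ`-exponent not involved in the move. -/
theorem lambda_piece (h : ThreeMove w w' i j k) {l : Fin N} (hi : l ≠ i) (hj : l ≠ j)
    (hk : l ≠ k) :
    lambdaExponent w' l i = lambdaExponent w l j ∧ lambdaExponent w' l j = lambdaExponent w l i ∧
    lambdaExponent w' l k = lambdaExponent w l j ∧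
    lambdaExponent w l k = lambdaExponent w l i := by
  have hl := h.other l hi hj hk
  have hc := h.lt_cases hi hj hk
  have e : ∀ {a b : Fin N}, l ≠ a → l ≠ b → (a = l ↔ b = l) :=
    fun h1 h2 => iff_of_false h1.symm h2.symm
  have o : ∀ {a b : Fin N}, (l < a ∧ l < b ∨ a < l ∧ b < l) → (a < l ↔ b < l) := by
    intro a b h
    rcases h with h | h
    · exact iff_of_false h.1.not_gt h.2.not_gt
    · exact iff_of_true h.1 h.2
  exact ⟨lambda_congr (e hi hj) (o (by tauto)) hl h.left,
    lambda_congr (e hj hi) (o (by tauto)) hl h.middle,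
    lambda_congr (e hk hj) (o (by tauto)) hl h.right,
    lambda_congr (e hk hi) (o (by tauto)) rfl h.same⟩

section Correspondence

theorem exists_corresponds_of_row (h : ThreeMove w w' i j k) (hw : IsReducedWord w)
    (hw' : IsReducedWord w') (d' : stringExponents w') {r : (ℤ × ℤ × ℤ) × (ℤ × ℤ × ℤ) × ℤ}
    (hr : r ∈ symmetricTable) (hr₂ : r.2.1 = (d'.1 i, d'.1 j, d'.1 k)) :
    ∃ d : stringExponents w, d.1 = patch i j k r.1 d'.1 ∧
      Corresponds symmetricTable i j k d' d r.2.2 := by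
  have hm : patch i j k r.1 d'.1 ∈ stringExponents w :=
    h.mem_stringExponents hw hw' d'.2 hr (by rw [patch_i, h.patch_j, h.patch_k]) hr₂
      fun q h1 h2 h3 => (patch_of_ne h1 h2 h3 _ _).symm
  refine ⟨⟨_, hm⟩, rfl, fun q h1 h2 h3 => (patch_of_ne h1 h2 h3 _ _).symm, ?_⟩
  simp only [patch_i, h.patch_j, h.patch_k, Prod.mk.eta, ← hr₂]
  exact hr

theorem exists_corresponds (h : ThreeMove w w' i j k) (hw : IsReducedWord w)
    (hw' : IsReducedWord w') (d' : stringExponents w') :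
    ∃ (d : stringExponents w) (e : ℤ), Corresponds pieceTable i j k d' d e := by
  obtain ⟨r, hr, hr₂⟩ := h.exists_row hw hw' d'.2
  obtain ⟨d, hd, h1, -⟩ := h.exists_corresponds_of_row hw hw' d' (mem_symmetricTable hr) hr₂
  refine ⟨d, r.2.2, h1, ?_⟩
  simp only [hd, patch_i, h.patch_j, h.patch_k, Prod.mk.eta, ← hr₂]
  exact hr

theorem corresponds_unique {d' : stringExponents w'} {d₁ d₂ : stringExponents w} {e₁ e₂ : ℤ}
    (h₁ : Corresponds pieceTable i j k d' d₁ e₁) (h₂ : Corresponds pieceTable i j k d' d₂ e₂) :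
    d₁ = d₂ ∧ e₁ = e₂ := by
  have := pieceTable_unique _ h₁.2 _ h₂.2 rfl
  simp only [Prod.mk.injEq, true_and] at this
  obtain ⟨⟨ei, ej, ek⟩, ee⟩ := this
  refine ⟨Subtype.ext (funext fun q => ?_), ee⟩
  by_cases hi : q = i
  · rw [hi, ei]
  by_cases hj : q = j
  · rw [hj, ej]
  by_cases hk : q = k
  · rw [hk, ek]
  · rw [← h₁.1 q hi hj hk, h₂.1 q hi hj hk]

theorem corresponds_symm {d' : stringExponents w'} {d : stringExponents w} {e : ℤ}
    (h : Corresponds pieceTable i j k d' d e) : Corresponds symmetricTable i j k d d' (-e) :=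
  ⟨fun q h1 h2 h3 => (h.1 q h1 h2 h3).symm, symmetricTable_symm _ (mem_symmetricTable h.2)⟩

/-- The class of `a_d C ^ e` does not depend on the entry of the symmetric table. -/
theorem class_unique (h : ThreeMove w w' i j k) {d' : stringExponents w'}
    {d₁ d₂ : stringExponents w} {e₁ e₂ : ℤ}
    (h₁ : Corresponds symmetricTable i j k d' d₁ e₁)
    (h₂ : Corresponds symmetricTable i j k d' d₂ e₂) :
    strClass d₁ + e₁ • (lamClass w k - lamClass w i) =
      strClass d₂ + e₂ • (lamClass w k - lamClass w i) := by
  have main : ∀ {d₁ d₂ : stringExponents w} {e₁ e₂ : ℤ},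
      Corresponds symmetricTable i j k d' d₁ e₁ → Corresponds symmetricTable i j k d' d₂ e₂ →
      d₁.1 i = -1 → d₂.1 k = 1 →
      (d₂.1 i, d₂.1 j, d₂.1 k) = (d₁.1 i, d₁.1 j, d₁.1 k) + (1, -1, 1) → e₂ = e₁ + 1 →
      strClass d₁ + e₁ • (lamClass w k - lamClass w i) =
        strClass d₂ + e₂ • (lamClass w k - lamClass w i) := by
    intro d₁ d₂ e₁ e₂ h₁ h₂ hi hk hd he
    -- The difference `(1, -1, 1)` is the piece of `λ_i - λ_k`, which vanishes outside the move, so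
    -- the two candidates form a box equation of the small box.
    have hbox : BoxCondition w i k d₁ d₂ := by
      refine ⟨h.isBox, funext fun q => ?_, hi, hk⟩
      obtain ⟨⟨a1, a2, a3⟩, -, b1, b2, b3⟩ := h.lambda_values
      simp only [Prod.mk_add_mk, Prod.mk.injEq] at hd
      obtain ⟨c1, c2, c3⟩ := hd
      simp only [Pi.add_apply]
      by_cases hqi : q = i
      · rw [hqi, a1, b1, c1]; ring
      by_cases hqj : q = j
      · rw [hqj, a2, b2, c2]; ring
      by_cases hqk : q = k
      · rw [hqk, a3, b3, c3]; ring
      · rw [← h₁.1 q hqi hqj hqk, h₂.1 q hqi hqj hqk, (h.lambda_outside hqi hqj hqk).2.2.2.2]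
    have := boxClass hbox
    rw [he, eq_sub_of_add_eq this]
    module
  rcases symmetricTable_unique _ h₁.2 _ h₂.2 rfl with he | ⟨c1, c2, c3, c4⟩ | ⟨c1, c2, c3, c4⟩
  · simp only [Prod.mk.injEq, true_and] at he
    obtain ⟨⟨ei, ej, ek⟩, ee⟩ := he
    have : d₁ = d₂ := by
      refine Subtype.ext (funext fun q => ?_)
      by_cases hi : q = i
      · rw [hi, ei]
      by_cases hj : q = j
      · rw [hj, ej]
      by_cases hk : q = k
      · rw [hk, ek]
      · rw [← h₁.1 q hi hj hk, h₂.1 q hi hj hk]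
    rw [this, ee]
  · exact main h₁ h₂ c1 c2 c3 c4
  · exact (main h₂ h₁ c1 c2 c3 c4).symm

end Correspondence

/-- The monomials of a 3-move, for given choices of the string exponents of `w`. -/
def monomials (i j k : Fin N) (D : stringExponents w' → stringExponents w)
    (E : stringExponents w' → ℤ) : Ineq w' → (Ineq w →₀ ℤ)
  | Sum.inl l =>
    if l = i then Finsupp.single (Sum.inl j) 1 + (-2 : ℤ) • ratio w i k
    else if l = j then Finsupp.single (Sum.inl k) 1 + (1 : ℤ) • ratio w i k
    else if l = k then Finsupp.single (Sum.inl j) 1 + (-1 : ℤ) • ratio w i k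
    else Finsupp.single (Sum.inl l) 1 +
      (lambdaExponent w l i - lambdaExponent w l j) • ratio w i k
  | Sum.inr d => Finsupp.single (Sum.inr (D d)) 1 + E d • ratio w i k

variable {D : stringExponents w' → stringExponents w} {E : stringExponents w' → ℤ}

theorem coeffRule_iff (h : ThreeMove w w' i j k)
    (hDE : ∀ d, Corresponds pieceTable i j k d (D d) (E d)) (d : Ineq w') (u : Ineq w →₀ ℤ) :
    CoeffRule₃ w w' i j k d u ↔ u = monomials i j k D E d := by
  have hij := h.lt_ij.ne
  have hik := h.lt_ik.ne
  have hjk := h.lt_jk.ne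
  constructor
  · rintro (_ | _ | _ | ⟨l, hi, hj, hk⟩ | ⟨d', d, e, h1, h2⟩)
    · simp [monomials]
    · simp [monomials, hik.symm, hjk.symm]
    · simp [monomials, hij.symm]
    · simp [monomials, hi, hj, hk]
    · obtain ⟨rfl, rfl⟩ := corresponds_unique ⟨h1, h2⟩ (hDE d')
      rfl
  · rintro rfl
    rcases d with l | d
    · unfold monomials
      simp only
      split_ifs with h1 h2 h3
      · subst h1; exact .lam_i
      · subst h2; exact .lam_j
      · subst h3; exact .lam_k
      · exact .lam_other l h1 h2 h3
    · exact .str d _ _ (hDE d).1 (hDE d).2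

theorem monomials_str (hDE : ∀ d, Corresponds pieceTable i j k d (D d) (E d))
    (h : ThreeMove w w' i j k) {d' : stringExponents w'} {d : stringExponents w} {e : ℤ}
    (hd : Corresponds symmetricTable i j k d' d e) :
    boxQuot w (monomials i j k D E (Sum.inr d')) =
      strClass d + e • (lamClass w k - lamClass w i) := by
  rw [monomials, map_add, map_zsmul, boxQuot_ratio]
  exact h.class_unique ⟨(hDE d').1, mem_symmetricTable (hDE d').2⟩ hd

theorem monomials_i (D : stringExponents w' → stringExponents w) (E : stringExponents w' → ℤ) :
    boxQuot w (monomials i j k D E (Sum.inl i)) =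
      lamClass w j + (-2 : ℤ) • (lamClass w k - lamClass w i) := by
  simp only [monomials, if_true, map_add, map_zsmul, boxQuot_ratio]
  rfl

theorem monomials_j (h : ThreeMove w w' i j k) (D : stringExponents w' → stringExponents w)
    (E : stringExponents w' → ℤ) :
    boxQuot w (monomials i j k D E (Sum.inl j)) =
      lamClass w k + (1 : ℤ) • (lamClass w k - lamClass w i) := by
  simp only [monomials, if_neg h.lt_ij.ne', if_true, map_add, map_zsmul, boxQuot_ratio]
  rfl

theorem monomials_k (h : ThreeMove w w' i j k) (D : stringExponents w' → stringExponents w)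
    (E : stringExponents w' → ℤ) :
    boxQuot w (monomials i j k D E (Sum.inl k)) =
      lamClass w j + (-1 : ℤ) • (lamClass w k - lamClass w i) := by
  simp only [monomials, if_neg h.lt_ik.ne', if_neg h.lt_jk.ne', if_true, map_add, map_zsmul,
    boxQuot_ratio]
  rfl

theorem monomials_other {l : Fin N} (hi : l ≠ i) (hj : l ≠ j) (hk : l ≠ k)
    (D : stringExponents w' → stringExponents w) (E : stringExponents w' → ℤ) :
    boxQuot w (monomials i j k D E (Sum.inl l)) = lamClass w l +
      (lambdaExponent w l i - lambdaExponent w l j) • (lamClass w k - lamClass w i) := by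
  simp only [monomials, if_neg hi, if_neg hj, if_neg hk, map_add, map_zsmul, boxQuot_ratio]
  rfl

/-- The substitutions of a 3-move and of its inverse cancel modulo the box equations. -/
theorem substitution_monomials (h : ThreeMove w w' i j k)
    (hDE : ∀ d, Corresponds pieceTable i j k d (D d) (E d))
    {D' : stringExponents w → stringExponents w'} {E' : stringExponents w → ℤ}
    (hDE' : ∀ d, Corresponds pieceTable i j k d (D' d) (E' d)) (d : Ineq w') :
    substitution (monomials i j k D' E') (monomials i j k D E d) - Finsupp.single d 1 ∈
      boxGroup w' := by
  set V := monomials i j k D' E' with hV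
  -- The ratio `C` of `w` goes to the ratio of `w'`, since the images of `λ_k` and `λ_i` carry the
  -- powers `-1` and `-2` of it. The powers of `C` in the two substitutions can therefore be added.
  have hratio : boxQuot w' (substitution V (ratio w i k)) = lamClass w' k - lamClass w' i := by
    rw [ratio, map_sub, substitution_single, substitution_single, one_smul, one_smul, map_sub,
      h.symm.monomials_k, monomials_i]
    module
  rw [← boxQuot_eq_zero, map_sub, sub_eq_zero]
  rcases d with l | d
  · unfold monomials
    simp only
    change _ = lamClass w' l
    split_ifs with h1 h2 h3
    · rw [map_add, map_add, map_zsmul, map_zsmul, hratio, substitution_single, one_smul,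
        h.symm.monomials_j, h1]
      module
    · rw [map_add, map_add, map_zsmul, map_zsmul, hratio, substitution_single, one_smul,
        h.symm.monomials_k, h2]
      module
    · rw [map_add, map_add, map_zsmul, map_zsmul, hratio, substitution_single, one_smul,
        h.symm.monomials_j, h3]
      module
    · rw [map_add, map_add, map_zsmul, map_zsmul, hratio, substitution_single, one_smul,
        monomials_other h1 h2 h3]
      obtain ⟨e1, e2, -, -⟩ := h.lambda_piece h1 h2 h3
      rw [e1, e2]
      module
  · change boxQuot w' (substitution V (_ + _)) = strClass d
    rw [map_add, map_add, map_zsmul, map_zsmul, hratio, substitution_single, one_smul,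
      monomials_str hDE' h.symm (corresponds_symm (hDE d))]
    module

/-- A box equation of `w` read off from two entries of the table. -/
theorem monomials_box (h : ThreeMove w w' i j k) (hw : IsReducedWord w) (hw' : IsReducedWord w')
    (hDE : ∀ d, Corresponds pieceTable i j k d (D d) (E d)) {p₁ p₂ : stringExponents w'}
    {r₁ r₂ : (ℤ × ℤ × ℤ) × (ℤ × ℤ × ℤ) × ℤ} (hr₁ : r₁ ∈ symmetricTable) (hr₂ : r₂ ∈ symmetricTable)
    (h₁ : r₁.2.1 = (p₁.1 i, p₁.1 j, p₁.1 k)) (h₂ : r₂.2.1 = (p₂.1 i, p₂.1 j, p₂.1 k))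
    {t b : Fin N} (hbox : IsBox w t b)
    (hout : ∀ q, q ≠ i → q ≠ j → q ≠ k →
      p₁.1 q + lambdaExponent w t q = p₂.1 q + lambdaExponent w b q)
    (hpiece : r₂.1 = r₁.1 + (lambdaExponent w t i - lambdaExponent w b i,
      lambdaExponent w t j - lambdaExponent w b j, lambdaExponent w t k - lambdaExponent w b k))
    (ht : patch i j k r₁.1 p₁.1 t = -1) (hb : patch i j k r₂.1 p₂.1 b = 1) :
    boxQuot w (monomials i j k D E (Sum.inr p₁)) - r₁.2.2 • (lamClass w k - lamClass w i) +
      lamClass w t =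
    boxQuot w (monomials i j k D E (Sum.inr p₂)) - r₂.2.2 • (lamClass w k - lamClass w i) +
      lamClass w b := by
  obtain ⟨d₁, e₁, c₁⟩ := h.exists_corresponds_of_row hw hw' p₁ hr₁ h₁
  obtain ⟨d₂, e₂, c₂⟩ := h.exists_corresponds_of_row hw hw' p₂ hr₂ h₂
  rw [monomials_str hDE h c₁, monomials_str hDE h c₂, add_sub_cancel_right, add_sub_cancel_right]
  apply boxClass
  refine ⟨hbox, funext fun q => ?_, by rw [e₁, ht], by rw [e₂, hb]⟩
  rw [Pi.add_apply, Pi.add_apply, e₁, e₂]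
  by_cases hi : q = i
  · subst hi
    rw [patch_i, patch_i, hpiece]
    simp only [Prod.fst_add]
    ring
  by_cases hj : q = j
  · subst hj
    rw [h.patch_j, h.patch_j, hpiece]
    simp only [Prod.fst_add, Prod.snd_add]
    ring
  by_cases hk : q = k
  · subst hk
    rw [h.patch_k, h.patch_k, hpiece]
    simp only [Prod.snd_add]
    ring
  · rw [patch_of_ne hi hj hk, patch_of_ne hi hj hk]
    exact hout q hi hj hk

end ThreeMove

end

/-! ### Box equations under a 3-move -/

section

variable {n N : ℕ} {w w' : Fin N → Fin n}

namespace ThreeMove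

variable {i j k : Fin N}

theorem lambda_of_left (h : ThreeMove w w' i j k) {l : Fin N} (hl : l < i) (hc : w l = w i) :
    lambdaExponent w l i = 2 ∧ lambdaExponent w l j = -1 ∧ lambdaExponent w l k = 2 :=
  ⟨lambda_of_eq hl hc.symm,
    lambda_of_adjacent (hl.trans h.lt_ij) (by rw [hc]; exact h.adjacent.symm),
    lambda_of_eq (hl.trans h.lt_ik) (h.same.trans hc.symm)⟩

theorem lambda_of_middle (h : ThreeMove w w' i j k) {l : Fin N} (hl : l < i) (hc : w l = w j) :
    lambdaExponent w l i = -1 ∧ lambdaExponent w l j = 2 ∧ lambdaExponent w l k = -1 :=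
  ⟨lambda_of_adjacent hl (by rw [hc]; exact h.adjacent), lambda_of_eq (hl.trans h.lt_ij) hc.symm,
    lambda_of_adjacent (hl.trans h.lt_ik) (by rw [hc, h.same]; exact h.adjacent)⟩

theorem lambda_of_after (h : ThreeMove w w' i j k) {l : Fin N} (hl : k < l) :
    lambdaExponent w l i = 0 ∧ lambdaExponent w l j = 0 ∧ lambdaExponent w l k = 0 :=
  ⟨lambda_of_lt (h.lt_ik.trans hl), lambda_of_lt (h.lt_jk.trans hl), lambda_of_lt hl⟩

theorem eq_of_mem_Icc (h : ThreeMove w w' i j k) {q : Fin N} (h₁ : i ≤ q) (h₂ : q ≤ k) :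
    q = i ∨ q = j ∨ q = k := by
  have := h.hj
  have := h.hk
  rw [Fin.le_def] at h₁ h₂
  simp only [Fin.ext_iff]
  omega

/-- A box that ends at the move. -/
theorem isBox_above (h : ThreeMove w w' i j k) {t b b' : Fin N} (hbox : IsBox w' t b) (ht : t < i)
    (hb : b = i ∨ b = j ∨ b = k) (hb' : b' = i ∨ b' = j) (hc : w b' = w' b)
    (hji : b' = j → w i ≠ w j) : IsBox w t b' := by
  have hij := h.lt_ij
  obtain ⟨h1, h2, h3⟩ := hbox
  have htj : t < j := ht.trans h.lt_ij
  have htk : t < k := ht.trans h.lt_ik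
  have hti := h.other t ht.ne htj.ne htk.ne
  refine ⟨by rcases hb' with rfl | rfl <;> assumption, by rw [← hti, h2, hc], fun r hr1 hr2 => ?_⟩
  rcases lt_or_ge r i with hri | hri
  · rw [← hti, ← h.other r hri.ne (hri.trans h.lt_ij).ne (hri.trans h.lt_ik).ne]
    refine h3 r hr1 (hri.trans_le ?_)
    rcases hb with rfl | rfl | rfl
    · exact le_rfl
    · exact h.lt_ij.le
    · exact h.lt_ik.le
  · rcases hb' with rfl | rfl
    · exact absurd hr2 hri.not_gt
    · have : r = i := by
        rcases h.eq_of_mem_Icc hri (hr2.trans h.lt_jk).le with rfl | rfl | rfl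
        · rfl
        · exact absurd hr2 (lt_irrefl _)
        · exact absurd hr2 h.lt_jk.not_gt
      subst this
      rw [← hti, h2, ← hc]
      exact hji rfl

/-- A box that starts at the move. -/
theorem isBox_below (h : ThreeMove w w' i j k) {t b t' : Fin N} (hbox : IsBox w' t b) (hb : k < b)
    (ht : t = i ∨ t = j ∨ t = k) (ht' : t' = j ∨ t' = k) (hc : w t' = w' t) : IsBox w t' b := by
  obtain ⟨h1, h2, h3⟩ := hbox
  have hjb : j < b := h.lt_jk.trans hb
  have hib : i < b := h.lt_ik.trans hb
  have hbi := h.other b hib.ne' hjb.ne' hb.ne'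
  refine ⟨by rcases ht' with rfl | rfl <;> assumption, by rw [← hbi, ← h2, hc], fun r hr1 hr2 => ?_⟩
  rcases lt_or_ge k r with hri | hri
  · rw [hc, ← h.other r (h.lt_ik.trans hri).ne' (h.lt_jk.trans hri).ne' hri.ne']
    refine h3 r (lt_of_le_of_lt ?_ hri) hr2
    rcases ht with rfl | rfl | rfl
    · exact h.lt_ik.le
    · exact h.lt_jk.le
    · exact le_rfl
  · rcases ht' with rfl | rfl
    · have : r = k := by
        rcases h.eq_of_mem_Icc (h.lt_ij.trans hr1).le hri with rfl | rfl | rfl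
        · exact absurd hr1 h.lt_ij.not_gt
        · exact absurd hr1 (lt_irrefl _)
        · rfl
      rw [this, h.same]
      exact h.ne_columns
    · exact absurd hr1 hri.not_gt

/-- A box that does not meet the move. -/
theorem isBox_apart (h : ThreeMove w w' i j k) {t b : Fin N} (hbox : IsBox w' t b)
    (hti : t ≠ i) (htj : t ≠ j) (htk : t ≠ k) (hbi : b ≠ i) (hbj : b ≠ j) (hbk : b ≠ k) :
    IsBox w t b := by
  obtain ⟨h1, h2, h3⟩ := hbox
  have ht := h.other t hti htj htk
  have key : t < i → k < b → w t ≠ w i ∧ w t ≠ w j := by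
    intro c1 c2
    have hi := h3 i c1 (h.lt_ik.trans c2)
    have hj := h3 j (c1.trans h.lt_ij) (h.lt_jk.trans c2)
    rw [h.left, ht] at hi
    rw [h.middle, ht] at hj
    exact ⟨hj.symm, hi.symm⟩
  refine ⟨h1, by rw [← ht, h2, h.other b hbi hbj hbk], fun r hr1 hr2 => ?_⟩
  by_cases hr : r = i ∨ r = j ∨ r = k
  · have c1 : t < i := by
      rcases h.lt_cases hti htj htk with c | c
      · exact c.1
      · rcases hr with rfl | rfl | rfl
        · exact absurd hr1 c.1.not_gt
        · exact absurd hr1 c.2.1.not_gt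
        · exact absurd hr1 c.2.2.not_gt
    have c2 : k < b := by
      rcases h.lt_cases hbi hbj hbk with c | c
      · rcases hr with rfl | rfl | rfl
        · exact absurd hr2 c.1.not_gt
        · exact absurd hr2 c.2.1.not_gt
        · exact absurd hr2 c.2.2.not_gt
      · exact c.2.2
    obtain ⟨k1, k2⟩ := key c1 c2
    rcases hr with rfl | rfl | rfl
    · exact k1.symm
    · exact k2.symm
    · rw [h.same]; exact k1.symm
  · push Not at hr
    rw [← ht, ← h.other r hr.1 hr.2.1 hr.2.2]
    exact h3 r hr1 hr2

variable {D : stringExponents w' → stringExponents w} {E : stringExponents w' → ℤ}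

/-- The equation between the images of the two sides of a box equation. -/
def BoxImage (i j k : Fin N) (D : stringExponents w' → stringExponents w)
    (E : stringExponents w' → ℤ) (top bot : Fin N) (p₁ p₂ : stringExponents w') : Prop :=
  boxQuot w (monomials i j k D E (Sum.inr p₁)) + boxQuot w (monomials i j k D E (Sum.inl top)) =
    boxQuot w (monomials i j k D E (Sum.inr p₂)) + boxQuot w (monomials i j k D E (Sum.inl bot))

variable {top bot : Fin N} {p₁ p₂ : stringExponents w'}

theorem piece_eq (heq : p₁.1 + lambdaExponent w' top = p₂.1 + lambdaExponent w' bot) :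
    (p₂.1 i, p₂.1 j, p₂.1 k) = (p₁.1 i, p₁.1 j, p₁.1 k) +
      (lambdaExponent w' top i - lambdaExponent w' bot i,
        lambdaExponent w' top j - lambdaExponent w' bot j,
        lambdaExponent w' top k - lambdaExponent w' bot k) := by
  have := congrFun heq
  simp only [Pi.add_apply] at this
  simp only [Prod.mk_add_mk, Prod.mk.injEq]
  exact ⟨by linarith [this i], by linarith [this j], by linarith [this k]⟩

/-- Both string inequalities correspond to the same one of `w`. Their exponents of `C` differ by
one, which the powers `-2` and `-1` in the images of `λ_i` and `λ_k` compensate, so the image is an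
identity. -/
theorem boxImage_small (h : ThreeMove w w' i j k) (hw : IsReducedWord w) (hw' : IsReducedWord w')
    (hDE : ∀ d, Corresponds pieceTable i j k d (D d) (E d)) (hbox : BoxCondition w' i k p₁ p₂) :
    BoxImage i j k D E i k p₁ p₂ := by
  obtain ⟨-, heq, ht, hb⟩ := hbox
  obtain ⟨s₁, hs₁, e₁⟩ := h.exists_row hw hw' p₁.2
  obtain ⟨s₂, hs₂, e₂⟩ := h.exists_row hw hw' p₂.2
  have hp := piece_eq (i := i) (j := j) (k := k) heq
  obtain ⟨⟨a1, a2, a3⟩, -, b1, b2, b3⟩ := h.symm.lambda_values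
  rw [a1, a2, a3, b1, b2, b3, ← e₁, ← e₂] at hp
  obtain ⟨f1, f2⟩ := rows_small_box s₁ hs₁ s₂ hs₂ (by rw [e₁, ht]) (by rw [e₂, hb])
    (by rw [hp]; rfl)
  obtain ⟨d₁, g₁, c₁⟩ := h.exists_corresponds_of_row hw hw' p₁ (mem_symmetricTable hs₁) e₁
  obtain ⟨d₂, g₂, c₂⟩ := h.exists_corresponds_of_row hw hw' p₂ (mem_symmetricTable hs₂) e₂
  have hd : d₁ = d₂ := by
    refine Subtype.ext (funext fun q => ?_)
    rw [g₁, g₂]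
    by_cases hi : q = i
    · rw [hi, patch_i, patch_i, f1]
    by_cases hj : q = j
    · rw [hj, h.patch_j, h.patch_j, f1]
    by_cases hk : q = k
    · rw [hk, h.patch_k, h.patch_k, f1]
    rw [patch_of_ne hi hj hk, patch_of_ne hi hj hk]
    have := congrFun heq q
    rw [Pi.add_apply, Pi.add_apply, (h.symm.lambda_outside hi hj hk).2.2.2.2] at this
    exact add_right_cancel this
  rw [BoxImage, monomials_str hDE h c₁, monomials_str hDE h c₂, monomials_i, h.monomials_k, hd, f2]
  module

/-- The column of `t_i` in `w'` is that of `t_j` in `w`, so the image is an equation for the box of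
`w` from `t_top` to `t_j`. The power `-3` of `C` carried by `λ_top` balances the rest. -/
theorem boxImage_above_left (h : ThreeMove w w' i j k) (hw : IsReducedWord w)
    (hw' : IsReducedWord w') (hDE : ∀ d, Corresponds pieceTable i j k d (D d) (E d))
    (hbox : BoxCondition w' top i p₁ p₂) : BoxImage i j k D E top i p₁ p₂ := by
  obtain ⟨hB, heq, ht, hb⟩ := hbox
  have hti := hB.1
  have htj := hti.trans h.lt_ij
  have htk := hti.trans h.lt_ik
  obtain ⟨s₁, hs₁, e₁⟩ := h.exists_row hw hw' p₁.2
  obtain ⟨s₂, hs₂, e₂⟩ := h.exists_row hw hw' p₂.2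
  have hp := piece_eq (i := i) (j := j) (k := k) heq
  have hc' : w' top = w' i := hB.2.1
  have hc : w top = w j := by rw [← h.other top hti.ne htj.ne htk.ne, hc', h.left]
  obtain ⟨x1, x2, x3⟩ := h.symm.lambda_of_left hti hc'
  obtain ⟨y1, y2, y3⟩ := h.lambda_of_middle hti hc
  obtain ⟨⟨a1, a2, a3⟩, -⟩ := h.symm.lambda_values
  obtain ⟨-, ⟨b1, b2, b3⟩, -⟩ := h.lambda_values
  rw [a1, a2, a3, x1, x2, x3, ← e₁, ← e₂] at hp
  obtain ⟨r₁, hr₁, r₂, hr₂, g₁, g₂, g3, g4, g5⟩ := rows_box_above_left s₁ hs₁ s₂ hs₂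
    (by rw [e₂, hb]) (by rw [hp]; rfl)
  have := monomials_box h hw hw' hDE hr₁ hr₂ (g₁.trans e₁) (g₂.trans e₂) (t := top) (b := j)
    (h.isBox_above hB hti (Or.inl rfl) (Or.inr rfl) h.left.symm fun _ => h.ne_columns)
    (fun q hi hj hk => by
      obtain ⟨l1, l2, -⟩ := h.lambda_outside hi hj hk
      rw [← l1 top hti.ne htj.ne htk.ne, ← l2]
      exact congrFun heq q)
    (by rw [g3, y1, y2, y3, b1, b2, b3]; rfl)
    (by rw [patch_of_ne hti.ne htj.ne htk.ne, ht]) (by rw [h.patch_j, g4])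
  rw [BoxImage, monomials_i, monomials_other hti.ne htj.ne htk.ne, y1, y2]
  rw [g5] at this
  rw [← sub_eq_zero] at this ⊢
  rw [← this]
  module

/-- The box of `w` now ends at `t_i`. The image of `λ_j` is used in the form `a_{λ_i} C ^ 2`, which
equals `a_{λ_k} C`. -/
theorem boxImage_above_middle (h : ThreeMove w w' i j k) (hw : IsReducedWord w)
    (hw' : IsReducedWord w') (hDE : ∀ d, Corresponds pieceTable i j k d (D d) (E d))
    (hti : top < i) (hbox : BoxCondition w' top j p₁ p₂) : BoxImage i j k D E top j p₁ p₂ := by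
  obtain ⟨hB, heq, ht, hb⟩ := hbox
  have htj := hti.trans h.lt_ij
  have htk := hti.trans h.lt_ik
  obtain ⟨s₁, hs₁, e₁⟩ := h.exists_row hw hw' p₁.2
  obtain ⟨s₂, hs₂, e₂⟩ := h.exists_row hw hw' p₂.2
  have hp := piece_eq (i := i) (j := j) (k := k) heq
  have hc' : w' top = w' j := hB.2.1
  have hc : w top = w i := by rw [← h.other top hti.ne htj.ne htk.ne, hc', h.middle]
  obtain ⟨x1, x2, x3⟩ := h.symm.lambda_of_middle hti hc'
  obtain ⟨y1, y2, y3⟩ := h.lambda_of_left hti hc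
  obtain ⟨-, ⟨a1, a2, a3⟩, -⟩ := h.symm.lambda_values
  obtain ⟨⟨b1, b2, b3⟩, -⟩ := h.lambda_values
  rw [a1, a2, a3, x1, x2, x3, ← e₁, ← e₂] at hp
  obtain ⟨r₁, hr₁, r₂, hr₂, g₁, g₂, g3, g4, g5⟩ := rows_box_above_middle s₁ hs₁ s₂ hs₂
    (by rw [e₂, hb]) (by rw [hp]; rfl)
  have := monomials_box h hw hw' hDE hr₁ hr₂ (g₁.trans e₁) (g₂.trans e₂) (t := top) (b := i)
    (h.isBox_above hB hti (Or.inr (Or.inl rfl)) (Or.inl rfl) h.middle.symm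
      fun e => absurd e h.lt_ij.ne)
    (fun q hi hj hk => by
      obtain ⟨l1, -, l2, -⟩ := h.lambda_outside hi hj hk
      rw [← l1 top hti.ne htj.ne htk.ne, ← l2]
      exact congrFun heq q)
    (by rw [g3, y1, y2, y3, b1, b2, b3]; rfl)
    (by rw [patch_of_ne hti.ne htj.ne htk.ne, ht]) (by rw [patch_i, g4])
  rw [BoxImage, h.monomials_j, monomials_other hti.ne htj.ne htk.ne, y1, y2]
  rw [g5, ← sub_eq_zero] at this
  rw [← sub_eq_zero, ← this]
  module

/-- The box of `w` starts at `t_j`. The lower end lies below the move, so `λ_bot` has trivial piece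
and is unchanged. -/
theorem boxImage_below_right (h : ThreeMove w w' i j k) (hw : IsReducedWord w)
    (hw' : IsReducedWord w') (hDE : ∀ d, Corresponds pieceTable i j k d (D d) (E d))
    (hbox : BoxCondition w' k bot p₁ p₂) : BoxImage i j k D E k bot p₁ p₂ := by
  obtain ⟨hB, heq, ht, hb⟩ := hbox
  have hkb := hB.1
  have hjb := h.lt_jk.trans hkb
  have hib := h.lt_ik.trans hkb
  obtain ⟨s₁, hs₁, e₁⟩ := h.exists_row hw hw' p₁.2
  obtain ⟨s₂, hs₂, e₂⟩ := h.exists_row hw hw' p₂.2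
  have hp := piece_eq (i := i) (j := j) (k := k) heq
  obtain ⟨x1, x2, x3⟩ := h.symm.lambda_of_after hkb
  obtain ⟨y1, y2, y3⟩ := h.lambda_of_after hkb
  obtain ⟨-, -, a1, a2, a3⟩ := h.symm.lambda_values
  obtain ⟨-, ⟨b1, b2, b3⟩, -⟩ := h.lambda_values
  rw [a1, a2, a3, x1, x2, x3, ← e₁, ← e₂] at hp
  obtain ⟨r₁, hr₁, r₂, hr₂, g₁, g₂, g3, g4, g5⟩ := rows_box_below_right s₁ hs₁ s₂ hs₂
    (by rw [e₁, ht]) (by rw [hp]; rfl)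
  have := monomials_box h hw hw' hDE hr₁ hr₂ (g₁.trans e₁) (g₂.trans e₂) (t := j) (b := bot)
    (h.isBox_below hB hkb (Or.inr (Or.inr rfl)) (Or.inl rfl) h.right.symm)
    (fun q hi hj hk => by
      obtain ⟨l1, -, -, l2, -⟩ := h.lambda_outside hi hj hk
      rw [← l1 bot hib.ne' hjb.ne' hkb.ne', ← l2]
      exact congrFun heq q)
    (by rw [g3, y1, y2, y3, b1, b2, b3]; rfl)
    (by rw [h.patch_j, g4]) (by rw [patch_of_ne hib.ne' hjb.ne' hkb.ne', hb])
  rw [BoxImage, h.monomials_k, monomials_other hib.ne' hjb.ne' hkb.ne', y1, y2]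
  rw [g5, ← sub_eq_zero] at this
  rw [← sub_eq_zero, ← this]
  module

theorem boxImage_below_middle (h : ThreeMove w w' i j k) (hw : IsReducedWord w)
    (hw' : IsReducedWord w') (hDE : ∀ d, Corresponds pieceTable i j k d (D d) (E d))
    (hkb : k < bot) (hbox : BoxCondition w' j bot p₁ p₂) : BoxImage i j k D E j bot p₁ p₂ := by
  obtain ⟨hB, heq, ht, hb⟩ := hbox
  have hjb := h.lt_jk.trans hkb
  have hib := h.lt_ik.trans hkb
  obtain ⟨s₁, hs₁, e₁⟩ := h.exists_row hw hw' p₁.2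
  obtain ⟨s₂, hs₂, e₂⟩ := h.exists_row hw hw' p₂.2
  have hp := piece_eq (i := i) (j := j) (k := k) heq
  obtain ⟨x1, x2, x3⟩ := h.symm.lambda_of_after hkb
  obtain ⟨y1, y2, y3⟩ := h.lambda_of_after hkb
  obtain ⟨-, ⟨a1, a2, a3⟩, -⟩ := h.symm.lambda_values
  obtain ⟨-, -, b1, b2, b3⟩ := h.lambda_values
  rw [a1, a2, a3, x1, x2, x3, ← e₁, ← e₂] at hp
  obtain ⟨r₁, hr₁, r₂, hr₂, g₁, g₂, g3, g4, g5⟩ := rows_box_below_middle s₁ hs₁ s₂ hs₂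
    (by rw [e₁, ht]) (by rw [hp]; rfl)
  have := monomials_box h hw hw' hDE hr₁ hr₂ (g₁.trans e₁) (g₂.trans e₂) (t := k) (b := bot)
    (h.isBox_below hB hkb (Or.inr (Or.inl rfl)) (Or.inr rfl) (h.same.trans h.middle.symm))
    (fun q hi hj hk => by
      obtain ⟨l1, -, l2, -, l3⟩ := h.lambda_outside hi hj hk
      rw [← l1 bot hib.ne' hjb.ne' hkb.ne', l3, ← l2]
      exact congrFun heq q)
    (by rw [g3, y1, y2, y3, b1, b2, b3]; rfl)
    (by rw [h.patch_k, g4]) (by rw [patch_of_ne hib.ne' hjb.ne' hkb.ne', hb])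
  rw [BoxImage, h.monomials_j, monomials_other hib.ne' hjb.ne' hkb.ne', y1, y2]
  rw [g5, ← sub_eq_zero] at this
  rw [← sub_eq_zero, ← this]
  module

theorem lambda_of_before (h : ThreeMove w w' i j k) {l : Fin N} (hl : l < i) (hi : w l ≠ w i)
    (hj : w l ≠ w j) :
    lambdaExponent w l i = (if (w i : ℕ) + 1 = w l ∨ (w l : ℕ) + 1 = w i then -1 else 0) ∧
    lambdaExponent w l j = (if (w j : ℕ) + 1 = w l ∨ (w l : ℕ) + 1 = w j then -1 else 0) := by
  have hlj := hl.trans h.lt_ij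
  simp [lambdaExponent, hl.ne', hl.not_gt, hlj.ne', hlj.not_gt, hi.symm, hj.symm]

/-- The box is the same in both words. Only the piece of `λ_top - λ_bot` matters: it is `(A, B, A)`
for `w` and `(B, A, B)` for `w'`, with `(A, B)` equal to `(0, 0)`, `(-1, 0)` or `(0, -1)`. -/
theorem boxImage_apart (h : ThreeMove w w' i j k) (hw : IsReducedWord w)
    (hw' : IsReducedWord w') (hDE : ∀ d, Corresponds pieceTable i j k d (D d) (E d))
    (hti : top ≠ i) (htj : top ≠ j) (htk : top ≠ k) (hbi : bot ≠ i) (hbj : bot ≠ j) (hbk : bot ≠ k)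
    (hbox : BoxCondition w' top bot p₁ p₂) : BoxImage i j k D E top bot p₁ p₂ := by
  obtain ⟨hB, heq, ht, hb⟩ := hbox
  have hB' := h.isBox_apart hB hti htj htk hbi hbj hbk
  have hc : w top = w bot := hB'.2.1
  obtain ⟨s₁, hs₁, e₁⟩ := h.exists_row hw hw' p₁.2
  obtain ⟨s₂, hs₂, e₂⟩ := h.exists_row hw hw' p₂.2
  have hp := piece_eq (i := i) (j := j) (k := k) heq
  obtain ⟨t1, t2, t3, t4⟩ := h.lambda_piece hti htj htk
  obtain ⟨b1, b2, b3, b4⟩ := h.lambda_piece hbi hbj hbk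
  rw [t1, t2, t3, b1, b2, b3, ← e₁, ← e₂] at hp
  obtain ⟨A, hA⟩ : ∃ A, lambdaExponent w top i - lambdaExponent w bot i = A := ⟨_, rfl⟩
  obtain ⟨B, hAB⟩ : ∃ B, lambdaExponent w top j - lambdaExponent w bot j = B := ⟨_, rfl⟩
  rw [hA, hAB] at hp
  have main : (∃ r₁ ∈ symmetricTable, ∃ r₂ ∈ symmetricTable, r₁.2.1 = s₁.2.1 ∧ r₂.2.1 = s₂.2.1 ∧
      r₂.1 = r₁.1 + (A, B, A) ∧ r₂.2.2 = r₁.2.2 + A - B) → BoxImage i j k D E top bot p₁ p₂ := by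
    rintro ⟨r₁, hr₁, r₂, hr₂, g₁, g₂, g3, g4⟩
    have := monomials_box h hw hw' hDE hr₁ hr₂ (g₁.trans e₁) (g₂.trans e₂) hB'
      (fun q hi hj hk => by
        obtain ⟨l1, -⟩ := h.lambda_outside hi hj hk
        rw [← l1 top hti htj htk, ← l1 bot hbi hbj hbk]
        exact congrFun heq q)
      (by rw [g3, t4, b4, hA, hAB]) (by rw [patch_of_ne hti htj htk, ht])
      (by rw [patch_of_ne hbi hbj hbk, hb])
    rw [BoxImage, monomials_other hti htj htk, monomials_other hbi hbj hbk]
    rw [g4, ← hA, ← hAB, ← sub_eq_zero] at this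
    rw [← sub_eq_zero, ← this]
    module
  have apart : A = 0 → B = 0 → BoxImage i j k D E top bot p₁ p₂ := by
    rintro rfl rfl
    obtain ⟨r₁, hr₁, r₂, hr₂, g₁, g₂, g3, g4⟩ := rows_box_apart s₁ hs₁ s₂ hs₂ (by rw [hp]; simp)
    exact main ⟨r₁, hr₁, r₂, hr₂, g₁, g₂, by rw [g3]; simp, by rw [g4]; simp⟩
  -- A box wholly above the move contributes equal pieces at its two ends, one wholly below
  -- contributes none. Only a box spanning the move remains, and its column is neither column of the
  -- move.
  rcases h.lt_cases hbi hbj hbk with ⟨c1, c2, -⟩ | ⟨c1, c2, c3⟩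
  · have hlt := hB.1
    have key : ∀ q, bot < q → lambdaExponent w top q - lambdaExponent w bot q = 0 := fun q hq => by
      rw [sub_eq_zero]
      exact lambda_congr (iff_of_false (hlt.trans hq).ne' hq.ne')
        (iff_of_false (hlt.trans hq).not_gt hq.not_gt) hc rfl
    exact apart (hA.symm.trans (key i c1)) (hAB.symm.trans (key j c2))
  obtain ⟨z1, z2, -⟩ := h.lambda_of_after c3
  rw [z1, sub_zero] at hA
  rw [z2, sub_zero] at hAB
  rcases h.lt_cases hti htj htk with ⟨u1, u2, u3⟩ | ⟨-, -, u3⟩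
  swap
  · obtain ⟨z1, z2, -⟩ := h.lambda_of_after u3
    exact apart (hA.symm.trans z1) (hAB.symm.trans z2)
  have hto := h.other top hti htj htk
  have n1 : w top ≠ w i := fun e => hB.2.2 j u2 c2 (by rw [h.middle, hto, e])
  have n2 : w top ≠ w j := fun e => hB.2.2 i u1 c1 (by rw [h.left, hto, e])
  obtain ⟨v1, v2⟩ := h.lambda_of_before u1 n1 n2
  have n1' : (w top : ℕ) ≠ w i := fun e => n1 (Fin.ext e)
  have n2' : (w top : ℕ) ≠ w j := fun e => n2 (Fin.ext e)
  have hadj := h.adjacent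
  by_cases q1 : (w i : ℕ) + 1 = w top ∨ (w top : ℕ) + 1 = w i
  -- The two columns of the move are adjacent to each other, so by parity no column is adjacent to
  -- both.
  · have q2 : ¬ ((w j : ℕ) + 1 = w top ∨ (w top : ℕ) + 1 = w j) := by omega
    rw [if_pos q1, hA] at v1
    rw [if_neg q2, hAB] at v2
    subst v1 v2
    obtain ⟨r₁, hr₁, r₂, hr₂, g₁, g₂, g3, g4⟩ := rows_box_beside_middle s₁ hs₁ s₂ hs₂ hp
    exact main ⟨r₁, hr₁, r₂, hr₂, g₁, g₂, g3, by rw [g4]; ring⟩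
  rw [if_neg q1, hA] at v1
  by_cases q2 : (w j : ℕ) + 1 = w top ∨ (w top : ℕ) + 1 = w j
  · rw [if_pos q2, hAB] at v2
    subst v1 v2
    -- The box is adjacent to the two outer crossings in `w'`, and the single bad pair of pieces
    -- must be excluded. Since the column of the box is not `w i`, the side on which it lies
    -- determines which kind of triangle `w'` has.
    obtain ⟨r₁, hr₁, r₂, hr₂, g₁, g₂, g3, g4⟩ := rows_box_beside_outer s₁ hs₁ s₂ hs₂ hp (by
      rintro ⟨f1, f2⟩
      rw [e₁] at f1
      rw [e₂] at f2
      have hl := congrArg Fin.val h.left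
      have hto := congrArg Fin.val hto
      obtain ⟨x, y, z, hT⟩ : ∃ x y z, ((w' i : ℕ) = w' top + 1 ∧ IsFirst w' i j k x y z) ∨
          ((w' top : ℕ) = w' i + 1 ∧ IsSecond w' i j k x y z) := by
        rcases hadj with ha | ha
        · obtain ⟨x, y, z, -, hT⟩ := h.triangles_of_lt hw ha
          exact ⟨x, y, z, Or.inr ⟨by omega, hT⟩⟩
        · obtain ⟨x, y, z, hT, -⟩ :=
            h.symm.triangles_of_lt hw' (by rw [h.left, h.middle]; exact ha)
          exact ⟨x, y, z, Or.inl ⟨by omega, hT⟩⟩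
      exact exclusion_of_box hw' hT (h.right.trans h.left.symm) hB heq u1 c3 p₁.2 p₂.2 f1 f2)
    exact main ⟨r₁, hr₁, r₂, hr₂, g₁, g₂, g3, by rw [g4]; ring⟩
  · rw [if_neg q2, hAB] at v2
    exact apart v1 v2

theorem substitution_box (h : ThreeMove w w' i j k) (hw : IsReducedWord w)
    (hw' : IsReducedWord w') (hDE : ∀ d, Corresponds pieceTable i j k d (D d) (E d))
    (hbox : BoxCondition w' top bot p₁ p₂) :
    substitution (monomials i j k D E) (boxVector w' top bot p₁ p₂) ∈ boxGroup w := by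
  rw [← boxQuot_eq_zero, boxVector, map_sub, map_add, map_add, map_sub, map_add, map_add]
  simp only [substitution_single, one_smul]
  rw [sub_eq_zero]
  change BoxImage i j k D E top bot p₁ p₂
  have hB := hbox.1
  have hlt := hB.1
  have hij := h.lt_ij
  have hjk := h.lt_jk
  have hne : w' i ≠ w' j := h.symm.ne_columns
  have hki : w' k = w' i := h.right.trans h.left.symm
  by_cases hti : top = i
  · subst hti
    have hbk : bot = k := by
      by_contra hne'
      rcases lt_or_gt_of_ne hne' with hb | hb
      · rcases h.eq_of_mem_Icc hlt.le hb.le with rfl | rfl | rfl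
        · exact lt_irrefl _ hlt
        · exact hne hB.2.1
        · exact hne' rfl
      · exact hB.2.2 k h.lt_ik hb hki
    subst hbk
    exact h.boxImage_small hw hw' hDE hbox
  by_cases htj : top = j
  · subst htj
    have hkb : k < bot := by
      by_contra hle
      rcases h.eq_of_mem_Icc (hij.trans hlt).le (not_lt.1 hle) with rfl | rfl | rfl
      · exact hlt.not_gt hij
      · exact lt_irrefl _ hlt
      · exact hne (hki.symm.trans hB.2.1.symm)
    exact h.boxImage_below_middle hw hw' hDE hkb hbox
  by_cases htk : top = k
  · subst htk
    exact h.boxImage_below_right hw hw' hDE hbox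
  by_cases hbi : bot = i
  · subst hbi
    exact h.boxImage_above_left hw hw' hDE hbox
  by_cases hbj : bot = j
  · subst hbj
    rcases h.lt_cases hti htj htk with c | c
    · exact h.boxImage_above_middle hw hw' hDE c.1 hbox
    · exact absurd c.2.1 hlt.not_gt
  by_cases hbk : bot = k
  · subst hbk
    rcases h.lt_cases hti htj htk with c | c
    -- No box from above the move ends at `t_k`, because `t_i` lies in the same column in between.
    · exact absurd (hki.symm.trans hB.2.1.symm) (hB.2.2 i c.1 h.lt_ik)
    · exact absurd c.2.2 hlt.not_gt
  exact h.boxImage_apart hw hw' hDE hti htj htk hbi hbj hbk hbox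

theorem isoByMonomials (h : ThreeMove w w' i j k) (hw : IsReducedWord w)
    (hw' : IsReducedWord w') :
    IsoByMonomials w w' (CoeffRule₃ w w' i j k) (CoeffRule₃ w' w i j k) := by
  choose D E hDE using h.exists_corresponds hw hw'
  choose D' E' hDE' using h.symm.exists_corresponds hw' hw
  exact isoByMonomials_of_substitution (h.coeffRule_iff hDE) (h.symm.coeffRule_iff hDE')
    (fun _ _ _ _ => h.substitution_box hw hw' hDE)
    (fun _ _ _ _ => h.symm.substitution_box hw' hw hDE')
    (h.substitution_monomials hDE hDE') (h.symm.substitution_monomials hDE' hDE)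

end ThreeMove

end

/-! ### The parameter spaces under a 2-move -/

section

variable {n N : ℕ} {w w' : Fin N → Fin n}

namespace TwoMove

variable {i j : Fin N}

theorem apply_swap (h : TwoMove w w' i j) (q : Fin N) : w (Equiv.swap i j q) = w' q := by
  rcases eq_or_ne q i with rfl | hi
  · rw [Equiv.swap_apply_left, h.left]
  rcases eq_or_ne q j with rfl | hj
  · rw [Equiv.swap_apply_right, h.right]
  rw [Equiv.swap_apply_of_ne_of_ne hi hj, h.other q hi hj]

theorem swap_lt_swap (h : TwoMove w w' i j) {p q : Fin N} (hpq : p < q)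
    (hne : ¬ (p = i ∧ q = j)) : Equiv.swap i j p < Equiv.swap i j q := by
  have := h.hj
  simp only [Equiv.swap_apply_def]
  simp only [Fin.lt_def, Fin.ext_iff] at *
  split_ifs <;> omega

theorem swap_lt_swap_iff (h : TwoMove w w' i j) {p q : Fin N}
    (h₁ : ¬ (p = i ∧ q = j)) (h₂ : ¬ (p = j ∧ q = i)) :
    Equiv.swap i j p < Equiv.swap i j q ↔ p < q := by
  have := h.hj
  simp only [Equiv.swap_apply_def]
  simp only [Fin.lt_def, Fin.ext_iff] at *
  split_ifs <;> omega

/-- The transposition preserves columns, and it preserves order except for the pair `i`, `j`. For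
that pair the exponent is `0` in either order, as the columns are far apart. -/
theorem lambda_swap (h : TwoMove w w' i j) (l q : Fin N) :
    lambdaExponent w (Equiv.swap i j l) (Equiv.swap i j q) = lambdaExponent w' l q := by
  have hlt : i < j := by rw [Fin.lt_def, h.hj]; omega
  have hfar := h.far
  have hfar' := h.symm.far
  have hne : w j ≠ w i := fun e => by rw [e] at hfar; omega
  have hne' : w' j ≠ w' i := fun e => by rw [e] at hfar'; omega
  by_cases h₁ : q = i ∧ l = j
  · obtain ⟨rfl, rfl⟩ := h₁
    rw [Equiv.swap_apply_left, Equiv.swap_apply_right, lambda_of_lt hlt,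
      lambda_of_far hlt hne (by omega)]
  by_cases h₂ : q = j ∧ l = i
  · obtain ⟨rfl, rfl⟩ := h₂
    rw [Equiv.swap_apply_left, Equiv.swap_apply_right, lambda_of_lt hlt,
      lambda_of_far hlt hne' (by omega)]
  · exact lambda_congr (Equiv.swap i j).injective.eq_iff (h.swap_lt_swap_iff h₁ h₂)
      (h.apply_swap l) (h.apply_swap q)

/-- Only crossings in one column are compared, and `t_i`, `t_j` are never both among them, so the
relevant order survives the transposition. -/
theorem isBox_swap (h : TwoMove w w' i j) {top bot : Fin N} (hB : IsBox w' top bot) :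
    IsBox w (Equiv.swap i j top) (Equiv.swap i j bot) := by
  obtain ⟨h1, h2, h3⟩ := hB
  have hfar' := h.symm.far
  have hne' : w' i ≠ w' j := fun e => by rw [e] at hfar'; omega
  refine ⟨h.swap_lt_swap h1 ?_, by rw [h.apply_swap, h.apply_swap, h2], fun r hr1 hr2 => ?_⟩
  · rintro ⟨rfl, rfl⟩
    exact hne' h2
  · obtain ⟨r, rfl⟩ := (Equiv.swap i j).surjective r
    rw [h.apply_swap, h.apply_swap]
    intro e
    have key : ∀ {a b : Fin N}, w' a = w' b → ¬ (a = i ∧ b = j) ∧ ¬ (a = j ∧ b = i) := by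
      intro a b e
      refine ⟨?_, ?_⟩
      · rintro ⟨rfl, rfl⟩; exact hne' e
      · rintro ⟨rfl, rfl⟩; exact hne' e.symm
    obtain ⟨a1, a2⟩ := key e.symm
    obtain ⟨b1, b2⟩ := key (e.trans h2)
    exact h3 r ((h.swap_lt_swap_iff a1 a2).1 hr1) ((h.swap_lt_swap_iff b1 b2).1 hr2) e

/-- The string exponent of `w` obtained by exchanging the coordinates `i` and `j`. -/
def strSwap (h : TwoMove w w' i j) (hw : IsReducedWord w) (hw' : IsReducedWord w')
    (d : stringExponents w') : stringExponents w :=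
  ⟨fun q => d.1 (Equiv.swap i j q), h.mem_stringExponents hw hw' d.2⟩

theorem boxCondition_swap (h : TwoMove w w' i j) (hw : IsReducedWord w) (hw' : IsReducedWord w')
    {top bot : Fin N} {p₁ p₂ : stringExponents w'} (hB : BoxCondition w' top bot p₁ p₂) :
    BoxCondition w (Equiv.swap i j top) (Equiv.swap i j bot) (h.strSwap hw hw' p₁)
      (h.strSwap hw hw' p₂) := by
  obtain ⟨hbox, heq, ht, hb⟩ := hB
  refine ⟨h.isBox_swap hbox, funext fun q => ?_, ?_, ?_⟩
  · obtain ⟨q, rfl⟩ := (Equiv.swap i j).surjective q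
    simp only [Pi.add_apply, strSwap, Equiv.swap_apply_self, h.lambda_swap]
    exact congrFun heq q
  · simpa only [strSwap, Equiv.swap_apply_self] using ht
  · simpa only [strSwap, Equiv.swap_apply_self] using hb

/-- The monomials of a 2-move. -/
def monomials (h : TwoMove w w' i j) (hw : IsReducedWord w) (hw' : IsReducedWord w') :
    Ineq w' → (Ineq w →₀ ℤ)
  | Sum.inl l => Finsupp.single (Sum.inl (Equiv.swap i j l)) 1
  | Sum.inr d => Finsupp.single (Sum.inr (h.strSwap hw hw' d)) 1

theorem coeffRule_iff (h : TwoMove w w' i j) (hw : IsReducedWord w) (hw' : IsReducedWord w')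
    (d : Ineq w') (u : Ineq w →₀ ℤ) : CoeffRule₂ w w' i j d u ↔ u = h.monomials hw hw' d := by
  constructor
  · rintro (l | ⟨d', d, hd⟩)
    · rfl
    · have : d = h.strSwap hw hw' d' := Subtype.ext (funext fun q => by
        simp only [strSwap, hd, Equiv.swap_apply_self])
      rw [this]
      rfl
  · rintro rfl
    rcases d with l | d
    · exact .lam l
    · exact .str d _ fun q => by simp only [strSwap, Equiv.swap_apply_self]

/-- Relabelling by the transposition turns each box equation into a single box equation, so no work
modulo the others is needed. -/
theorem substitution_box (h : TwoMove w w' i j) (hw : IsReducedWord w) (hw' : IsReducedWord w')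
    {top bot : Fin N} {p₁ p₂ : stringExponents w'} (hB : BoxCondition w' top bot p₁ p₂) :
    substitution (h.monomials hw hw') (boxVector w' top bot p₁ p₂) ∈ boxGroup w := by
  refine AddSubgroup.subset_closure ⟨_, _, _, _, h.boxCondition_swap hw hw' hB, ?_⟩
  rw [boxVector, map_sub, map_add, map_add]
  simp only [substitution_single, one_smul]
  rfl

theorem substitution_monomials (h : TwoMove w w' i j) (hw : IsReducedWord w)
    (hw' : IsReducedWord w') (d : Ineq w') :
    substitution (h.symm.monomials hw' hw) (h.monomials hw hw' d) - Finsupp.single d 1 ∈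
      boxGroup w' := by
  rcases d with l | d
  · simp only [monomials, substitution_single, one_smul, Equiv.swap_apply_self, sub_self, zero_mem]
  · simp only [monomials, substitution_single, one_smul, strSwap, Equiv.swap_apply_self,
      Subtype.coe_eta, sub_self, zero_mem]

theorem isoByMonomials (h : TwoMove w w' i j) (hw : IsReducedWord w) (hw' : IsReducedWord w') :
    IsoByMonomials w w' (CoeffRule₂ w w' i j) (CoeffRule₂ w' w i j) :=
  isoByMonomials_of_substitution (h.coeffRule_iff hw hw') (h.symm.coeffRule_iff hw' hw)
    (fun _ _ _ _ => h.substitution_box hw hw') (fun _ _ _ _ => h.symm.substitution_box hw' hw)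
    (h.substitution_monomials hw hw') (h.symm.substitution_monomials hw' hw)

end TwoMove

end

end StringDiagram

end

theorem proposition4p8 {n N : ℕ} (w w' : Fin N → Fin n)
    (hw : StringDiagram.IsReducedWord w) (hw' : StringDiagram.IsReducedWord w') :
    (∀ i j : Fin N, StringDiagram.TwoMove w w' i j →
      StringDiagram.IsoByMonomials w w'
        (StringDiagram.CoeffRule₂ w w' i j) (StringDiagram.CoeffRule₂ w' w i j)) ∧
    (∀ i j k : Fin N, StringDiagram.ThreeMove w w' i j k →
      StringDiagram.IsoByMonomials w w'
        (StringDiagram.CoeffRule₃ w w' i j k) (StringDiagram.CoeffRule₃ w' w i j k)) :=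
  ⟨fun _ _ h => h.isoByMonomials hw hw', fun _ _ _ h => h.isoByMonomials hw hw'⟩
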